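/- Let $n_1,n_2\ge 0$ be integers, $\hbar\in\mathbb C$, $q^x:=e^{\hbar x}$, and assume $q^m\neq1$ for $1\le m\le n_1+n_2+1$. Put $[x]=\frac{q^{x/2}-q^{-x/2}}{q^{1/2}-q^{-1/2}}$, $[n]!=[1]\cdots[n]$, $1/[n]!=0$ for $n<0$; $\sqrt{[m]}$ is the principal root, and roots of products and quotients of $q$-numbers are products and quotients of these. **Conventions.** $U_q(\mathfrak{sl}_3)$ has generators $H_{\alpha_i},E^\pm_{\alpha_i}$ ($i=1,2$), with $[H_{\alpha_i},H_{\alpha_j}]=0$, $[H_{\alpha_i},E^\pm_{\alpha_j}]=\pm(\alpha_i\cdot\alpha_j)E^\pm_{\alpha_j}$, $[E^+_{\alpha_i},E^-_{\alpha_j}]=\delta_{ij}[2H_{\alpha_i}]$, the $q$-Serre relations $(E_{\alpha_i}^\pm)^2E_{\alpha_j}^\pm-[2]E_{\alpha_i}^\pm E_{\alpha_j}^\pm E_{\alpha_i}^\pm+E_{\alpha_j}^\pm(E_{\alpha_i}^\pm)^2=0$ ($i\ne j$), where $\alpha_i\cdot\alpha_i=1$, $\alpha_1\cdot\alpha_2=-\frac12$,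 and coproduct $\Delta H=H\otimes1+1\otimes H$, $\Delta E^\pm=E^\pm\otimes q^{H/2}+q^{-H/2}\otimes E^\pm$. Fundamental weights satisfy $\mu_i\cdot\alpha_j=\frac12\delta_{ij}$. For a weight $\omega=n\mu_1+m\mu_2-A\alpha_1-B\alpha_2$ of the irreducible representation $(n,m)$ of highest weight $n\mu_1+m\mu_2$ put $m^{(i)}(\omega)=\omega\cdot\alpha_i$, $j^{(1)}(\omega)=(n\mu_1+m\mu_2-\max(B-m,0)\alpha_1-B\alpha_2)\cdot\alpha_1$, $j^{(2)}(\omega)=(n\mu_1+m\mu_2-A\alpha_1-\max(A-n,0)\alpha_2)\cdot\alpha_2$. The representation $(n,0)$ has basis states $|\omega\rangle$, $\omega=n\mu_1-A\alpha_1-B\alpha_2$, $0\le B\le A\le n$, with $H_{\alpha_i}|\omega\rangle=m^{(i)}|\omega\rangle$ and $E^\pm_{\alpha_i}|\omega\rangle=\sqrt{[j^{(i)}\mp m^{(i)}][j^{(i)}\pm m^{(i)}+1]}\,|\omega\pm\alpha_i\rangle$. On $(n_1,0)\otimes(n_2,0)$, $\langle\cdot,\cdot\rangle$ is the bilinear pairing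 for which the products of basis states are orthonormal. For $0\le s\le\min(n_1,n_2)$ let $\Lambda=\Lambda^{(s)}=(n_1+n_2-2s)\mu_1+s\mu_2$. The $U_q(\mathfrak{sl}_2)$ $q$-CG coefficients are $$\begin{bmatrix}j_1&j_2&j\\m_1&m_2&m\end{bmatrix}=(-1)^{j_1-m_1}\delta_{m,m_1+m_2}\,q^{\frac14[j_2(j_2+1)-j_1(j_1+1)-j(j+1)]+\frac{m+1}2m_1}\left\{\tfrac{[2j+1][j_1+j_2-j]![j_1-m_1]![j_2-m_2]![j+m]![j-m]!}{[j+j_1+j_2+1]![j+j_1-j_2]![j+j_2-j_1]![j_1+m_1]![j_2+m_2]!}\right\}^{1/2}\sum_{k=0}^{j-m}\tfrac{(-1)^kq^{\frac k2(j+m+1)}[j_2+j-m_1-k]![j_1+m_1+k]!}{[k]![j-m-k]![j_2-j+m_1+k]![j_1-m_1-k]!}.$$ **Claim.** 1. $(n_1,0)$ and $(n_2,0)$ are irreducible representations of $U_q(\mathfrak{sl}_3)$ of highest weights $n_1\mu_1$, $n_2\mu_1$, their tensor product is a representation, and $(n_1,0)\otimes(n_2,0)=\bigoplus_{s=0}^{\min(n_1,n_2)}V^{(s)}$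 with $V^{(s)}$ irreducible of highest weight $\Lambda^{(s)}$. 2. The highest weight vectors $v$ of weight $\Lambda^{(s)}$ in the tensor product with $\langle v,v\rangle=1$ are exactly $\pm|\Lambda\rangle$, where $|\Lambda\rangle=\sum_{k_1+k_2=s}C_{k_1,k_2}\,|n_1\mu_1-k_1\alpha_1\rangle\otimes|n_2\mu_1-k_2\alpha_1\rangle$ (over $0\le k_i\le n_i$) and $C_{k_1,k_2}$ is the $U_q(\mathfrak{sl}_2)$ $q$-CG coefficient $$C_{k_1,k_2}=\begin{bmatrix}\frac{n_1}2&\frac{n_2}2&\frac{n_1+n_2}2-s\\ \frac{n_1}2-k_1&\frac{n_2}2-k_2&\frac{n_1+n_2}2-s\end{bmatrix},$$ and $V^{(s)}$ is generated by $|\Lambda\rangle$. 3. Let $0\le l_1\le n_1+n_2-2s$, $0\le l_2\le s+l_1$. For the weights of $V^{(s)}$ put $$H_{\alpha_i,l}(\Omega)=\left(\frac{[j^{(i)}+m^{(i)}]!\,[j^{(i)}-m^{(i)}+l]!}{[j^{(i)}+m^{(i)}-l]!\,[j^{(i)}-m^{(i)}]!}\right)^{1/2}\ (\text{at }\Omega),$$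 and for weights $\omega_1,\omega_2$ of $(n_1,0),(n_2,0)$, writing $j_a=j^{(i)}(\omega_a)$, $m_a=m^{(i)}(\omega_a)$ and $l=x+y$, $$F^{x,y}_{\alpha_i,l}(\omega_1,\omega_2)=q^{\frac12(xm_2-ym_1)}\frac{[x+y]!}{[x]![y]!}\left(\frac{[j_2+m_2]![j_1+m_1]!}{[j_2-m_2]![j_1-m_1]!}\right)^{1/2}\left(\frac{[j_2-m_2+y]![j_1-m_1+x]!}{[j_2+m_2-y]![j_1+m_1-x]!}\right)^{1/2}.$$ Then the state $$|\Lambda,\Lambda-l_1\alpha_1-l_2\alpha_2\rangle:=\frac{(-1)^s\,(E^-_{\alpha_2})^{l_2}(E^-_{\alpha_1})^{l_1}|\Lambda\rangle}{H_{\alpha_1,l_1}(\Lambda)H_{\alpha_2,l_2}(\Lambda-l_1\alpha_1)}$$ (where $(-1)^s$ is a choice of sign) has $\langle\cdot,\cdot\rangle$-square $1$, and its coefficient on $|n_1\mu_1-A_1\alpha_1-B_1\alpha_2\rangle\otimes|n_2\mu_1-A_2\alpha_1-B_2\alpha_2\rangle$ is $$\sum(-1)^s\,C_{k_1,k_2}\,\frac{F^{x_1,y_1}_{\alpha_1,l_1}(\omega_1,\omega_2)}{H_{\alpha_1,l_1}(\Lambda)}\,\frac{F^{x_2,y_2}_{\alpha_2,l_2}(\omega_1-x_1\alpha_1,\omega_2-y_1\alpha_1)}{H_{\alpha_2,l_2}(\Lambda-l_1\alpha_1)},\qquad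 \omega_a=n_a\mu_1-k_a\alpha_1,$$ summed over all non-negative integers with $k_1+k_2=s$, $x_i+y_i=l_i$, $k_1+x_1=A_1$, $k_2+y_1=A_2$, $x_2=B_1$, $y_2=B_2$. 4. Let $E^-_{\alpha_3}=E^-_{\alpha_2}E^-_{\alpha_1}-q^{\varepsilon/2}E^-_{\alpha_1}E^-_{\alpha_2}$ with $\varepsilon=1$ or $\varepsilon=-1$. For $A,B\ge0$ let $\mu$ be the multiplicity of the weight $\Lambda-A\alpha_1-B\alpha_2$ in $V^{(s)}$. The vectors $$v_c=(E^-_{\alpha_3})^{B-c}(E^-_{\alpha_1})^{A-B}(E^-_{\alpha_2})^c(E^-_{\alpha_1})^c|\Lambda\rangle\ (A\ge B),\qquad v_c=(E^-_{\alpha_3})^{A-c}(E^-_{\alpha_2})^{B-A}(E^-_{\alpha_2})^c(E^-_{\alpha_1})^c|\Lambda\rangle\ (A<B),$$ $0\le c<\mu$, form a basis of this weight space. Given $n_1,n_2$, for all values of $q^{1/2}=e^{\hbar/2}$ outside a finite set which contains no positive real number other than possibly $1$, the Gram–Schmidt procedure for $\langle\cdot,\cdot\rangle$, applied to $v_0,\dots,v_{\mu-1}$,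 turns them into an orthonormal basis of the weight space. For the same values, if $s\ge1$ and $1\le l\le n_1+n_2-2s$, the states $(E^-_{\alpha_3})^l|\Lambda\rangle$ and $|\Lambda,\Lambda-l\alpha_1-l\alpha_2\rangle$ are linearly independent, and Gram–Schmidt, applied to them in this order, gives an orthonormal pair. -/

import Mathlib

open scoped Kronecker

noncomputable section

namespace QuantumSl3

/-! ### q-numbers

The deformation parameter is `q = exp ħ` with `ħ : ℂ`, and `q ^ x` means `exp (ħ x)`. -/

/-- `q ^ x` for a rational exponent `x`. -/
def qPow (ħ : ℂ) (x : ℚ) : ℂ := Complex.exp (ħ * (x : ℂ))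

/-- The q-number `[x] = (q^{x/2} - q^{-x/2}) / (q^{1/2} - q^{-1/2})`. -/
def qNum (ħ : ℂ) (x : ℚ) : ℂ :=
  (qPow ħ (x / 2) - qPow ħ (-x / 2)) / (qPow ħ (1 / 2) - qPow ħ (-1 / 2))

/-- The square root `√[x]` of a q-number (principal branch; it is the usual positive root when
`[x] > 0`). Square roots of products and quotients of q-numbers are always formed as the
products and quotients of these roots. -/
def qSqrt (ħ : ℂ) (x : ℚ) : ℂ := qNum ħ x ^ (1 / 2 : ℂ)

/-- The q-factorial `[x]! = [1] [2] ⋯ [x]` of an integer `x ≥ 0`, with the value `0` at negative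
`x`. Negative arguments matter only in denominators, where Lean's `a / 0 = 0` then is
the usual convention `1 / [x]! = 0` for `x < 0`. -/
def qFact (ħ : ℂ) (x : ℚ) : ℂ := if x < 0 then 0 else ∏ m ∈ Finset.Icc 1 ⌊x⌋₊, qNum ħ m

/-- The square root of `[x]!`, with the same convention for negative `x`. -/
def qSqrtFact (ħ : ℂ) (x : ℚ) : ℂ := if x < 0 then 0 else ∏ m ∈ Finset.Icc 1 ⌊x⌋₊, qSqrt ħ m

/-! ### The q-CG coefficients of `U_q(sl₂)` -/

/-- The `U_q(sl₂)` q-CG coefficient for spins `j₁ ⊗ j₂ → j` and magnetic numbers `m₁, m₂, m`. -/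
def cgSl2 (ħ : ℂ) (j₁ m₁ j₂ m₂ j m : ℚ) : ℂ :=
  if m = m₁ + m₂ then
    (-1 : ℂ) ^ ⌊j₁ - m₁⌋
      * qPow ħ ((j₂ * (j₂ + 1) - j₁ * (j₁ + 1) - j * (j + 1)) / 4 + (m + 1) / 2 * m₁)
      * ((qSqrt ħ (2 * j + 1) * qSqrtFact ħ (j₁ + j₂ - j) * qSqrtFact ħ (j₁ - m₁)
            * qSqrtFact ħ (j₂ - m₂) * qSqrtFact ħ (j + m) * qSqrtFact ħ (j - m))
          / (qSqrtFact ħ (j + j₁ + j₂ + 1) * qSqrtFact ħ (j + j₁ - j₂)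
            * qSqrtFact ħ (j + j₂ - j₁) * qSqrtFact ħ (j₁ + m₁) * qSqrtFact ħ (j₂ + m₂)))
      * ∑ k ∈ Finset.range (⌊j - m⌋₊ + 1),
          ((-1 : ℂ) ^ k * qPow ħ ((k : ℚ) / 2 * (j + m + 1))
              * qFact ħ (j₂ + j - m₁ - k) * qFact ħ (j₁ + m₁ + k))
            / (qFact ħ k * qFact ħ (j - m - k) * qFact ħ (j₂ - j + m₁ + k)
              * qFact ħ (j₁ - m₁ - k))
  else 0

/-! ### Weights

The simple roots are `α₁, α₂` (indices `0, 1 : Fin 2`), normalised by `αᵢ·αᵢ = 1`,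
`α₁·α₂ = -1/2`, and `μ₁, μ₂` are the fundamental weights, `μᵢ·αⱼ = δᵢⱼ/2`. -/

/-- `αᵢ · αⱼ`. -/
def rootDot (i j : Fin 2) : ℚ := if i = j then 1 else -1 / 2

/-- `m^{(i)}(ω) = ω · αᵢ` for the weight `ω = n μ₁ + m μ₂ - A α₁ - B α₂`. -/
def magM (i : Fin 2) (n m A B : ℕ) : ℚ :=
  (![(n : ℚ), (m : ℚ)] i) / 2 - A * rootDot 0 i - B * rootDot 1 i

/-- `j^{(i)}(ω)` for the weight `ω = n μ₁ + m μ₂ - A α₁ - B α₂` of the representation `(n, m)`: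
`j^{(1)} = (n μ₁ + m μ₂ - max (B-m) 0 α₁ - B α₂)·α₁` and
`j^{(2)} = (n μ₁ + m μ₂ - A α₁ - max (A-n) 0 α₂)·α₂`
(the subtractions below are truncated subtractions of natural numbers). -/
def spinJ (i : Fin 2) (n m A B : ℕ) : ℚ :=
  if i = 0 then magM 0 n m (B - m) B else magM 1 n m A (A - n)

/-! ### Representations of `U_q(sl₃)` in coordinates -/

/-- Operators `H_{αᵢ}`, `E⁺_{αᵢ}`, `E⁻_{αᵢ}` on the space `ι → ℂ` with basis `ι`.
They form a representation of `U_q(sl₃)` if `IsRep` below holds. -/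
structure Ops (ι : Type) where
  H : Fin 2 → Matrix ι ι ℂ
  Ep : Fin 2 → Matrix ι ι ℂ
  Em : Fin 2 → Matrix ι ι ℂ

variable {ι κ : Type} [Fintype ι] [DecidableEq ι] [Fintype κ] [DecidableEq κ]

/-- The operator `q ^ (c X)`. -/
def qPowMat (ħ : ℂ) (c : ℚ) (X : Matrix ι ι ℂ) : Matrix ι ι ℂ :=
  NormedSpace.exp ((ħ * (c : ℂ)) • X)

/-- The operator `[2X]`, the q-number of `2X`. -/
def qNumTwoMat (ħ : ℂ) (X : Matrix ι ι ℂ) : Matrix ι ι ℂ :=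
  (qPow ħ (1 / 2) - qPow ħ (-1 / 2))⁻¹ • (qPowMat ħ 1 X - qPowMat ħ (-1) X)

/-- The defining relations of `U_q(sl₃)`, including the q-Serre relations. -/
structure IsRep (ħ : ℂ) (R : Ops ι) : Prop where
  H_comm : ∀ i j, R.H i * R.H j = R.H j * R.H i
  H_Ep : ∀ i j, R.H i * R.Ep j - R.Ep j * R.H i = (rootDot i j : ℂ) • R.Ep j
  H_Em : ∀ i j, R.H i * R.Em j - R.Em j * R.H i = -((rootDot i j : ℂ) • R.Em j)
  Ep_Em : ∀ i j, R.Ep i * R.Em j - R.Em j * R.Ep i = if i = j then qNumTwoMat ħ (R.H i) else 0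
  serre_Ep : ∀ i j, i ≠ j →
    R.Ep i ^ 2 * R.Ep j - qNum ħ 2 • (R.Ep i * R.Ep j * R.Ep i) + R.Ep j * R.Ep i ^ 2 = 0
  serre_Em : ∀ i j, i ≠ j →
    R.Em i ^ 2 * R.Em j - qNum ħ 2 • (R.Em i * R.Em j * R.Em i) + R.Em j * R.Em i ^ 2 = 0

/-- The tensor product of two representations, through the coproduct
`ΔH = H ⊗ 1 + 1 ⊗ H`, `ΔE^± = E^± ⊗ q^{H/2} + q^{-H/2} ⊗ E^±`. -/
def tensor (ħ : ℂ) (R : Ops ι) (R' : Ops κ) : Ops (ι × κ) where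
  H i := R.H i ⊗ₖ (1 : Matrix κ κ ℂ) + (1 : Matrix ι ι ℂ) ⊗ₖ R'.H i
  Ep i := R.Ep i ⊗ₖ qPowMat ħ (1 / 2) (R'.H i) + qPowMat ħ (-1 / 2) (R.H i) ⊗ₖ R'.Ep i
  Em i := R.Em i ⊗ₖ qPowMat ħ (1 / 2) (R'.H i) + qPowMat ħ (-1 / 2) (R.H i) ⊗ₖ R'.Em i

/-- The weights `n μ₁ - A α₁ - B α₂` of the symmetric representation `(n, 0)`, `0 ≤ B ≤ A ≤ n`,
as pairs `(A, B)`. They index the basis states of `(n, 0)`. -/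
abbrev SymIdx (n : ℕ) : Type := {p : Fin (n + 1) × Fin (n + 1) // p.2 ≤ p.1}

/-- The coordinate `A` of the weight `n μ₁ - A α₁ - B α₂`. -/
def SymIdx.A {n : ℕ} (p : SymIdx n) : ℕ := p.1.1

/-- The coordinate `B` of the weight `n μ₁ - A α₁ - B α₂`. -/
def SymIdx.B {n : ℕ} (p : SymIdx n) : ℕ := p.1.2

/-- `m^{(i)}` of a state of `(n, 0)`. -/
def SymIdx.m {n : ℕ} (p : SymIdx n) (i : Fin 2) : ℚ := magM i n 0 p.A p.B

/-- `j^{(i)}` of a state of `(n, 0)`. -/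
def SymIdx.j {n : ℕ} (p : SymIdx n) (i : Fin 2) : ℚ := spinJ i n 0 p.A p.B

/-- `p.IsLower i p'` : the weight of `p'` is the weight of `p` minus `αᵢ`. -/
def SymIdx.IsLower {n : ℕ} (p : SymIdx n) (i : Fin 2) (p' : SymIdx n) : Prop :=
  p'.A = p.A + (if i = 0 then 1 else 0) ∧ p'.B = p.B + (if i = 1 then 1 else 0)

open Classical in
/-- The symmetric representation `(n, 0)`: on its basis states, `H_{αᵢ} = m^{(i)}` and
`E^±_{αᵢ} |j, m⟩ = √([j ∓ m] [j ± m + 1]) |j, m ± 1⟩` with `j = j^{(i)}`, `m = m^{(i)}`.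
The entry at `(t, u)` is the coefficient of the state `t` in the image of the state `u`. -/
def symRep (ħ : ℂ) (n : ℕ) : Ops (SymIdx n) where
  H i := Matrix.diagonal fun u => ((u.m i : ℚ) : ℂ)
  Ep i := Matrix.of fun t u =>
    if t.IsLower i u then qSqrt ħ (u.j i - u.m i) * qSqrt ħ (u.j i + u.m i + 1) else 0
  Em i := Matrix.of fun t u =>
    if u.IsLower i t then qSqrt ħ (u.j i + u.m i) * qSqrt ħ (u.j i - u.m i + 1) else 0

/-! ### Subrepresentations, highest weights, irreducibility -/

/-- `W` is stable under all generators. -/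
def IsInvariant (R : Ops ι) (W : Submodule ℂ (ι → ℂ)) : Prop :=
  ∀ i, ∀ v ∈ W, (R.H i).mulVec v ∈ W ∧ (R.Ep i).mulVec v ∈ W ∧ (R.Em i).mulVec v ∈ W

/-- The subrepresentation generated by a vector. -/
def generated (R : Ops ι) (v : ι → ℂ) : Submodule ℂ (ι → ℂ) :=
  sInf {W | IsInvariant R W ∧ v ∈ W}

/-- `W` is an irreducible subrepresentation. -/
def IsIrreducibleSub (R : Ops ι) (W : Submodule ℂ (ι → ℂ)) : Prop :=
  IsInvariant R W ∧ W ≠ ⊥ ∧ ∀ W', W' ≤ W → IsInvariant R W' → W' = ⊥ ∨ W' = W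

/-- `v` has weight `n μ₁ + m μ₂ - A α₁ - B α₂` (or is zero). -/
def HasWeight (R : Ops ι) (n m A B : ℕ) (v : ι → ℂ) : Prop :=
  ∀ i, (R.H i).mulVec v = ((magM i n m A B : ℚ) : ℂ) • v

/-- `v` is a highest weight vector of weight `n μ₁ + m μ₂`. -/
def IsHighestWeight (R : Ops ι) (n m : ℕ) (v : ι → ℂ) : Prop :=
  v ≠ 0 ∧ HasWeight R n m 0 0 v ∧ ∀ i, (R.Ep i).mulVec v = 0

/-- The space of vectors of weight `n μ₁ + m μ₂ - A α₁ - B α₂` in a subspace `W`. -/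
def weightSpace (R : Ops ι) (W : Submodule ℂ (ι → ℂ)) (n m A B : ℕ) : Submodule ℂ (ι → ℂ) :=
  W ⊓ ⨅ i : Fin 2, LinearMap.ker
    ((R.H i).mulVecLin - ((magM i n m A B : ℚ) : ℂ) • (LinearMap.id : (ι → ℂ) →ₗ[ℂ] (ι → ℂ)))

/-! ### Orthonormality and Gram–Schmidt

Orthogonality of q-CG coefficients is orthogonality for the bilinear pairing in which the basis
states are orthonormal (no complex conjugation); for real `q > 0` all coefficients are real. -/

/-- The bilinear pairing `⟨v, w⟩ = ∑ v_p w_p`. -/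
def pairing (v w : ι → ℂ) : ℂ := ∑ p, v p * w p

/-- The vector `v` divided by a square root of `⟨v, v⟩`. -/
def normalized (v : ι → ℂ) : ι → ℂ := ((pairing v v) ^ (1 / 2 : ℂ))⁻¹ • v

/-- Gram–Schmidt orthogonalisation of `v 0, v 1, …` with respect to `pairing`. -/
def gramSchmidt (v : ℕ → ι → ℂ) (c : ℕ) : ι → ℂ :=
  v c - ∑ d : Fin c,
    (pairing (gramSchmidt v d) (v c) / pairing (gramSchmidt v d) (gramSchmidt v d))
      • gramSchmidt v d
termination_by c
decreasing_by exact d.2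

/-- Gram–Schmidt orthonormalisation. -/
def gramSchmidtNormed (v : ℕ → ι → ℂ) (c : ℕ) : ι → ℂ := normalized (gramSchmidt v c)

/-! ### The tensor product `(n₁, 0) ⊗ (n₂, 0)` -/

/-- The tensor product `(n₁, 0) ⊗ (n₂, 0)`. The coordinate of a vector at `(p₁, p₂)` is its
coefficient on `|n₁ μ₁, n₁ μ₁ - A₁ α₁ - B₁ α₂⟩ ⊗ |n₂ μ₁, n₂ μ₁ - A₂ α₁ - B₂ α₂⟩`, where
`pₖ = (Aₖ, Bₖ)`. -/
def tensorRep (ħ : ℂ) (n₁ n₂ : ℕ) : Ops (SymIdx n₁ × SymIdx n₂) :=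
  tensor ħ (symRep ħ n₁) (symRep ħ n₂)

/-- The `U_q(sl₂)` q-CG coefficient with spins `n₁/2`, `n₂/2 → (n₁+n₂)/2 - s` and magnetic numbers
`n₁/2 - k₁`, `n₂/2 - k₂`, `(n₁+n₂)/2 - s`. -/
def topCG (ħ : ℂ) (n₁ n₂ s k₁ k₂ : ℕ) : ℂ :=
  cgSl2 ħ ((n₁ : ℚ) / 2) ((n₁ : ℚ) / 2 - k₁) ((n₂ : ℚ) / 2) ((n₂ : ℚ) / 2 - k₂)
    (((n₁ : ℚ) + n₂) / 2 - s) (((n₁ : ℚ) + n₂) / 2 - s)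

/-- The vector whose coefficient on `|n₁ μ₁ - k₁ α₁⟩ ⊗ |n₂ μ₁ - k₂ α₁⟩`, `k₁ + k₂ = s`, is the
`U_q(sl₂)` q-CG coefficient `topCG`, and whose other coefficients vanish. -/
def topState (ħ : ℂ) (n₁ n₂ s : ℕ) : SymIdx n₁ × SymIdx n₂ → ℂ := fun p =>
  if p.1.B = 0 ∧ p.2.B = 0 ∧ p.1.A + p.2.A = s then topCG ħ n₁ n₂ s p.1.A p.2.A else 0

/-- The subrepresentation of `(n₁, 0) ⊗ (n₂, 0)` generated by `topState`. -/
def summand (ħ : ℂ) (n₁ n₂ s : ℕ) : Submodule ℂ (SymIdx n₁ × SymIdx n₂ → ℂ) :=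
  generated (tensorRep ħ n₁ n₂) (topState ħ n₁ n₂ s)

/-- The vector `(E⁻_{α₂})^{l₂} (E⁻_{α₁})^{l₁}` applied to `topState`. -/
def lowered (ħ : ℂ) (n₁ n₂ s l₁ l₂ : ℕ) : SymIdx n₁ × SymIdx n₂ → ℂ :=
  ((tensorRep ħ n₁ n₂).Em 1 ^ l₂ * (tensorRep ħ n₁ n₂).Em 0 ^ l₁).mulVec (topState ħ n₁ n₂ s)

/-- The ladder factor `H_{αᵢ,l}(ω)` at the weight `ω = n μ₁ + m μ₂ - A α₁ - B α₂` of `(n, m)`. -/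
def ladderH (ħ : ℂ) (i : Fin 2) (l n m A B : ℕ) : ℂ :=
  let j := spinJ i n m A B
  let μ := magM i n m A B
  (qSqrtFact ħ (j + μ) * qSqrtFact ħ (j - μ + l)) / (qSqrtFact ħ (j + μ - l) * qSqrtFact ħ (j - μ))

/-- The coproduct factor `F_{αᵢ,x+y}^{x,y}(ω₁, ω₂)` at the weights `ωₖ = nₖ μ₁ - Aₖ α₁ - Bₖ α₂`
of `(nₖ, 0)`. -/
def coprodF (ħ : ℂ) (i : Fin 2) (x y n₁ A₁ B₁ n₂ A₂ B₂ : ℕ) : ℂ :=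
  let j₁ := spinJ i n₁ 0 A₁ B₁
  let m₁ := magM i n₁ 0 A₁ B₁
  let j₂ := spinJ i n₂ 0 A₂ B₂
  let m₂ := magM i n₂ 0 A₂ B₂
  qPow ħ ((x * m₂ - y * m₁) / 2)
    * (qFact ħ ((x : ℚ) + y) / (qFact ħ x * qFact ħ y))
    * ((qSqrtFact ħ (j₂ + m₂) * qSqrtFact ħ (j₁ + m₁))
        / (qSqrtFact ħ (j₂ - m₂) * qSqrtFact ħ (j₁ - m₁)))
    * ((qSqrtFact ħ (j₂ - m₂ + y) * qSqrtFact ħ (j₁ - m₁ + x))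
        / (qSqrtFact ħ (j₂ + m₂ - y) * qSqrtFact ħ (j₁ + m₁ - x)))

/-- The state `|Λ, Λ - l₁ α₁ - l₂ α₂⟩`, `Λ = (n₁+n₂-2s) μ₁ + s μ₂`: `lowered` divided by its
ladder factors, with the sign `(-1)^s`. -/
def blackState (ħ : ℂ) (n₁ n₂ s l₁ l₂ : ℕ) : SymIdx n₁ × SymIdx n₂ → ℂ :=
  ((-1 : ℂ) ^ s / (ladderH ħ 0 l₁ (n₁ + n₂ - 2 * s) s 0 0 * ladderH ħ 1 l₂ (n₁ + n₂ - 2 * s) s l₁ 0))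
    • lowered ħ n₁ n₂ s l₁ l₂

/-- The closed form of the coefficient of `blackState` on
`|n₁ μ₁ - A₁ α₁ - B₁ α₂⟩ ⊗ |n₂ μ₁ - A₂ α₁ - B₂ α₂⟩`: the sum, over all `k₁ + k₂ = s`,
`x₁ + y₁ = l₁`, `x₂ + y₂ = l₂` for which the weights `ωₖ = nₖ μ₁ - kₖ α₁` satisfy
`ω₁ - x₁ α₁ - x₂ α₂ = n₁ μ₁ - A₁ α₁ - B₁ α₂` and `ω₂ - y₁ α₁ - y₂ α₂ = n₂ μ₁ - A₂ α₁ - B₂ α₂`, of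
`(-1)^s C F_{α₁,l₁}^{x₁,y₁}(ω₁, ω₂) F_{α₂,l₂}^{x₂,y₂}(ω₁ - x₁ α₁, ω₂ - y₁ α₁) / (H H)`. -/
def blackCG (ħ : ℂ) (n₁ n₂ s l₁ l₂ A₁ B₁ A₂ B₂ : ℕ) : ℂ :=
  ∑ k ∈ Finset.HasAntidiagonal.antidiagonal s, ∑ x ∈ Finset.HasAntidiagonal.antidiagonal l₁, ∑ z ∈ Finset.HasAntidiagonal.antidiagonal l₂,
    if k.1 + x.1 = A₁ ∧ z.1 = B₁ ∧ k.2 + x.2 = A₂ ∧ z.2 = B₂ then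
      (-1 : ℂ) ^ s * topCG ħ n₁ n₂ s k.1 k.2
        * (coprodF ħ 0 x.1 x.2 n₁ k.1 0 n₂ k.2 0 / ladderH ħ 0 l₁ (n₁ + n₂ - 2 * s) s 0 0)
        * (coprodF ħ 1 z.1 z.2 n₁ (k.1 + x.1) 0 n₂ (k.2 + x.2) 0
            / ladderH ħ 1 l₂ (n₁ + n₂ - 2 * s) s l₁ 0)
    else 0

/-- The lowering operator of the root `α₃ = α₁ + α₂`, the q-commutator
`E⁻_{α₂} E⁻_{α₁} - q^{ε/2} E⁻_{α₁} E⁻_{α₂}`; the two usual choices are `ε = 1` and `ε = -1`. -/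
def Em3 (ħ : ℂ) (ε : ℤ) (R : Ops ι) : Matrix ι ι ℂ :=
  R.Em 1 * R.Em 0 - qPow ħ ((ε : ℚ) / 2) • (R.Em 0 * R.Em 1)

/-- The states (black `c = 0`, red `c = 1`, green `c = 2`, …) at the weight `Λ - A α₁ - B α₂`:
`(E⁻_{α₃})^{B-c} (E⁻_{α₁})^{A-B} (E⁻_{α₂})^c (E⁻_{α₁})^c |Λ, Λ⟩` if `B ≤ A` and
`(E⁻_{α₃})^{A-c} (E⁻_{α₂})^{B-A} (E⁻_{α₂})^c (E⁻_{α₁})^c |Λ, Λ⟩` if `A < B`. -/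
def colorState (ħ : ℂ) (ε : ℤ) (n₁ n₂ s A B c : ℕ) : SymIdx n₁ × SymIdx n₂ → ℂ :=
  let R := tensorRep ħ n₁ n₂
  (if B ≤ A then Em3 ħ ε R ^ (B - c) * R.Em 0 ^ (A - B)
    else Em3 ħ ε R ^ (A - c) * R.Em 1 ^ (B - A)).mulVec (lowered ħ n₁ n₂ s c c)

/-- The multiplicity of the weight `Λ - A α₁ - B α₂` in the summand of highest weight
`Λ = (n₁+n₂-2s) μ₁ + s μ₂`. -/
def multiplicity (ħ : ℂ) (n₁ n₂ s A B : ℕ) : ℕ :=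
  Module.finrank ℂ
    (weightSpace (tensorRep ħ n₁ n₂) (summand ħ n₁ n₂ s) (n₁ + n₂ - 2 * s) s A B)

/-- The pair `(E⁻_{α₃})^l |Λ, Λ⟩`, `(E⁻_{α₂})^l (E⁻_{α₁})^l |Λ, Λ⟩` of states of weight
`Λ - l α₃`, the second one normalised, as the beginning of a sequence. -/
def pairStates (ħ : ℂ) (ε : ℤ) (n₁ n₂ s l : ℕ) : ℕ → SymIdx n₁ × SymIdx n₂ → ℂ
  | 0 => (Em3 ħ ε (tensorRep ħ n₁ n₂) ^ l).mulVec (topState ħ n₁ n₂ s)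
  | _ => blackState ħ n₁ n₂ s l l

end QuantumSl3

end

/-!
# Tensor products of symmetric representations of `U_q(sl₃)`

All representations in question have a basis of weight vectors in which the raising operators are the
transposes of the lowering operators (`IsGraded`). Hence the bilinear pairing is contravariant: a
lowering operator on one side can be moved to the other side as a raising operator, and vectors of
different weights are orthogonal. The pairing is complex bilinear and has isotropic vectors, so
positivity arguments are not available. They are replaced by singular vectors, the vectors annihilated
by both raising operators: a nonzero subspace which is stable under the raising operators contains a
nonzero one (`IsGraded.exists_singular`).

*Decomposition.* In `(n₁, 0) ⊗ (n₂, 0)` a singular vector is determined by its coefficients on the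
states whose first factor is the highest weight state, and most of these vanish
(`singular_eq_zero`, `singular_coeff_B`, `singular_coeff_A`). So the singular vectors are the
combinations of the vectors `topState` (`singular_eq_sum`), which are orthonormal: their norms are
given by the q-Vandermonde identity (`pairing_topState_self`). The summand generated by one of them
consists of lowered states (`IsGraded.generated_le_of_lowering`) and is therefore orthogonal to the
others. Irreducibility, directness of the sum, the fact that the summands exhaust the tensor product
and the uniqueness of the highest weight vectors follow by looking at singular vectors in the
respective subspaces (`isIrreducibleSub_summand`, `isInternal_summand`,
`isHighestWeight_and_pairing_iff`).

*The states `blackState`.* Their norms come from the commutation relations of `U_q(sl₂)` along two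
ladders (`pairing_lowered`), their coefficients from the q-binomial theorem for powers of the coproduct
`E ⊗ q^(H/2) + q^(-H/2) ⊗ E` (`pow_apply_eq_sum_ladderF`).

*Weight spaces.* By the q-Serre relations `Em3` q-commutes with `Em 0` and `Em 1`, so its image is
stable under lowering, and modulo this image `Em 0` and `Em 1` commute up to powers of `q`. Thus every
weight space is spanned by states `Em3 ^ j` applied to a `cornerState`, with one such state for each
`j` (`IsTop.wt_le_span`). Together with `Ep3`, the operator `Em3` satisfies the relations of `U_q(sl₂)`,
and its powers map weight spaces onto their reflections; this removes the superfluous states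
(`IsTop.wt_eq_span`). Counted over all summands, the remaining spanning states are as many as the
dimension of the tensor product (`card_wordIndex`), so they are linearly independent
(`linearIndependent_word`). In particular the multiplicities are the same for all admissible `q`
(`multiplicity_eq`).

*Gram–Schmidt.* The procedure succeeds when the leading Gram determinants do not vanish
(`pairing_gramSchmidt`). Moving lowering operators across the pairing shows that the determinants are
Laurent polynomials in `q^(1/2)` (`IsLoweredFamily.isLaurent_pairing`). For real `ħ ≠ 0` the vectors
have real coordinates, so the pairing is positive definite on their real span and linear independence
gives nonzero determinants (`det_gram_ne_zero_of_star_eq`). So the exceptional values are the roots of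
a nonzero polynomial without positive real roots other than possibly `1`
(`IsLaurent.exists_finset`). The two states of weight `Λ - l α₃` are linearly independent because a
relation between them would be carried by `Em 1 * Ep 1` to one between basis states of the weight
space (`linearIndependent_pairWord`).
-/

noncomputable section

set_option linter.unusedSectionVars false
set_option linter.unusedSimpArgs false

namespace QuantumSl3

section

/-! ### q-numbers and q-factorials -/

/-- `q ^ m ≠ 1` for `1 ≤ m ≤ M`, where `q = exp ħ`. -/
def Admissible (ħ : ℂ) (M : ℕ) : Prop :=
  ∀ m : ℕ, 1 ≤ m → m ≤ M → Complex.exp (ħ * m) ≠ 1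

lemma Admissible.mono {ħ : ℂ} {M M' : ℕ} (h : Admissible ħ M) (hM : M' ≤ M) : Admissible ħ M' :=
  fun m h1 h2 => h m h1 (h2.trans hM)

lemma qPow_add (ħ : ℂ) (x y : ℚ) : qPow ħ (x + y) = qPow ħ x * qPow ħ y := by
  simp only [qPow, ← Complex.exp_add]; push_cast; ring_nf

@[simp] lemma qPow_zero (ħ : ℂ) : qPow ħ 0 = 1 := by simp [qPow]

lemma qPow_ne_zero (ħ : ℂ) (x : ℚ) : qPow ħ x ≠ 0 := Complex.exp_ne_zero _

lemma qPow_pow (ħ : ℂ) (x : ℚ) (n : ℕ) : qPow ħ x ^ n = qPow ħ (n * x) := by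
  simp only [qPow, ← Complex.exp_nat_mul]; push_cast; ring_nf

lemma qDenom_ne_zero {ħ : ℂ} (h : Admissible ħ 1) : qPow ħ (1 / 2) - qPow ħ (-1 / 2) ≠ 0 := by
  intro h0
  apply h 1 le_rfl le_rfl
  have h1 : qPow ħ (1 / 2) = qPow ħ (-1 / 2) := sub_eq_zero.1 h0
  have h2 : qPow ħ (1 / 2) * qPow ħ (1 / 2) = qPow ħ (1 / 2) * qPow ħ (-1 / 2) := by rw [← h1]
  rw [← qPow_add, ← qPow_add] at h2
  norm_num at h2
  simpa [qPow] using h2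

@[simp] lemma qNum_zero (ħ : ℂ) : qNum ħ 0 = 0 := by simp [qNum]

lemma qNum_neg (ħ : ℂ) (x : ℚ) : qNum ħ (-x) = -qNum ħ x := by
  simp only [qNum, neg_neg]; rw [← neg_div, neg_sub]

lemma qNum_one {ħ : ℂ} (h : Admissible ħ 1) : qNum ħ 1 = 1 := by
  simp only [qNum]; exact div_self (qDenom_ne_zero h)

/-- The addition formula of q-numbers. -/
lemma qNum_add (ħ : ℂ) (x y : ℚ) :
    qNum ħ (x + y) = qPow ħ (-y / 2) * qNum ħ x + qPow ħ (x / 2) * qNum ħ y := by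
  simp only [qNum, mul_div_assoc', mul_sub, ← qPow_add]
  rw [← add_div]
  congr 1
  have h1 : (x + y) / 2 = x / 2 + y / 2 := by ring
  have h2 : -(x + y) / 2 = -y / 2 + -x / 2 := by ring
  have h3 : -y / 2 + x / 2 = x / 2 + -y / 2 := by ring
  rw [h1, h2, h3]; ring

/-- The addition formula of q-numbers with the powers of `q` inverted. -/
lemma qNum_add' (ħ : ℂ) (x y : ℚ) :
    qNum ħ (x + y) = qPow ħ (y / 2) * qNum ħ x + qPow ħ (-x / 2) * qNum ħ y := by
  have := qNum_add ħ y x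
  rw [add_comm y x] at this
  rw [this]; ring

lemma qNum_ne_zero {ħ : ℂ} {M : ℕ} (h : Admissible ħ M) {m : ℕ} (h1 : 1 ≤ m) (h2 : m ≤ M) :
    qNum ħ m ≠ 0 := by
  refine div_ne_zero ?_ (qDenom_ne_zero (h.mono (h1.trans h2)))
  intro h0
  apply h m h1 h2
  have h1 : qPow ħ ((m : ℚ) / 2) = qPow ħ (-(m : ℚ) / 2) := sub_eq_zero.1 h0
  have h2 : qPow ħ ((m : ℚ) / 2) * qPow ħ ((m : ℚ) / 2)
      = qPow ħ ((m : ℚ) / 2) * qPow ħ (-(m : ℚ) / 2) := by rw [← h1]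
  rw [← qPow_add, ← qPow_add, add_halves, neg_div, add_neg_cancel] at h2
  simpa [qPow] using h2

lemma qNum_two {ħ : ℂ} (h : Admissible ħ 1) :
    qNum ħ 2 = qPow ħ (1 / 2) + qPow ħ (-1 / 2) := by
  have := qNum_add ħ 1 1
  rw [qNum_one h] at this
  norm_num at this ⊢
  rw [this]; ring

/-- The commutator of the two ladder operators on a state with occupation numbers `a`, `b`. -/
lemma qNum_mul_succ_sub {ħ : ℂ} (h : Admissible ħ 1) (a b : ℚ) :
    qNum ħ a * qNum ħ (b + 1) - qNum ħ b * qNum ħ (a + 1) = qNum ħ (a - b) := by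
  have e1 := qNum_add ħ b 1
  have e2 := qNum_add ħ a 1
  have e3 := qNum_add ħ a (-b)
  rw [qNum_neg] at e3
  rw [qNum_one h] at e1 e2
  rw [sub_eq_add_neg a b, e3, e1, e2]
  have : -(-b) / 2 = b / 2 := by ring
  rw [this]
  ring

/-- The three-term recursion of q-numbers, the source of the q-Serre relations in the symmetric
representations. -/
lemma qNum_serre {ħ : ℂ} (h : Admissible ħ 1) (b : ℚ) :
    qNum ħ b - qNum ħ 2 * qNum ħ (b + 1) + qNum ħ (b + 2) = 0 := by
  have e1 := qNum_add' ħ (b + 1) 1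
  have e2 := qNum_add' ħ (b + 1) (-1)
  have e3 : qNum ħ (-1) = -1 := by rw [qNum_neg, qNum_one h]
  rw [e3] at e2
  rw [qNum_one h] at e1
  have h1 : b + 2 = b + 1 + 1 := by ring
  have h2 : qNum ħ b = qNum ħ (b + 1 + -1) := by congr 1; ring
  rw [h1, h2, e1, e2, qNum_two h]
  ring

lemma qSqrt_mul_self (ħ : ℂ) (x : ℚ) : qSqrt ħ x * qSqrt ħ x = qNum ħ x := by
  unfold qSqrt
  rw [← sq, ← Complex.cpow_nat_mul]; norm_num

@[simp] lemma qSqrt_zero (ħ : ℂ) : qSqrt ħ 0 = 0 := by simp [qSqrt]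

lemma qSqrt_ne_zero {ħ : ℂ} {M : ℕ} (h : Admissible ħ M) {m : ℕ} (h1 : 1 ≤ m) (h2 : m ≤ M) :
    qSqrt ħ m ≠ 0 := by
  intro h0
  apply qNum_ne_zero h h1 h2
  rw [← qSqrt_mul_self, h0, zero_mul]

/-- The q-factorial `[m]!` of a natural number. -/
def qfac (ħ : ℂ) (m : ℕ) : ℂ := ∏ i ∈ Finset.range m, qNum ħ ((i + 1 : ℕ) : ℚ)

/-- The square root of the q-factorial of a natural number. -/
def sfac (ħ : ℂ) (m : ℕ) : ℂ := ∏ i ∈ Finset.range m, qSqrt ħ ((i + 1 : ℕ) : ℚ)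

@[simp] lemma qfac_zero (ħ : ℂ) : qfac ħ 0 = 1 := by simp [qfac]
@[simp] lemma sfac_zero (ħ : ℂ) : sfac ħ 0 = 1 := by simp [sfac]

lemma qfac_succ (ħ : ℂ) (m : ℕ) : qfac ħ (m + 1) = qfac ħ m * qNum ħ ((m + 1 : ℕ) : ℚ) :=
  Finset.prod_range_succ _ _

lemma sfac_succ (ħ : ℂ) (m : ℕ) : sfac ħ (m + 1) = sfac ħ m * qSqrt ħ ((m + 1 : ℕ) : ℚ) :=
  Finset.prod_range_succ _ _

lemma sfac_mul_self (ħ : ℂ) (m : ℕ) : sfac ħ m * sfac ħ m = qfac ħ m := by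
  simp [sfac, qfac, ← Finset.prod_mul_distrib, qSqrt_mul_self]

lemma qfac_ne_zero {ħ : ℂ} {M : ℕ} (h : Admissible ħ M) {m : ℕ} (hm : m ≤ M) : qfac ħ m ≠ 0 :=
  Finset.prod_ne_zero_iff.2 fun i hi =>
    qNum_ne_zero h (by omega) (by have := Finset.mem_range.1 hi; omega)

lemma sfac_ne_zero {ħ : ℂ} {M : ℕ} (h : Admissible ħ M) {m : ℕ} (hm : m ≤ M) : sfac ħ m ≠ 0 :=
  Finset.prod_ne_zero_iff.2 fun i hi =>
    qSqrt_ne_zero h (by omega) (by have := Finset.mem_range.1 hi; omega)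

lemma prod_Icc_one_floor (f : ℚ → ℂ) (m : ℕ) :
    ∏ i ∈ Finset.Icc 1 ⌊(m : ℚ)⌋₊, f i = ∏ i ∈ Finset.range m, f ((i + 1 : ℕ) : ℚ) := by
  rw [Nat.floor_natCast, Finset.range_eq_Ico, Finset.prod_Ico_add' (fun i : ℕ => f (i : ℚ)) 0 m 1]
  rfl

lemma qFact_natCast (ħ : ℂ) (m : ℕ) : qFact ħ m = qfac ħ m := by
  have : ¬ (m : ℚ) < 0 := by simp
  rw [qFact, if_neg this, prod_Icc_one_floor]; rfl

lemma qSqrtFact_natCast (ħ : ℂ) (m : ℕ) : qSqrtFact ħ m = sfac ħ m := by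
  have : ¬ (m : ℚ) < 0 := by simp
  rw [qSqrtFact, if_neg this, prod_Icc_one_floor]; rfl

/-- A version of `qFact_natCast` for arguments that are only propositionally casts. -/
lemma qFact_eq {ħ : ℂ} {x : ℚ} (m : ℕ) (h : x = m) : qFact ħ x = qfac ħ m := by
  rw [h, qFact_natCast]

lemma qSqrtFact_eq {ħ : ℂ} {x : ℚ} (m : ℕ) (h : x = m) : qSqrtFact ħ x = sfac ħ m := by
  rw [h, qSqrtFact_natCast]

/-- The Gaussian binomial coefficient `[a + k]! / ([a]! [k]!)`. -/
def qbin (ħ : ℂ) (a k : ℕ) : ℂ := qfac ħ (a + k) / (qfac ħ a * qfac ħ k)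

lemma qbin_zero_right {ħ : ℂ} {M : ℕ} (h : Admissible ħ M) {a : ℕ} (ha : a ≤ M) :
    qbin ħ a 0 = 1 := by
  simp [qbin, div_self (qfac_ne_zero h ha)]

lemma qbin_zero_left {ħ : ℂ} {M : ℕ} (h : Admissible ħ M) {k : ℕ} (hk : k ≤ M) :
    qbin ħ 0 k = 1 := by
  simp [qbin, div_self (qfac_ne_zero h hk)]

/-- The Pascal rule for Gaussian binomial coefficients. -/
lemma qbin_succ_succ {ħ : ℂ} {M : ℕ} (h : Admissible ħ M) {a k : ℕ} (hM : a + k + 1 ≤ M) :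
    qbin ħ (a + 1) (k + 1) = qPow ħ (-((k : ℚ) + 1) / 2) * qbin ħ a (k + 1)
      + qPow ħ (((a : ℚ) + 1) / 2) * qbin ħ (a + 1) k := by
  have e := qNum_add ħ ((a + 1 : ℕ) : ℚ) ((k + 1 : ℕ) : ℚ)
  have e' : ((a + 1 : ℕ) : ℚ) + ((k + 1 : ℕ) : ℚ) = ((a + 1 + k + 1 : ℕ) : ℚ) := by
    push_cast; ring
  rw [e'] at e
  have ha := qfac_ne_zero h (show a ≤ M by omega)
  have hk := qfac_ne_zero h (show k ≤ M by omega)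
  have ha1 := qNum_ne_zero h (show 1 ≤ a + 1 by omega) (by omega)
  have hk1 := qNum_ne_zero h (show 1 ≤ k + 1 by omega) (by omega)
  simp only [qbin]
  rw [show a + 1 + (k + 1) = (a + 1 + k) + 1 by ring, show a + (k + 1) = a + 1 + k by ring,
    qfac_succ ħ (a + 1 + k), e, qfac_succ ħ a, qfac_succ ħ k]
  push_cast at ha1 hk1 ⊢
  field_simp

end

section

/-! ### Tensor products of representations with diagonal Cartan part -/

section TensorProduct

variable {ι κ : Type} [Fintype ι] [DecidableEq ι] [Fintype κ] [DecidableEq κ]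

lemma qPowMat_diagonal (ħ : ℂ) (c : ℚ) (h : ι → ℚ) :
    qPowMat ħ c (Matrix.diagonal fun p => ((h p : ℚ) : ℂ))
      = Matrix.diagonal fun p => qPow ħ (c * h p) := by
  rw [qPowMat, ← Matrix.diagonal_smul, Matrix.exp_diagonal]
  congr 1
  funext p
  rw [Pi.coe_exp, ← Complex.exp_eq_exp_ℂ]
  simp only [Pi.smul_apply, smul_eq_mul, qPow]
  push_cast
  ring_nf

/-- An operator that shifts the eigenvalues of `H` by `a` q-commutes with `q ^ (c H)`. -/
lemma qPowMat_mul_of_commutator (ħ : ℂ) (c a : ℚ) (h : ι → ℚ) (E : Matrix ι ι ℂ)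
    (hE : (Matrix.diagonal fun p => ((h p : ℚ) : ℂ)) * E
      - E * (Matrix.diagonal fun p => ((h p : ℚ) : ℂ)) = (a : ℂ) • E) :
    qPowMat ħ c (Matrix.diagonal fun p => ((h p : ℚ) : ℂ)) * E
      = qPow ħ (c * a) • (E * qPowMat ħ c (Matrix.diagonal fun p => ((h p : ℚ) : ℂ))) := by
  rw [qPowMat_diagonal]
  ext p q
  have := congrFun (congrFun hE p) q
  simp only [Matrix.sub_apply, Matrix.diagonal_mul, Matrix.mul_diagonal, Matrix.smul_apply,
    smul_eq_mul] at this ⊢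
  by_cases h0 : E p q = 0
  · simp [h0]
  · have h1 : (h p : ℂ) = h q + a := by
      have : ((h p : ℂ) - h q - a) * E p q = 0 := by linear_combination this
      rcases mul_eq_zero.1 this with h2 | h2
      · linear_combination h2
      · exact absurd h2 h0
    have h2 : h p = h q + a := by exact_mod_cast h1
    rw [h2, show c * (h q + a) = c * a + c * h q by ring, qPow_add]
    ring

/-- The q-Serre relation passes from two q-commuting families to their sums: this is the
multiplicativity of the coproduct on the Serre relations. -/
lemma serre_add {A : Type*} [Ring A] [Algebra ℂ A] (x y c : ℂ) (P₁ P₂ Q₁ Q₂ : A)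
    (hy : x * x * y = 1) (hc : c * x = x * x + 1)
    (hP : P₁ ^ 2 * P₂ - c • (P₁ * P₂ * P₁) + P₂ * P₁ ^ 2 = 0)
    (hQ : Q₁ ^ 2 * Q₂ - c • (Q₁ * Q₂ * Q₁) + Q₂ * Q₁ ^ 2 = 0)
    (h11 : Q₁ * P₁ = y • (P₁ * Q₁)) (h12 : Q₁ * P₂ = x • (P₂ * Q₁))
    (h21 : Q₂ * P₁ = x • (P₁ * Q₂)) :
    (P₁ + Q₁) ^ 2 * (P₂ + Q₂) - c • ((P₁ + Q₁) * (P₂ + Q₂) * (P₁ + Q₁))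
      + (P₂ + Q₂) * (P₁ + Q₁) ^ 2 = 0 := by
  have hx : x ≠ 0 := by rintro rfl; simp at hy
  have hy' : y = 1 / (x * x) := by field_simp; linear_combination hy
  have hc' : c = x + 1 / x := by field_simp; linear_combination hc
  have h11' : ∀ z, Q₁ * (P₁ * z) = y • (P₁ * (Q₁ * z)) := fun z => by
    rw [← mul_assoc, h11, smul_mul_assoc, mul_assoc]
  have h12' : ∀ z, Q₁ * (P₂ * z) = x • (P₂ * (Q₁ * z)) := fun z => by
    rw [← mul_assoc, h12, smul_mul_assoc, mul_assoc]
  have h21' : ∀ z, Q₂ * (P₁ * z) = x • (P₁ * (Q₂ * z)) := fun z => by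
    rw [← mul_assoc, h21, smul_mul_assoc, mul_assoc]
  simp only [sq, mul_assoc] at hP hQ
  have key : (P₁ + Q₁) ^ 2 * (P₂ + Q₂) - c • ((P₁ + Q₁) * (P₂ + Q₂) * (P₁ + Q₁))
      + (P₂ + Q₂) * (P₁ + Q₁) ^ 2
      = (P₁ * (P₁ * P₂) - c • (P₁ * (P₂ * P₁)) + P₂ * (P₁ * P₁))
        + (Q₁ * (Q₁ * Q₂) - c • (Q₁ * (Q₂ * Q₁)) + Q₂ * (Q₁ * Q₁)) := by
    simp only [sq, mul_add, add_mul, mul_assoc, h11, h12, h21, h11', h12', h21',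
      smul_mul_assoc, mul_smul_comm, smul_add, smul_smul]
    rw [hy', hc']
    match_scalars <;> field_simp <;> ring
  rw [key, hP, hQ, add_zero]

/-- The q-Serre relation for the coproducts `E ⊗ K + K⁻¹ ⊗ E` of operators that shift the weights
by `σ αᵢ`, `σ = ±1`. -/
lemma serre_tensor {ħ : ℂ} (hq : Admissible ħ 1) (σ : ℚ) (hσ : σ = 1 ∨ σ = -1)
    (E : Fin 2 → Matrix ι ι ℂ) (K : ℚ → Fin 2 → Matrix ι ι ℂ)
    (E' : Fin 2 → Matrix κ κ ℂ) (K' : ℚ → Fin 2 → Matrix κ κ ℂ)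
    (hK : ∀ c i j, K c i * K c j = K c j * K c i)
    (hK' : ∀ c i j, K' c i * K' c j = K' c j * K' c i)
    (hE : ∀ c i j, K c i * E j = qPow ħ (c * (σ * rootDot i j)) • (E j * K c i))
    (hE' : ∀ c i j, K' c i * E' j = qPow ħ (c * (σ * rootDot i j)) • (E' j * K' c i))
    (hs : ∀ i j, i ≠ j →
      E i ^ 2 * E j - qNum ħ 2 • (E i * E j * E i) + E j * E i ^ 2 = 0)
    (hs' : ∀ i j, i ≠ j →
      E' i ^ 2 * E' j - qNum ħ 2 • (E' i * E' j * E' i) + E' j * E' i ^ 2 = 0)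
    (i j : Fin 2) (hij : i ≠ j) :
    (E i ⊗ₖ K' (1 / 2) i + K (-1 / 2) i ⊗ₖ E' i) ^ 2
        * (E j ⊗ₖ K' (1 / 2) j + K (-1 / 2) j ⊗ₖ E' j)
      - qNum ħ 2 • ((E i ⊗ₖ K' (1 / 2) i + K (-1 / 2) i ⊗ₖ E' i)
        * (E j ⊗ₖ K' (1 / 2) j + K (-1 / 2) j ⊗ₖ E' j)
        * (E i ⊗ₖ K' (1 / 2) i + K (-1 / 2) i ⊗ₖ E' i))
      + (E j ⊗ₖ K' (1 / 2) j + K (-1 / 2) j ⊗ₖ E' j)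
        * (E i ⊗ₖ K' (1 / 2) i + K (-1 / 2) i ⊗ₖ E' i) ^ 2 = 0 := by
  have comm : ∀ i j, (K (-1 / 2) i ⊗ₖ E' i) * (E j ⊗ₖ K' (1 / 2) j)
      = qPow ħ (-(σ * rootDot i j)) • ((E j ⊗ₖ K' (1 / 2) j) * (K (-1 / 2) i ⊗ₖ E' i)) := by
    intro i j
    have hsymm : rootDot j i = rootDot i j := by simp [rootDot, eq_comm]
    have e : E' i * K' (1 / 2) j
        = qPow ħ (-(σ * rootDot i j) / 2) • (K' (1 / 2) j * E' i) := by
      rw [hE' _ j i, smul_smul, ← qPow_add, hsymm]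
      ring_nf
      simp
    rw [← Matrix.mul_kronecker_mul, ← Matrix.mul_kronecker_mul, hE, e, Matrix.smul_kronecker,
      Matrix.kronecker_smul, smul_smul, ← qPow_add]
    congr 2; ring
  have key : ∀ {X : Type} [Fintype X] [DecidableEq X] (Ki Kj : Matrix X X ℂ), Ki * Kj = Kj * Ki →
      Ki * Kj * Ki = Ki ^ 2 * Kj ∧ Kj * Ki ^ 2 = Ki ^ 2 * Kj := by
    intro X _ _ Ki Kj h
    constructor
    · rw [mul_assoc, ← h, ← mul_assoc, sq]
    · rw [sq, ← mul_assoc, ← h, mul_assoc, ← h, ← mul_assoc]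
  have hc : rootDot i j = -1 / 2 ∧ rootDot i i = 1 := by simp [rootDot, hij]
  refine serre_add (qPow ħ (σ / 2)) (qPow ħ (-σ)) (qNum ħ 2) _ _ _ _ ?_ ?_ ?_ ?_ ?_ ?_ ?_
  · rw [← qPow_add, ← qPow_add]; ring_nf; simp
  · rw [qNum_two hq, add_mul, ← qPow_add, ← qPow_add, ← qPow_add]
    rcases hσ with rfl | rfl <;> norm_num
    ring
  · obtain ⟨e1, e2⟩ := key _ _ (hK' (1 / 2) i j)
    have e3 : (E i ⊗ₖ K' (1 / 2) i) ^ 2 = (E i ^ 2) ⊗ₖ (K' (1 / 2) i ^ 2) := by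
      rw [sq, sq, sq, ← Matrix.mul_kronecker_mul]
    have := congrArg (fun M => M ⊗ₖ (K' (1 / 2) i ^ 2 * K' (1 / 2) j)) (hs i j hij)
    simp only [sub_eq_add_neg, ← neg_smul, Matrix.add_kronecker, Matrix.smul_kronecker,
      Matrix.zero_kronecker] at this
    rw [e3]
    simp only [← Matrix.mul_kronecker_mul]
    rw [e1, e2, sub_eq_add_neg, ← neg_smul, this]
  · obtain ⟨e1, e2⟩ := key _ _ (hK (-1 / 2) i j)
    have e3 : (K (-1 / 2) i ⊗ₖ E' i) ^ 2 = (K (-1 / 2) i ^ 2) ⊗ₖ (E' i ^ 2) := by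
      rw [sq, sq, sq, ← Matrix.mul_kronecker_mul]
    have := congrArg (fun M => (K (-1 / 2) i ^ 2 * K (-1 / 2) j) ⊗ₖ M) (hs' i j hij)
    simp only [sub_eq_add_neg, ← neg_smul, Matrix.kronecker_add, Matrix.kronecker_smul,
      Matrix.kronecker_zero] at this
    rw [e3]
    simp only [← Matrix.mul_kronecker_mul]
    rw [e1, e2, sub_eq_add_neg, ← neg_smul, this]
  · rw [comm, hc.2, mul_one]
  · rw [comm, hc.1]; congr 2; ring
  · rw [comm]
    have : rootDot j i = -1 / 2 := by simp [rootDot, hij.symm]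
    rw [this]; congr 2; ring

lemma tensor_H_eq {ħ : ℂ} {R : Ops ι} {R' : Ops κ} {h : Fin 2 → ι → ℚ} {h' : Fin 2 → κ → ℚ}
    (hd : ∀ i, R.H i = Matrix.diagonal fun p => ((h i p : ℚ) : ℂ))
    (hd' : ∀ i, R'.H i = Matrix.diagonal fun p => ((h' i p : ℚ) : ℂ)) (i : Fin 2) :
    (tensor ħ R R').H i
      = Matrix.diagonal fun p : ι × κ => (((h i p.1 + h' i p.2 : ℚ) : ℚ) : ℂ) := by
  ext ⟨p, p'⟩ ⟨r, r'⟩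
  simp only [tensor, hd, hd', Matrix.add_apply, Matrix.kroneckerMap_apply, Matrix.diagonal_apply,
    Matrix.one_apply, Prod.mk.injEq]
  by_cases h1 : p = r <;> by_cases h2 : p' = r' <;> simp [h1, h2]

/-- The coproduct is compatible with the defining relations. Diagonal `H` make `q ^ (c H)` diagonal,
so that it q-commutes with the generators and the mixed terms of the commutators cancel. -/
theorem isRep_tensor {ħ : ℂ} (hq : Admissible ħ 1) {R : Ops ι} {R' : Ops κ}
    (hR : IsRep ħ R) (hR' : IsRep ħ R') (h : Fin 2 → ι → ℚ) (h' : Fin 2 → κ → ℚ)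
    (hd : ∀ i, R.H i = Matrix.diagonal fun p => ((h i p : ℚ) : ℂ))
    (hd' : ∀ i, R'.H i = Matrix.diagonal fun p => ((h' i p : ℚ) : ℂ)) :
    IsRep ħ (tensor ħ R R') := by
  have kp : ∀ c i j, qPowMat ħ c (R.H i) * R.Ep j
      = qPow ħ (c * rootDot i j) • (R.Ep j * qPowMat ħ c (R.H i)) := fun c i j => by
    have := hR.H_Ep i j
    rw [hd i] at this ⊢
    exact qPowMat_mul_of_commutator ħ c _ _ _ this
  have km : ∀ c i j, qPowMat ħ c (R.H i) * R.Em j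
      = qPow ħ (c * -rootDot i j) • (R.Em j * qPowMat ħ c (R.H i)) := fun c i j => by
    have := hR.H_Em i j
    rw [hd i] at this ⊢
    exact qPowMat_mul_of_commutator ħ c _ _ _ (by rw [this]; push_cast; rw [neg_smul])
  have kp' : ∀ c i j, qPowMat ħ c (R'.H i) * R'.Ep j
      = qPow ħ (c * rootDot i j) • (R'.Ep j * qPowMat ħ c (R'.H i)) := fun c i j => by
    have := hR'.H_Ep i j
    rw [hd' i] at this ⊢
    exact qPowMat_mul_of_commutator ħ c _ _ _ this
  have km' : ∀ c i j, qPowMat ħ c (R'.H i) * R'.Em j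
      = qPow ħ (c * -rootDot i j) • (R'.Em j * qPowMat ħ c (R'.H i)) := fun c i j => by
    have := hR'.H_Em i j
    rw [hd' i] at this ⊢
    exact qPowMat_mul_of_commutator ħ c _ _ _ (by rw [this]; push_cast; rw [neg_smul])
  have kk : ∀ c d i j, qPowMat ħ c (R.H i) * qPowMat ħ d (R.H j)
      = qPowMat ħ d (R.H j) * qPowMat ħ c (R.H i) := fun c d i j => by
    rw [hd, hd, qPowMat_diagonal, qPowMat_diagonal, Matrix.diagonal_mul_diagonal,
      Matrix.diagonal_mul_diagonal]
    simp only [mul_comm]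
  have kk' : ∀ c d i j, qPowMat ħ c (R'.H i) * qPowMat ħ d (R'.H j)
      = qPowMat ħ d (R'.H j) * qPowMat ħ c (R'.H i) := fun c d i j => by
    rw [hd', hd', qPowMat_diagonal, qPowMat_diagonal, Matrix.diagonal_mul_diagonal,
      Matrix.diagonal_mul_diagonal]
    simp only [mul_comm]
  have hk : ∀ c i j, R.H i * qPowMat ħ c (R.H j) = qPowMat ħ c (R.H j) * R.H i := fun c i j => by
    rw [hd, hd, qPowMat_diagonal, Matrix.diagonal_mul_diagonal, Matrix.diagonal_mul_diagonal]
    simp only [mul_comm]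
  have hk' : ∀ c i j, R'.H i * qPowMat ħ c (R'.H j) = qPowMat ħ c (R'.H j) * R'.H i :=
    fun c i j => by
    rw [hd', hd', qPowMat_diagonal, Matrix.diagonal_mul_diagonal, Matrix.diagonal_mul_diagonal]
    simp only [mul_comm]
  have hH := tensor_H_eq (ħ := ħ) hd hd'
  -- the mixed terms of `[ΔEp i, ΔEm j]` vanish: the two powers of `q` cancel
  have cross : ∀ i j, (R.Ep i ⊗ₖ qPowMat ħ (1 / 2) (R'.H i))
        * (qPowMat ħ (-1 / 2) (R.H j) ⊗ₖ R'.Em j)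
      = (qPowMat ħ (-1 / 2) (R.H j) ⊗ₖ R'.Em j)
        * (R.Ep i ⊗ₖ qPowMat ħ (1 / 2) (R'.H i)) := fun i j => by
    have hsymm : rootDot j i = rootDot i j := by simp [rootDot, eq_comm]
    rw [← Matrix.mul_kronecker_mul, ← Matrix.mul_kronecker_mul, km', kp, Matrix.smul_kronecker,
      Matrix.kronecker_smul, hsymm]
    congr 2; ring
  have cross' : ∀ i j, (qPowMat ħ (-1 / 2) (R.H i) ⊗ₖ R'.Ep i)
        * (R.Em j ⊗ₖ qPowMat ħ (1 / 2) (R'.H j))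
      = (R.Em j ⊗ₖ qPowMat ħ (1 / 2) (R'.H j))
        * (qPowMat ħ (-1 / 2) (R.H i) ⊗ₖ R'.Ep i) := fun i j => by
    have hsymm : rootDot j i = rootDot i j := by simp [rootDot, eq_comm]
    rw [← Matrix.mul_kronecker_mul, ← Matrix.mul_kronecker_mul, km, kp', Matrix.smul_kronecker,
      Matrix.kronecker_smul, hsymm]
    congr 2; ring
  refine ⟨fun i j => ?_, fun i j => ?_, fun i j => ?_, fun i j => ?_, fun i j hij => ?_,
    fun i j hij => ?_⟩
  · rw [hH, hH, Matrix.diagonal_mul_diagonal, Matrix.diagonal_mul_diagonal]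
    simp only [mul_comm]
  · have e1 := congrArg (fun M => M ⊗ₖ qPowMat ħ (1 / 2) (R'.H j)) (hR.H_Ep i j)
    have e2 := congrArg (fun M => qPowMat ħ (-1 / 2) (R.H j) ⊗ₖ M) (hR'.H_Ep i j)
    simp only [sub_eq_add_neg, ← neg_one_smul ℂ (_ * _), Matrix.add_kronecker,
      Matrix.kronecker_add, Matrix.smul_kronecker, Matrix.kronecker_smul] at e1 e2
    simp only [tensor, add_mul, mul_add, ← Matrix.mul_kronecker_mul, one_mul, mul_one, hk', hk,
      smul_add]
    rw [← e1, ← e2]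
    module
  · have e1 := congrArg (fun M => M ⊗ₖ qPowMat ħ (1 / 2) (R'.H j)) (hR.H_Em i j)
    have e2 := congrArg (fun M => qPowMat ħ (-1 / 2) (R.H j) ⊗ₖ M) (hR'.H_Em i j)
    simp only [sub_eq_add_neg, ← neg_one_smul ℂ (_ * _), ← neg_smul, Matrix.add_kronecker,
      Matrix.kronecker_add, Matrix.smul_kronecker, Matrix.kronecker_smul] at e1 e2
    simp only [tensor, add_mul, mul_add, ← Matrix.mul_kronecker_mul, one_mul, mul_one, hk', hk]
    linear_combination (norm := module) e1 + e2
  · have e1 := congrArg (fun M => M ⊗ₖ (qPowMat ħ (1 / 2) (R'.H i) * qPowMat ħ (1 / 2) (R'.H j)))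
      (hR.Ep_Em i j)
    have e2 := congrArg (fun M => (qPowMat ħ (-1 / 2) (R.H i) * qPowMat ħ (-1 / 2) (R.H j)) ⊗ₖ M)
      (hR'.Ep_Em i j)
    simp only [sub_eq_add_neg, ← neg_one_smul ℂ (_ * _), Matrix.add_kronecker,
      Matrix.kronecker_add, Matrix.smul_kronecker, Matrix.kronecker_smul] at e1 e2
    have e3 : (tensor ħ R R').Ep i * (tensor ħ R R').Em j
        - (tensor ħ R R').Em j * (tensor ħ R R').Ep i
        = (if i = j then qNumTwoMat ħ (R.H i) else 0)
            ⊗ₖ (qPowMat ħ (1 / 2) (R'.H i) * qPowMat ħ (1 / 2) (R'.H j))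
          + (qPowMat ħ (-1 / 2) (R.H i) * qPowMat ħ (-1 / 2) (R.H j))
            ⊗ₖ (if i = j then qNumTwoMat ħ (R'.H i) else 0) := by
      rw [← e1, ← e2]
      simp only [tensor, add_mul, mul_add, cross, cross']
      simp only [← Matrix.mul_kronecker_mul]
      rw [kk' _ _ j i, kk _ _ j i]
      module
    rw [e3]
    by_cases h0 : i = j
    · subst h0
      simp only [if_true, qNumTwoMat]
      rw [hH, hd, hd']
      simp only [qPowMat_diagonal, Matrix.diagonal_mul_diagonal, Matrix.diagonal_sub,
        ← Matrix.diagonal_smul, Matrix.diagonal_kronecker_diagonal, Matrix.diagonal_add]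
      congr 1
      funext p
      simp only [Pi.smul_apply, smul_eq_mul, ← qPow_add]
      have a1 : qPow ħ (1 * (h i p.1 + h' i p.2))
          = qPow ħ (1 * h i p.1) * qPow ħ (1 * h' i p.2) := by
        rw [← qPow_add]; congr 1; ring
      have a2 : qPow ħ (-1 * (h i p.1 + h' i p.2))
          = qPow ħ (-1 * h i p.1) * qPow ħ (-1 * h' i p.2) := by
        rw [← qPow_add]; congr 1; ring
      have a3 : qPow ħ (-1 / 2 * h i p.1 + -1 / 2 * h i p.1) = qPow ħ (-1 * h i p.1) := by
        congr 1; ring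
      have a4 : qPow ħ (1 / 2 * h' i p.2 + 1 / 2 * h' i p.2) = qPow ħ (1 * h' i p.2) := by
        congr 1; ring
      rw [a1, a2, a3, a4]
      ring
    · simp [h0]
  · exact serre_tensor hq 1 (Or.inl rfl) R.Ep (fun c i => qPowMat ħ c (R.H i)) R'.Ep
      (fun c i => qPowMat ħ c (R'.H i)) (fun c => kk c c) (fun c => kk' c c)
      (by simpa using kp) (by simpa using kp') hR.serre_Ep hR'.serre_Ep i j hij
  · exact serre_tensor hq (-1) (Or.inr rfl) R.Em (fun c i => qPowMat ħ c (R.H i)) R'.Em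
      (fun c i => qPowMat ħ c (R'.H i)) (fun c => kk c c) (fun c => kk' c c)
      (by simpa using km) (by simpa using km') hR.serre_Em hR'.serre_Em i j hij

end TensorProduct

end

section

/-! ### The symmetric representations -/

lemma SymIdx.A_le {n : ℕ} (p : SymIdx n) : p.A ≤ n := Nat.lt_succ_iff.1 p.1.1.2

lemma SymIdx.B_le_A {n : ℕ} (p : SymIdx n) : p.B ≤ p.A := p.2

lemma SymIdx.ext {n : ℕ} {p r : SymIdx n} (hA : p.A = r.A) (hB : p.B = r.B) : p = r :=
  Subtype.ext (Prod.ext (Fin.ext hA) (Fin.ext hB))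

/-- The state with given coordinates. -/
def SymIdx.mk' {n A B : ℕ} (hA : A ≤ n) (hB : B ≤ A) : SymIdx n :=
  ⟨(⟨A, by omega⟩, ⟨B, by omega⟩), hB⟩

@[simp] lemma SymIdx.A_mk' {n A B : ℕ} (hA : A ≤ n) (hB : B ≤ A) : (SymIdx.mk' hA hB).A = A := rfl
@[simp] lemma SymIdx.B_mk' {n A B : ℕ} (hA : A ≤ n) (hB : B ≤ A) : (SymIdx.mk' hA hB).B = B := rfl

lemma SymIdx.m_zero {n : ℕ} (p : SymIdx n) : p.m 0 = (n : ℚ) / 2 - p.A + p.B / 2 := by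
  simp [SymIdx.m, magM, rootDot]; ring

lemma SymIdx.m_one {n : ℕ} (p : SymIdx n) : p.m 1 = (p.A : ℚ) / 2 - p.B := by
  simp [SymIdx.m, magM, rootDot]; ring

lemma SymIdx.j_zero {n : ℕ} (p : SymIdx n) : p.j 0 = ((n : ℚ) - p.B) / 2 := by
  simp [SymIdx.j, spinJ, magM, rootDot]; ring

lemma SymIdx.j_one {n : ℕ} (p : SymIdx n) : p.j 1 = (p.A : ℚ) / 2 := by
  simp [SymIdx.j, spinJ, magM, rootDot, Nat.sub_eq_zero_of_le p.A_le]; ring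

/-- The basis state `|n μ₁ - A α₁ - B α₂⟩` of `(n, 0)`, and `0` if there is no such weight.
With integer coordinates the action of the generators needs no case distinction at the boundary,
where the coefficients vanish. -/
def ket (n : ℕ) (A B : ℤ) : SymIdx n → ℂ :=
  fun p => if (p.A : ℤ) = A ∧ (p.B : ℤ) = B then 1 else 0

lemma ket_eq_single {n : ℕ} (p : SymIdx n) : ket n p.A p.B = Pi.single p 1 := by
  funext r
  simp only [ket, Nat.cast_inj, Pi.single_apply]
  by_cases h : r = p
  · simp [h]
  · rw [if_neg (fun h' => h (SymIdx.ext h'.1 h'.2)), if_neg h]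

lemma ket_eq_zero {n : ℕ} {A B : ℤ} (h : ¬ (0 ≤ B ∧ B ≤ A ∧ A ≤ n)) : ket n A B = 0 := by
  funext r
  have h1 := r.A_le
  have h2 := r.B_le_A
  simp only [ket, Pi.zero_apply, ite_eq_right_iff, one_ne_zero, imp_false]
  omega

lemma exists_ket {n : ℕ} {A B : ℤ} (h : 0 ≤ B ∧ B ≤ A ∧ A ≤ n) :
    ∃ p : SymIdx n, A = p.A ∧ B = p.B :=
  ⟨SymIdx.mk' (A := A.toNat) (B := B.toNat) (by omega) (by omega),
    by simp; omega, by simp; omega⟩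

lemma matrix_ext_ket {n : ℕ} {M N : Matrix (SymIdx n) (SymIdx n) ℂ}
    (h : ∀ A B, M.mulVec (ket n A B) = N.mulVec (ket n A B)) : M = N := by
  apply Matrix.ext_of_mulVec_single
  intro p
  rw [← ket_eq_single, h]

variable {ħ : ℂ} {n : ℕ}

lemma symRep_H_ket (i : Fin 2) (A B : ℤ) :
    ((symRep ħ n).H i).mulVec (ket n A B)
      = (((![(n : ℚ) / 2 - A + B / 2, (A : ℚ) / 2 - B] i : ℚ)) : ℂ) • ket n A B := by
  funext p
  simp only [symRep, Matrix.mulVec_diagonal, Pi.smul_apply, smul_eq_mul, ket]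
  split_ifs with h
  · obtain ⟨rfl, rfl⟩ := h
    fin_cases i
    · simp [SymIdx.m_zero]
    · simp [SymIdx.m_one]
  · simp

lemma symRep_Em_zero_ket (A B : ℤ) :
    ((symRep ħ n).Em 0).mulVec (ket n A B)
      = (qSqrt ħ ((n : ℚ) - A) * qSqrt ħ ((A : ℚ) - B + 1)) • ket n (A + 1) B := by
  by_cases h : 0 ≤ B ∧ B ≤ A ∧ A ≤ n
  · obtain ⟨p, rfl, rfl⟩ := exists_ket h
    rw [ket_eq_single, Matrix.mulVec_single_one]
    funext r
    have e1 : p.j 0 + p.m 0 = (n : ℚ) - ((p.A : ℤ) : ℚ) := by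
      rw [SymIdx.j_zero, SymIdx.m_zero]; push_cast; ring
    have e2 : p.j 0 - p.m 0 + 1 = ((p.A : ℤ) : ℚ) - ((p.B : ℤ) : ℚ) + 1 := by
      rw [SymIdx.j_zero, SymIdx.m_zero]; push_cast; ring
    simp only [symRep, Matrix.col_apply, Matrix.of_apply, SymIdx.IsLower, e1, e2, ket,
      Pi.smul_apply, smul_eq_mul]
    simp
    norm_cast
  · rw [ket_eq_zero h, Matrix.mulVec_zero]
    by_cases h' : 0 ≤ B ∧ B ≤ A + 1 ∧ A + 1 ≤ n
    · have : A = B - 1 := by omega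
      subst this
      simp
    · rw [ket_eq_zero h', smul_zero]

lemma symRep_Em_one_ket (A B : ℤ) :
    ((symRep ħ n).Em 1).mulVec (ket n A B)
      = (qSqrt ħ ((A : ℚ) - B) * qSqrt ħ ((B : ℚ) + 1)) • ket n A (B + 1) := by
  by_cases h : 0 ≤ B ∧ B ≤ A ∧ A ≤ n
  · obtain ⟨p, rfl, rfl⟩ := exists_ket h
    rw [ket_eq_single, Matrix.mulVec_single_one]
    funext r
    have e1 : p.j 1 + p.m 1 = ((p.A : ℤ) : ℚ) - ((p.B : ℤ) : ℚ) := by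
      rw [SymIdx.j_one, SymIdx.m_one]; push_cast; ring
    have e2 : p.j 1 - p.m 1 + 1 = ((p.B : ℤ) : ℚ) + 1 := by
      rw [SymIdx.j_one, SymIdx.m_one]; push_cast; ring
    simp only [symRep, Matrix.col_apply, Matrix.of_apply, SymIdx.IsLower, e1, e2, ket,
      Pi.smul_apply, smul_eq_mul]
    simp
    norm_cast
  · rw [ket_eq_zero h, Matrix.mulVec_zero]
    by_cases h' : 0 ≤ B + 1 ∧ B + 1 ≤ A ∧ A ≤ n
    · have : B = -1 := by omega
      subst this
      simp
    · rw [ket_eq_zero h', smul_zero]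

lemma symRep_Ep_zero_ket (A B : ℤ) :
    ((symRep ħ n).Ep 0).mulVec (ket n A B)
      = (qSqrt ħ ((A : ℚ) - B) * qSqrt ħ ((n : ℚ) - A + 1)) • ket n (A - 1) B := by
  by_cases h : 0 ≤ B ∧ B ≤ A ∧ A ≤ n
  · obtain ⟨p, rfl, rfl⟩ := exists_ket h
    rw [ket_eq_single, Matrix.mulVec_single_one]
    funext r
    have e1 : p.j 0 - p.m 0 = ((p.A : ℤ) : ℚ) - ((p.B : ℤ) : ℚ) := by
      rw [SymIdx.j_zero, SymIdx.m_zero]; push_cast; ring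
    have e2 : p.j 0 + p.m 0 + 1 = (n : ℚ) - ((p.A : ℤ) : ℚ) + 1 := by
      rw [SymIdx.j_zero, SymIdx.m_zero]; push_cast; ring
    simp only [symRep, Matrix.col_apply, Matrix.of_apply, SymIdx.IsLower, e1, e2, ket,
      Pi.smul_apply, smul_eq_mul, mul_ite, mul_one, mul_zero]
    refine if_congr ?_ rfl rfl
    simp
    omega
  · rw [ket_eq_zero h, Matrix.mulVec_zero]
    by_cases h' : 0 ≤ B ∧ B ≤ A - 1 ∧ A - 1 ≤ n
    · have : A = n + 1 := by omega
      subst this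
      simp
    · rw [ket_eq_zero h', smul_zero]

lemma symRep_Ep_one_ket (A B : ℤ) :
    ((symRep ħ n).Ep 1).mulVec (ket n A B)
      = (qSqrt ħ (B : ℚ) * qSqrt ħ ((A : ℚ) - B + 1)) • ket n A (B - 1) := by
  by_cases h : 0 ≤ B ∧ B ≤ A ∧ A ≤ n
  · obtain ⟨p, rfl, rfl⟩ := exists_ket h
    rw [ket_eq_single, Matrix.mulVec_single_one]
    funext r
    have e1 : p.j 1 - p.m 1 = ((p.B : ℤ) : ℚ) := by
      rw [SymIdx.j_one, SymIdx.m_one]; push_cast; ring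
    have e2 : p.j 1 + p.m 1 + 1 = ((p.A : ℤ) : ℚ) - ((p.B : ℤ) : ℚ) + 1 := by
      rw [SymIdx.j_one, SymIdx.m_one]; push_cast; ring
    simp only [symRep, Matrix.col_apply, Matrix.of_apply, SymIdx.IsLower, e1, e2, ket,
      Pi.smul_apply, smul_eq_mul, mul_ite, mul_one, mul_zero]
    refine if_congr ?_ rfl rfl
    simp
    omega
  · rw [ket_eq_zero h, Matrix.mulVec_zero]
    by_cases h' : 0 ≤ B - 1 ∧ B - 1 ≤ A ∧ A ≤ n
    · have : B = A + 1 := by omega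
      subst this
      simp
    · rw [ket_eq_zero h', smul_zero]

/-- The same square roots occur in both directions along an edge of the weight diagram. -/
lemma symRep_transpose (i : Fin 2) : ((symRep ħ n).Em i).transpose = (symRep ħ n).Ep i := by
  ext t u
  simp only [symRep, Matrix.transpose_apply, Matrix.of_apply]
  by_cases h : t.IsLower i u
  swap
  · simp [h]
  rw [if_pos h, if_pos h]
  obtain ⟨hA, hB⟩ := h
  have hA' : (u.A : ℚ) = t.A + if i = 0 then 1 else 0 := by rw [hA]; split_ifs <;> simp
  have hB' : (u.B : ℚ) = t.B + if i = 1 then 1 else 0 := by rw [hB]; split_ifs <;> simp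
  rw [mul_comm]
  fin_cases i
  · simp only [Fin.zero_eta, SymIdx.j_zero, SymIdx.m_zero, hA', hB']
    congr 2 <;> simp <;> ring
  · simp only [Fin.mk_one, SymIdx.j_one, SymIdx.m_one, hA', hB']
    (congr 2 <;> simp); ring

lemma symRep_H_eq_diagonal (i : Fin 2) :
    (symRep ħ n).H i = Matrix.diagonal fun p : SymIdx n => ((p.m i : ℚ) : ℂ) := rfl

lemma qNumTwoMat_symRep_ket (i : Fin 2) (A B : ℤ) :
    (qNumTwoMat ħ ((symRep ħ n).H i)).mulVec (ket n A B)
      = qNum ħ (2 * ![(n : ℚ) / 2 - A + B / 2, (A : ℚ) / 2 - B] i) • ket n A B := by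
  rw [qNumTwoMat, symRep_H_eq_diagonal, qPowMat_diagonal, qPowMat_diagonal]
  funext p
  simp only [Matrix.smul_mulVec, Matrix.sub_mulVec, Matrix.mulVec_diagonal, Pi.smul_apply,
    Pi.sub_apply, smul_eq_mul, ket]
  split_ifs with h
  · obtain ⟨rfl, rfl⟩ := h
    simp only [mul_one, qNum, div_eq_inv_mul (_ - _)]
    congr 2
    · congr 1
      fin_cases i
      · simp [SymIdx.m_zero]
      · simp [SymIdx.m_one]
    · congr 1
      fin_cases i
      · simp [SymIdx.m_zero]; ring
      · simp [SymIdx.m_one]; ring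
  · simp

/-- All relations are checked on the states `ket n A B` with arbitrary integer coordinates; in the
occupation numbers `n - A`, `A - B`, `B` they become identities of q-numbers. -/
theorem isRep_symRep (hq : Admissible ħ 1) (n : ℕ) : IsRep ħ (symRep ħ n) := by
  have sq' : ∀ x : ℚ, qSqrt ħ x ^ 2 = qNum ħ x := fun x => by rw [sq, qSqrt_mul_self]
  refine ⟨fun i j => ?_, fun i j => ?_, fun i j => ?_, fun i j => ?_, fun i j hij => ?_,
    fun i j hij => ?_⟩
  · rw [symRep_H_eq_diagonal, symRep_H_eq_diagonal, Matrix.diagonal_mul_diagonal,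
      Matrix.diagonal_mul_diagonal]
    simp only [mul_comm]
  · apply matrix_ext_ket
    intro A B
    fin_cases i <;> fin_cases j <;>
    simp only [Fin.zero_eta, Fin.mk_one, Matrix.sub_mulVec, ← Matrix.mulVec_mulVec,
      Matrix.smul_mulVec, symRep_Ep_zero_ket, symRep_Ep_one_ket, symRep_H_ket, Matrix.mulVec_smul,
      smul_smul, ← sub_smul] <;>
    congr 1 <;> simp [rootDot] <;> ring
  · apply matrix_ext_ket
    intro A B
    fin_cases i <;> fin_cases j <;>
    simp only [Fin.zero_eta, Fin.mk_one, Matrix.sub_mulVec, ← Matrix.mulVec_mulVec,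
      Matrix.smul_mulVec, symRep_Em_zero_ket, symRep_Em_one_ket, symRep_H_ket, Matrix.mulVec_smul,
      smul_smul, ← sub_smul, Matrix.neg_mulVec, ← neg_smul] <;>
    congr 1 <;> simp [rootDot] <;> ring
  · apply matrix_ext_ket
    intro A B
    -- the occupation numbers `a = n - A`, `b = A - B` and `B`
    obtain ⟨b, hb⟩ : ∃ b : ℚ, (A : ℚ) = B + b := ⟨A - B, by ring⟩
    obtain ⟨a, ha⟩ : ∃ a : ℚ, (n : ℚ) = a + B + b := ⟨n - B - b, by ring⟩
    fin_cases i <;> fin_cases j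
    · simp only [Fin.zero_eta, Fin.mk_one, Matrix.sub_mulVec, ← Matrix.mulVec_mulVec, if_true,
        qNumTwoMat_symRep_ket, symRep_Em_zero_ket, symRep_Ep_zero_ket, Matrix.mulVec_smul,
        smul_smul]
      rw [add_sub_cancel_right, sub_add_cancel, ← sub_smul]
      congr 1
      push_cast
      simp only [ha, hb, Matrix.cons_val_zero]
      ring_nf
      have := qNum_mul_succ_sub hq a b
      rw [add_comm b 1, add_comm a 1] at this
      simp only [sq', this]
    · simp only [Fin.zero_eta, Fin.mk_one, Matrix.sub_mulVec, ← Matrix.mulVec_mulVec,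
        symRep_Em_zero_ket, symRep_Em_one_ket, symRep_Ep_zero_ket, symRep_Ep_one_ket,
        Matrix.mulVec_smul, smul_smul, ← sub_smul, zero_ne_one, if_false, Matrix.zero_mulVec]
      convert zero_smul ℂ _
      push_cast
      simp only [ha, hb]
      ring_nf
    · simp only [Fin.zero_eta, Fin.mk_one, Matrix.sub_mulVec, ← Matrix.mulVec_mulVec,
        symRep_Em_zero_ket, symRep_Em_one_ket, symRep_Ep_zero_ket, symRep_Ep_one_ket,
        Matrix.mulVec_smul, smul_smul, ← sub_smul, one_ne_zero, if_false, Matrix.zero_mulVec]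
      convert zero_smul ℂ _
      push_cast
      simp only [ha, hb]
      ring_nf
    · simp only [Fin.zero_eta, Fin.mk_one, Matrix.sub_mulVec, ← Matrix.mulVec_mulVec, if_true,
        qNumTwoMat_symRep_ket, symRep_Em_one_ket, symRep_Ep_one_ket, Matrix.mulVec_smul,
        smul_smul]
      rw [add_sub_cancel_right, sub_add_cancel, ← sub_smul]
      congr 1
      push_cast
      simp only [hb, Matrix.cons_val_one, Matrix.cons_val_zero]
      ring_nf
      have := qNum_mul_succ_sub hq b B
      rw [add_comm b 1, add_comm (B : ℚ) 1, sub_eq_neg_add b (B : ℚ)] at this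
      simp only [sq', this]
  · apply matrix_ext_ket
    intro A B
    obtain ⟨b, hb⟩ : ∃ b : ℚ, (A : ℚ) = B + b := ⟨A - B, by ring⟩
    obtain ⟨a, ha⟩ : ∃ a : ℚ, (n : ℚ) = a + B + b := ⟨n - B - b, by ring⟩
    -- `b` is the occupation number which the operators of both roots change
    have s1 := qNum_serre hq b
    have s2 := qNum_serre hq (-1 + b)
    rw [add_comm b 1, add_comm b 2] at s1
    rw [show -1 + b + 1 = b by ring, show -1 + b + 2 = 1 + b by ring] at s2
    fin_cases i <;> fin_cases j <;> simp at hij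
    all_goals
      simp only [Fin.zero_eta, Fin.mk_one, Matrix.sub_mulVec, Matrix.add_mulVec, sq,
        ← Matrix.mulVec_mulVec, Matrix.smul_mulVec, symRep_Ep_zero_ket, symRep_Ep_one_ket,
        Matrix.mulVec_smul, smul_smul, ← sub_smul, ← add_smul, Matrix.zero_mulVec]
      convert zero_smul ℂ _
      push_cast
      simp only [ha, hb]
      ring_nf
      simp only [sq']
    · linear_combination (qSqrt ħ B * qSqrt ħ (1 + a) * qSqrt ħ b * qSqrt ħ (2 + a))
        * (s2 - qNum ħ 2 * sq' b)
    · linear_combination (qSqrt ħ (1 + a) * qSqrt ħ B * qSqrt ħ (-1 + B) * qSqrt ħ (1 + b))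
        * (s1 - qNum ħ 2 * sq' (1 + b))
  · apply matrix_ext_ket
    intro A B
    obtain ⟨b, hb⟩ : ∃ b : ℚ, (A : ℚ) = B + b := ⟨A - B, by ring⟩
    obtain ⟨a, ha⟩ : ∃ a : ℚ, (n : ℚ) = a + B + b := ⟨n - B - b, by ring⟩
    have s1 := qNum_serre hq b
    have s2 := qNum_serre hq (-1 + b)
    rw [add_comm b 1, add_comm b 2] at s1
    rw [show -1 + b + 1 = b by ring, show -1 + b + 2 = 1 + b by ring] at s2
    fin_cases i <;> fin_cases j <;> simp at hij
    all_goals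
      simp only [Fin.zero_eta, Fin.mk_one, Matrix.sub_mulVec, Matrix.add_mulVec, sq,
        ← Matrix.mulVec_mulVec, Matrix.smul_mulVec, symRep_Em_zero_ket, symRep_Em_one_ket,
        Matrix.mulVec_smul, smul_smul, ← sub_smul, ← add_smul, Matrix.zero_mulVec]
      convert zero_smul ℂ _
      push_cast
      simp only [ha, hb]
      ring_nf
      simp only [sq']
    · linear_combination (qSqrt ħ (1 + B) * qSqrt ħ a * qSqrt ħ (-1 + a) * qSqrt ħ (1 + b))
        * (s1 - qNum ħ 2 * sq' (1 + b))
    · linear_combination (qSqrt ħ a * qSqrt ħ (1 + B) * qSqrt ħ b * qSqrt ħ (2 + B))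
        * (s2 - qNum ħ 2 * sq' b)

end

section

/-! ### Graded representations and the contravariant pairing -/

section Pairing

variable {ι : Type} [Fintype ι]

lemma pairing_eq_dotProduct (v w : ι → ℂ) : pairing v w = dotProduct v w := rfl

lemma pairing_comm (v w : ι → ℂ) : pairing v w = pairing w v := dotProduct_comm v w

lemma pairing_add_right (u v w : ι → ℂ) : pairing u (v + w) = pairing u v + pairing u w :=
  dotProduct_add u v w

lemma pairing_add_left (u v w : ι → ℂ) : pairing (u + v) w = pairing u w + pairing v w :=
  add_dotProduct u v w

lemma pairing_sub_right (u v w : ι → ℂ) : pairing u (v - w) = pairing u v - pairing u w :=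
  dotProduct_sub u v w

lemma pairing_smul_right (c : ℂ) (v w : ι → ℂ) : pairing v (c • w) = c * pairing v w :=
  dotProduct_smul c v w

lemma pairing_smul_left (c : ℂ) (v w : ι → ℂ) : pairing (c • v) w = c * pairing v w :=
  smul_dotProduct c v w

@[simp] lemma pairing_zero_right (v : ι → ℂ) : pairing v 0 = 0 := dotProduct_zero v

@[simp] lemma pairing_zero_left (v : ι → ℂ) : pairing 0 v = 0 := zero_dotProduct v

lemma pairing_sum_right {α : Type*} (s : Finset α) (f : α → ι → ℂ) (v : ι → ℂ) :
    pairing v (∑ a ∈ s, f a) = ∑ a ∈ s, pairing v (f a) := dotProduct_sum v s f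

lemma pairing_sum_left {α : Type*} (s : Finset α) (f : α → ι → ℂ) (v : ι → ℂ) :
    pairing (∑ a ∈ s, f a) v = ∑ a ∈ s, pairing (f a) v := sum_dotProduct s f v

end Pairing

variable {ι : Type} [Fintype ι] [DecidableEq ι]

/-- A representation with basis `ι` in which the basis state `p` has the weight
`N μ₁ - (A p) α₁ - (B p) α₂` and in which the raising operators are the transposes of the lowering
operators. -/
structure IsGraded (ħ : ℂ) (R : Ops ι) (N : ℕ) (A B : ι → ℕ) : Prop where
  rep : IsRep ħ R
  H_eq : ∀ i, R.H i = Matrix.diagonal fun p =>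
    (((![(N : ℚ) / 2 - A p + B p / 2, (A p : ℚ) / 2 - B p] i : ℚ)) : ℂ)
  transpose : ∀ i, (R.Em i).transpose = R.Ep i

/-- The vectors supported on the basis states with `A = a` and `B = b`. -/
def wt (A B : ι → ℕ) (a b : ℤ) : Submodule ℂ (ι → ℂ) where
  carrier := {v | ∀ p, v p ≠ 0 → (A p : ℤ) = a ∧ (B p : ℤ) = b}
  zero_mem' := fun p h => absurd rfl h
  add_mem' := fun {v w} hv hw p h => by
    by_cases h1 : v p = 0
    · exact hw p (fun h2 => h (by simp [h1, h2]))
    · exact hv p h1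
  smul_mem' := fun c v hv p h => hv p (fun h2 => h (by simp [h2]))

/-- The restriction of a vector to the basis states with `A = a` and `B = b`. -/
def wtProj (A B : ι → ℕ) (a b : ℤ) : (ι → ℂ) →ₗ[ℂ] (ι → ℂ) where
  toFun v p := if (A p : ℤ) = a ∧ (B p : ℤ) = b then v p else 0
  map_add' v w := by funext p; simp only [Pi.add_apply]; split_ifs <;> simp
  map_smul' c v := by funext p; simp only [Pi.smul_apply, RingHom.id_apply]; split_ifs <;> simp

lemma wtProj_apply (A B : ι → ℕ) (a b : ℤ) (v : ι → ℂ) (p : ι) :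
    wtProj A B a b v p = if (A p : ℤ) = a ∧ (B p : ℤ) = b then v p else 0 := rfl

lemma wtProj_mem (A B : ι → ℕ) (a b : ℤ) (v : ι → ℂ) : wtProj A B a b v ∈ wt A B a b := by
  intro p h
  by_contra h'
  exact h (if_neg h')

lemma wtProj_of_mem {A B : ι → ℕ} {a b : ℤ} {v : ι → ℂ} (hv : v ∈ wt A B a b) :
    wtProj A B a b v = v := by
  funext p
  rw [wtProj_apply]
  split_ifs with h
  · rfl
  · by_contra h0
    exact h (hv p (Ne.symm h0))

lemma wtProj_of_mem_of_ne {A B : ι → ℕ} {a b a' b' : ℤ} {v : ι → ℂ} (hv : v ∈ wt A B a b)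
    (h : ¬ (a = a' ∧ b = b')) : wtProj A B a' b' v = 0 := by
  funext p
  rw [wtProj_apply]
  split_ifs with h1
  · by_contra h0
    have := hv p h0
    omega
  · rfl

lemma pairing_eq_zero_of_wt {A B : ι → ℕ} {a b a' b' : ℤ} {v w : ι → ℂ} (hv : v ∈ wt A B a b)
    (hw : w ∈ wt A B a' b') (h : ¬ (a = a' ∧ b = b')) : pairing v w = 0 := by
  refine Finset.sum_eq_zero fun p _ => ?_
  by_contra h0
  have h1 := hv p (left_ne_zero_of_mul h0)
  have h2 := hw p (right_ne_zero_of_mul h0)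
  omega

/-- A subspace that contains all homogeneous components of a vector contains the vector, which is
their sum. -/
lemma mem_of_wtProj_mem {A B : ι → ℕ} {W : Submodule ℂ (ι → ℂ)} {v : ι → ℂ}
    (h : ∀ a b : ℕ, wtProj A B a b v ∈ W) : v ∈ W := by
  have : v = ∑ x ∈ Finset.univ.image (fun p => (A p, B p)), wtProj A B x.1 x.2 v := by
    funext p
    rw [Finset.sum_apply, Finset.sum_eq_single_of_mem (A p, B p)
      (Finset.mem_image.2 ⟨p, Finset.mem_univ p, rfl⟩)]
    · simp [wtProj_apply]
    · intro x _ hx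
      rw [wtProj_apply, if_neg]
      rintro ⟨h1, h2⟩
      exact hx (Prod.ext (by simpa using h1.symm) (by simpa using h2.symm))
  rw [this]
  exact W.sum_mem fun x _ => h _ _

namespace IsGraded

variable {ħ : ℂ} {R : Ops ι} {N : ℕ} {A B : ι → ℕ}

/-- A nonzero matrix element of a lowering operator changes the weight by a simple root: the two
coordinates of the weight are recovered from the eigenvalues of `H`. -/
lemma Em_shift (G : IsGraded ħ R N A B) {j : Fin 2} {p r : ι} (h : R.Em j p r ≠ 0) :
    (A p : ℤ) = A r + (if j = 0 then 1 else 0) ∧ (B p : ℤ) = B r + (if j = 1 then 1 else 0) := by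
  have key : ∀ i, (![(N : ℚ) / 2 - A p + B p / 2, (A p : ℚ) / 2 - B p] i
      - ![(N : ℚ) / 2 - A r + B r / 2, (A r : ℚ) / 2 - B r] i) = - rootDot i j := by
    intro i
    have := congrFun (congrFun (G.rep.H_Em i j) p) r
    rw [G.H_eq] at this
    simp only [Matrix.sub_apply, Matrix.diagonal_mul, Matrix.mul_diagonal, Matrix.smul_apply,
      Matrix.neg_apply, smul_eq_mul] at this
    have h1 := mul_right_cancel₀ h (show (((![(N : ℚ) / 2 - A p + B p / 2, (A p : ℚ) / 2 - B p] i
      - ![(N : ℚ) / 2 - A r + B r / 2, (A r : ℚ) / 2 - B r] i : ℚ)) : ℂ) * R.Em j p r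
      = ((-rootDot i j : ℚ) : ℂ) * R.Em j p r by
        rw [Rat.cast_sub, Rat.cast_neg]; linear_combination this)
    exact_mod_cast h1
  have k0 := key 0
  have k1 := key 1
  fin_cases j <;> simp [rootDot] at k0 k1
  · have a1 : (A p : ℚ) = A r + 1 := by linarith
    have a2 : (B p : ℚ) = B r := by linarith
    exact ⟨by exact_mod_cast a1, by simpa using a2⟩
  · have a1 : (A p : ℚ) = A r := by linarith
    have a2 : (B p : ℚ) = B r + 1 := by linarith
    exact ⟨by simpa using a1, by exact_mod_cast a2⟩

lemma Em_zero_mem (G : IsGraded ħ R N A B) {a b : ℤ} {v : ι → ℂ} (hv : v ∈ wt A B a b) :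
    (R.Em 0).mulVec v ∈ wt A B (a + 1) b := by
  intro p h
  obtain ⟨r, -, h1⟩ := Finset.exists_ne_zero_of_sum_ne_zero h
  have h2 := G.Em_shift (left_ne_zero_of_mul h1)
  have h3 := hv r (right_ne_zero_of_mul h1)
  simp at h2
  omega

lemma Em_one_mem (G : IsGraded ħ R N A B) {a b : ℤ} {v : ι → ℂ} (hv : v ∈ wt A B a b) :
    (R.Em 1).mulVec v ∈ wt A B a (b + 1) := by
  intro p h
  obtain ⟨r, -, h1⟩ := Finset.exists_ne_zero_of_sum_ne_zero h
  have h2 := G.Em_shift (left_ne_zero_of_mul h1)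
  have h3 := hv r (right_ne_zero_of_mul h1)
  simp at h2
  omega

lemma Ep_apply (G : IsGraded ħ R N A B) (j : Fin 2) (p r : ι) : R.Ep j p r = R.Em j r p := by
  rw [← G.transpose]; rfl

lemma Ep_zero_mem (G : IsGraded ħ R N A B) {a b : ℤ} {v : ι → ℂ} (hv : v ∈ wt A B a b) :
    (R.Ep 0).mulVec v ∈ wt A B (a - 1) b := by
  intro p h
  obtain ⟨r, -, h1⟩ := Finset.exists_ne_zero_of_sum_ne_zero h
  have h2 : R.Ep _ p r ≠ 0 := left_ne_zero_of_mul h1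
  have h2 := G.Em_shift (by rwa [← G.Ep_apply])
  have h3 := hv r (right_ne_zero_of_mul h1)
  simp at h2
  omega

lemma Ep_one_mem (G : IsGraded ħ R N A B) {a b : ℤ} {v : ι → ℂ} (hv : v ∈ wt A B a b) :
    (R.Ep 1).mulVec v ∈ wt A B a (b - 1) := by
  intro p h
  obtain ⟨r, -, h1⟩ := Finset.exists_ne_zero_of_sum_ne_zero h
  have h2 : R.Ep _ p r ≠ 0 := left_ne_zero_of_mul h1
  have h2 := G.Em_shift (by rwa [← G.Ep_apply])
  have h3 := hv r (right_ne_zero_of_mul h1)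
  simp at h2
  omega

/-- The pairing is contravariant. -/
lemma pairing_Em (G : IsGraded ħ R N A B) (i : Fin 2) (v w : ι → ℂ) :
    pairing ((R.Em i).mulVec v) w = pairing v ((R.Ep i).mulVec w) := by
  rw [← G.transpose, pairing_eq_dotProduct, pairing_eq_dotProduct, Matrix.mulVec_transpose,
    dotProduct_comm, Matrix.dotProduct_mulVec, dotProduct_comm]

lemma H_mulVec (G : IsGraded ħ R N A B) {a b : ℤ} {v : ι → ℂ} (hv : v ∈ wt A B a b) (i : Fin 2) :
    (R.H i).mulVec v = (((![(N : ℚ) / 2 - a + b / 2, (a : ℚ) / 2 - b] i : ℚ)) : ℂ) • v := by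
  rw [G.H_eq]
  funext p
  rw [Matrix.mulVec_diagonal, Pi.smul_apply, smul_eq_mul]
  by_cases h : v p = 0
  · simp [h]
  · obtain ⟨rfl, rfl⟩ := hv p h
    simp

lemma qNumTwoMat_mulVec (G : IsGraded ħ R N A B) {a b : ℤ} {v : ι → ℂ} (hv : v ∈ wt A B a b)
    (i : Fin 2) : (qNumTwoMat ħ (R.H i)).mulVec v
      = qNum ħ (![(N : ℚ) - 2 * a + b, (a : ℚ) - 2 * b] i) • v := by
  rw [qNumTwoMat, G.H_eq, qPowMat_diagonal, qPowMat_diagonal]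
  funext p
  simp only [Matrix.smul_mulVec, Matrix.sub_mulVec, Matrix.mulVec_diagonal, Pi.smul_apply,
    Pi.sub_apply, smul_eq_mul]
  by_cases h : v p = 0
  · simp [h]
  · obtain ⟨rfl, rfl⟩ := hv p h
    rw [← sub_mul, ← mul_assoc, qNum, div_eq_inv_mul (_ - _)]
    congr 3
    · congr 1; fin_cases i <;> simp <;> ring
    · congr 1; fin_cases i <;> simp <;> ring

lemma Ep_Em_zero (G : IsGraded ħ R N A B) {a b : ℤ} {v : ι → ℂ} (hv : v ∈ wt A B a b) :
    (R.Ep 0).mulVec ((R.Em 0).mulVec v)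
      = (R.Em 0).mulVec ((R.Ep 0).mulVec v) + qNum ħ ((N : ℚ) - 2 * a + b) • v := by
  have h1 := G.rep.Ep_Em 0 0
  rw [if_pos rfl, sub_eq_iff_eq_add] at h1
  rw [Matrix.mulVec_mulVec, h1, Matrix.add_mulVec, G.qNumTwoMat_mulVec hv, Matrix.mulVec_mulVec,
    add_comm]
  rfl

lemma Ep_Em_one (G : IsGraded ħ R N A B) {a b : ℤ} {v : ι → ℂ} (hv : v ∈ wt A B a b) :
    (R.Ep 1).mulVec ((R.Em 1).mulVec v)
      = (R.Em 1).mulVec ((R.Ep 1).mulVec v) + qNum ħ ((a : ℚ) - 2 * b) • v := by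
  have h1 := G.rep.Ep_Em 1 1
  rw [if_pos rfl, sub_eq_iff_eq_add] at h1
  rw [Matrix.mulVec_mulVec, h1, Matrix.add_mulVec, G.qNumTwoMat_mulVec hv, Matrix.mulVec_mulVec,
    add_comm]
  rfl

lemma Ep_Em_of_ne (G : IsGraded ħ R N A B) {i j : Fin 2} (hij : i ≠ j) (v : ι → ℂ) :
    (R.Ep i).mulVec ((R.Em j).mulVec v) = (R.Em j).mulVec ((R.Ep i).mulVec v) := by
  have h1 := G.rep.Ep_Em i j
  rw [if_neg hij, sub_eq_zero] at h1
  rw [Matrix.mulVec_mulVec, h1, Matrix.mulVec_mulVec]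

lemma wtProj_Em_zero (G : IsGraded ħ R N A B) (a b : ℤ) (v : ι → ℂ) :
    wtProj A B a b ((R.Em 0).mulVec v) = (R.Em 0).mulVec (wtProj A B (a - 1) b v) := by
  funext p
  rw [wtProj_apply]
  simp only [Matrix.mulVec, dotProduct, wtProj_apply]
  have e : ∀ (c : Prop) [Decidable c] (f : ι → ℂ),
      (if c then ∑ x, f x else 0) = ∑ x, if c then f x else 0 := fun c _ f => by
    split_ifs <;> simp
  rw [e]
  refine Finset.sum_congr rfl fun r _ => ?_
  by_cases h : R.Em 0 p r = 0
  · simp [h]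
  · have h2 := G.Em_shift h
    simp only [if_true, zero_ne_one, if_false, add_zero] at h2
    have : ((A p : ℤ) = a ∧ (B p : ℤ) = b) ↔ ((A r : ℤ) = a - 1 ∧ (B r : ℤ) = b) := by omega
    simp only [this, mul_ite, mul_zero]

lemma wtProj_Em_one (G : IsGraded ħ R N A B) (a b : ℤ) (v : ι → ℂ) :
    wtProj A B a b ((R.Em 1).mulVec v) = (R.Em 1).mulVec (wtProj A B a (b - 1) v) := by
  funext p
  rw [wtProj_apply]
  simp only [Matrix.mulVec, dotProduct, wtProj_apply]
  have e : ∀ (c : Prop) [Decidable c] (f : ι → ℂ),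
      (if c then ∑ x, f x else 0) = ∑ x, if c then f x else 0 := fun c _ f => by
    split_ifs <;> simp
  rw [e]
  refine Finset.sum_congr rfl fun r _ => ?_
  by_cases h : R.Em 1 p r = 0
  · simp [h]
  · have h2 := G.Em_shift h
    simp only [if_true, one_ne_zero, if_false, add_zero] at h2
    have : ((A p : ℤ) = a ∧ (B p : ℤ) = b) ↔ ((A r : ℤ) = a ∧ (B r : ℤ) = b - 1) := by omega
    simp only [this, mul_ite, mul_zero]

end IsGraded

/-! ### The root vectors of the non-simple root -/

/-- The raising operator of the root `α₃ = α₁ + α₂` matching `Em3`: together they generate a copy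
of `U_q(sl₂)`. It is not the transpose of `Em3`. -/
def Ep3 (ħ : ℂ) (ε : ℤ) (R : Ops ι) : Matrix ι ι ℂ :=
  R.Ep 0 * R.Ep 1 - qPow ħ (-(ε : ℚ) / 2) • (R.Ep 1 * R.Ep 0)

namespace IsGraded

variable {ħ : ℂ} {R : Ops ι} {N : ℕ} {A B : ι → ℕ} {ε : ℤ}

lemma qNum_two_eq (hq : Admissible ħ 1) (hε : ε = 1 ∨ ε = -1) :
    qNum ħ 2 = qPow ħ ((ε : ℚ) / 2) + qPow ħ (-(ε : ℚ) / 2) := by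
  rw [qNum_two hq]
  rcases hε with rfl | rfl
  · norm_num
  · norm_num; ring

/-- `Em3` q-commutes with `Em 0`; this is the q-Serre relation. -/
lemma Em3_mul_Em_zero (G : IsGraded ħ R N A B) (hq : Admissible ħ 1) (hε : ε = 1 ∨ ε = -1) :
    Em3 ħ ε R * R.Em 0 = qPow ħ (-(ε : ℚ) / 2) • (R.Em 0 * Em3 ħ ε R) := by
  have h := G.rep.serre_Em 0 1 (by simp)
  have e : qPow ħ (-(ε : ℚ) / 2) * qPow ħ ((ε : ℚ) / 2) = 1 := by
    rw [← qPow_add]; ring_nf; simp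
  rw [qNum_two_eq hq hε] at h
  simp only [sq] at h
  simp only [Em3, sub_mul, mul_sub, smul_sub, mul_smul_comm, smul_mul_assoc, smul_smul, e,
    mul_assoc] at h ⊢
  linear_combination (norm := module) h

/-- `Em3` q-commutes with `Em 1`; this is the other q-Serre relation. -/
lemma Em_one_mul_Em3 (G : IsGraded ħ R N A B) (hq : Admissible ħ 1) (hε : ε = 1 ∨ ε = -1) :
    R.Em 1 * Em3 ħ ε R = qPow ħ (-(ε : ℚ) / 2) • (Em3 ħ ε R * R.Em 1) := by
  have h := G.rep.serre_Em 1 0 (by simp)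
  have e : qPow ħ (-(ε : ℚ) / 2) * qPow ħ ((ε : ℚ) / 2) = 1 := by
    rw [← qPow_add]; ring_nf; simp
  rw [qNum_two_eq hq hε] at h
  simp only [sq] at h
  simp only [Em3, sub_mul, mul_sub, smul_sub, mul_smul_comm, smul_mul_assoc, smul_smul, e,
    mul_assoc] at h ⊢
  linear_combination (norm := module) h

lemma Em3_mulVec (v : ι → ℂ) : (Em3 ħ ε R).mulVec v
    = (R.Em 1).mulVec ((R.Em 0).mulVec v)
      - qPow ħ ((ε : ℚ) / 2) • (R.Em 0).mulVec ((R.Em 1).mulVec v) := by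
  simp only [Em3, Matrix.sub_mulVec, Matrix.smul_mulVec, Matrix.mulVec_mulVec]

lemma Ep3_mulVec (v : ι → ℂ) : (Ep3 ħ ε R).mulVec v
    = (R.Ep 0).mulVec ((R.Ep 1).mulVec v)
      - qPow ħ (-(ε : ℚ) / 2) • (R.Ep 1).mulVec ((R.Ep 0).mulVec v) := by
  simp only [Ep3, Matrix.sub_mulVec, Matrix.smul_mulVec, Matrix.mulVec_mulVec]

lemma Em3_mem (G : IsGraded ħ R N A B) {a b : ℤ} {v : ι → ℂ} (hv : v ∈ wt A B a b) :
    (Em3 ħ ε R).mulVec v ∈ wt A B (a + 1) (b + 1) := by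
  rw [Em3_mulVec]
  exact sub_mem (G.Em_one_mem (G.Em_zero_mem hv))
    (Submodule.smul_mem _ _ (G.Em_zero_mem (G.Em_one_mem hv)))

lemma Ep3_mem (G : IsGraded ħ R N A B) {a b : ℤ} {v : ι → ℂ} (hv : v ∈ wt A B a b) :
    (Ep3 ħ ε R).mulVec v ∈ wt A B (a - 1) (b - 1) := by
  rw [Ep3_mulVec]
  exact sub_mem (G.Ep_zero_mem (G.Ep_one_mem hv))
    (Submodule.smul_mem _ _ (G.Ep_one_mem (G.Ep_zero_mem hv)))

lemma Ep_zero_Em3 (G : IsGraded ħ R N A B) (hq : Admissible ħ 1) (hε : ε = 1 ∨ ε = -1)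
    {a b : ℤ} {v : ι → ℂ} (hv : v ∈ wt A B a b) :
    (R.Ep 0).mulVec ((Em3 ħ ε R).mulVec v) = (Em3 ħ ε R).mulVec ((R.Ep 0).mulVec v)
      - qPow ħ (ε * ((N : ℚ) - 2 * a + b + 1) / 2) • (R.Em 1).mulVec v := by
  have key : qNum ħ ((N : ℚ) - 2 * a + b)
      - qPow ħ ((ε : ℚ) / 2) * qNum ħ ((N : ℚ) - 2 * a + b + 1)
      = - qPow ħ (ε * ((N : ℚ) - 2 * a + b + 1) / 2) := by
    generalize (N : ℚ) - 2 * a + b = h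
    have e : qPow ħ (1 / 2) * qPow ħ (-1 / 2) = 1 := by rw [← qPow_add]; norm_num
    rcases hε with rfl | rfl
    · rw [qNum_add, qNum_one hq]
      have : qPow ħ (((1 : ℤ) : ℚ) * (h + 1) / 2) = qPow ħ (1 / 2) * qPow ħ (h / 2) := by
        rw [← qPow_add]; congr 1; push_cast; ring
      rw [this]; push_cast
      linear_combination (-qNum ħ h) * e
    · rw [qNum_add', qNum_one hq]
      have : qPow ħ (((-1 : ℤ) : ℚ) * (h + 1) / 2) = qPow ħ (-1 / 2) * qPow ħ (-h / 2) := by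
        rw [← qPow_add]; congr 1; push_cast; ring
      rw [this]; push_cast
      linear_combination (-qNum ħ h) * e
  rw [Em3_mulVec, Em3_mulVec, Matrix.mulVec_sub, Matrix.mulVec_smul, G.Ep_Em_of_ne (by simp),
    G.Ep_Em_zero hv, G.Ep_Em_zero (G.Em_one_mem hv), G.Ep_Em_of_ne (by simp), Matrix.mulVec_add,
    Matrix.mulVec_smul]
  have : (N : ℚ) - 2 * a + ((b + 1 : ℤ) : ℚ) = (N : ℚ) - 2 * a + b + 1 := by push_cast; ring
  rw [this]
  linear_combination (norm := module) congrArg (fun c => c • (R.Em 1).mulVec v) key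

lemma Ep_one_Em3 (G : IsGraded ħ R N A B) (hq : Admissible ħ 1) (hε : ε = 1 ∨ ε = -1)
    {a b : ℤ} {v : ι → ℂ} (hv : v ∈ wt A B a b) :
    (R.Ep 1).mulVec ((Em3 ħ ε R).mulVec v) = (Em3 ħ ε R).mulVec ((R.Ep 1).mulVec v)
      + qPow ħ (-ε * ((a : ℚ) - 2 * b) / 2) • (R.Em 0).mulVec v := by
  have key : qNum ħ ((a : ℚ) - 2 * b + 1) - qPow ħ ((ε : ℚ) / 2) * qNum ħ ((a : ℚ) - 2 * b)
      = qPow ħ (-ε * ((a : ℚ) - 2 * b) / 2) := by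
    generalize (a : ℚ) - 2 * b = h
    rcases hε with rfl | rfl
    · rw [qNum_add', qNum_one hq]
      push_cast
      ring_nf
    · rw [qNum_add, qNum_one hq]
      push_cast
      ring_nf
  rw [Em3_mulVec, Em3_mulVec, Matrix.mulVec_sub, Matrix.mulVec_smul,
    G.Ep_Em_one (G.Em_zero_mem hv), G.Ep_Em_of_ne one_ne_zero v,
    G.Ep_Em_of_ne one_ne_zero ((R.Em 1).mulVec v), G.Ep_Em_one hv, Matrix.mulVec_add,
    Matrix.mulVec_smul]
  have : ((a + 1 : ℤ) : ℚ) - 2 * b = (a : ℚ) - 2 * b + 1 := by push_cast; ring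
  rw [this]
  linear_combination (norm := module) congrArg (fun c => c • (R.Em 0).mulVec v) key

/-- `Ep3` and `Em3` satisfy the commutation relation of `U_q(sl₂)` for the root `α₃`. -/
lemma Ep3_Em3 (G : IsGraded ħ R N A B) (hq : Admissible ħ 1) (hε : ε = 1 ∨ ε = -1)
    {a b : ℤ} {v : ι → ℂ} (hv : v ∈ wt A B a b) :
    (Ep3 ħ ε R).mulVec ((Em3 ħ ε R).mulVec v) = (Em3 ħ ε R).mulVec ((Ep3 ħ ε R).mulVec v)
      + qNum ħ ((N : ℚ) - a - b) • v := by
  have key : qNum ħ ((N : ℚ) - a - b)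
      = qPow ħ (-ε * ((a : ℚ) - 2 * b) / 2) * qNum ħ ((N : ℚ) - 2 * a + b)
        + qPow ħ (ε * ((N : ℚ) - 2 * a + b) / 2) * qNum ħ ((a : ℚ) - 2 * b) := by
    have : (N : ℚ) - a - b = ((N : ℚ) - 2 * a + b) + (a - 2 * b) := by ring
    rw [this]
    rcases hε with rfl | rfl
    · rw [qNum_add]; simp
    · rw [qNum_add']; simp
  have x1 : ε * ((N : ℚ) - 2 * a + ((b - 1 : ℤ) : ℚ) + 1) / 2
      = ε * ((N : ℚ) - 2 * a + b) / 2 := by push_cast; ring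
  have x2 : qPow ħ (-(ε : ℚ) / 2) * qPow ħ (-ε * (((a - 1 : ℤ) : ℚ) - 2 * b) / 2)
      = qPow ħ (-ε * ((a : ℚ) - 2 * b) / 2) := by
    rw [← qPow_add]; congr 1; push_cast; ring
  have x3 : qPow ħ (-(ε : ℚ) / 2) * qPow ħ (ε * ((N : ℚ) - 2 * a + b + 1) / 2)
      = qPow ħ (ε * ((N : ℚ) - 2 * a + b) / 2) := by
    rw [← qPow_add]; congr 1; ring
  rw [Ep3_mulVec ((Em3 ħ ε R).mulVec v), G.Ep_one_Em3 hq hε hv, G.Ep_zero_Em3 hq hε hv,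
    Matrix.mulVec_add, Matrix.mulVec_sub, Matrix.mulVec_smul, Matrix.mulVec_smul,
    G.Ep_zero_Em3 hq hε (G.Ep_one_mem hv), G.Ep_one_Em3 hq hε (G.Ep_zero_mem hv),
    G.Ep_Em_zero hv, G.Ep_Em_one hv, Ep3_mulVec, Matrix.mulVec_sub, Matrix.mulVec_smul, x1]
  simp only [smul_sub, smul_add, smul_smul, ← mul_assoc, x2, x3, key]
  module

end IsGraded

/-! ### Injectivity of powers of the lowering operator of `U_q(sl₂)` -/

/-- Moving the raising operator `X` of a quantum `sl₂`-pair past a power of the lowering operator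
`Y`. -/
lemma raising_lowering_pow {V : Type*} [AddCommGroup V] [Module ℂ V] {ħ : ℂ}
    (hq : Admissible ħ 1) (X Y : V →ₗ[ℂ] V) (W : ℤ → Set V)
    (hXY : ∀ w : ℤ, ∀ v ∈ W w, X (Y v) = Y (X v) + qNum ħ w • v)
    (hY : ∀ w, ∀ v ∈ W w, Y v ∈ W (w - 2)) (r : ℕ) (w : ℤ) (v : V) (hv : v ∈ W w) :
    X ((Y ^ (r + 1)) v)
      = (Y ^ (r + 1)) (X v) + (qNum ħ ((r : ℚ) + 1) * qNum ħ ((w : ℚ) - r)) • (Y ^ r) v := by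
  have hYr : ∀ (r : ℕ) (w : ℤ), ∀ v ∈ W w, (Y ^ r) v ∈ W (w - 2 * r) := by
    intro r
    induction r with
    | zero => intro w v hv; simpa using hv
    | succ r ih =>
      intro w v hv
      rw [pow_succ', Module.End.mul_apply]
      convert hY _ _ (ih w v hv) using 2
      push_cast; ring
  induction r with
  | zero => simpa [qNum_one hq] using hXY w v hv
  | succ r ih =>
    have e := qNum_mul_succ_sub hq ((w : ℚ) - (r + 1)) ((r : ℚ) + 1)
    have e1 : (w : ℚ) - (r + 1) + 1 = w - r := by ring
    have e2 : (w : ℚ) - (r + 1) - (r + 1) = ((w - 2 * ((r + 1 : ℕ) : ℤ) : ℤ) : ℚ) := by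
      push_cast; ring
    rw [e1, e2] at e
    rw [pow_succ' Y (r + 1), Module.End.mul_apply, hXY _ _ (hYr (r + 1) w v hv), ih, map_add,
      map_smul, ← Module.End.mul_apply Y (Y ^ r), ← pow_succ', Module.End.mul_apply, ← e]
    push_cast
    module

/-- For a quantum `sl₂`-pair `X, Y` on a graded space with weights bounded by `N`, the power `Y ^ r`
is injective on weights `w ≥ r`. The proof applies `X` to `Y ^ (r + 1) v = 0` and uses induction
from the highest weights downwards. -/
lemma eq_zero_of_lowering_pow_eq_zero {V : Type*} [AddCommGroup V] [Module ℂ V] {ħ : ℂ} {N : ℕ}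
    (hN : Admissible ħ N) (X Y : V →ₗ[ℂ] V) (W : ℤ → Set V)
    (hX : ∀ w, ∀ v ∈ W w, X v ∈ W (w + 2))
    (hXY : ∀ w : ℤ, ∀ v ∈ W w, X (Y v) = Y (X v) + qNum ħ w • v)
    (hY : ∀ w, ∀ v ∈ W w, Y v ∈ W (w - 2))
    (htop : ∀ w : ℤ, (N : ℤ) < w → ∀ v ∈ W w, v = 0)
    (r : ℕ) (w : ℤ) (hr : (r : ℤ) ≤ w) (v : V) (hv : v ∈ W w) (h : (Y ^ r) v = 0) : v = 0 := by
  rcases Nat.eq_zero_or_pos N with rfl | hNpos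
  · rcases Nat.eq_zero_or_pos r with rfl | hr'
    · simpa using h
    · exact htop w (by push_cast; omega) v hv
  have hq : Admissible ħ 1 := hN.mono hNpos
  have comm := raising_lowering_pow hq X Y W hXY hY
  -- on a singular vector, `X Y ^ (r + 1)` is a nonzero multiple of `Y ^ r`
  have sing : ∀ (r : ℕ) (w : ℤ), (r : ℤ) ≤ w → w ≤ N → ∀ v ∈ W w, X v = 0 → (Y ^ r) v = 0 →
      v = 0 := by
    intro r
    induction r with
    | zero => intro w _ _ v _ _ h; simpa using h
    | succ r ih =>
      intro w hr hw v hv hXv h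
      refine ih w (by push_cast at hr; omega) hw v hv hXv ?_
      have := comm r w v hv
      rw [h, hXv, map_zero, map_zero, zero_add] at this
      refine (smul_eq_zero.1 this.symm).resolve_left (mul_ne_zero ?_ ?_)
      · have := qNum_ne_zero hN (m := r + 1) (by omega) (by push_cast at hr; omega)
        simpa using this
      · obtain ⟨m, hm⟩ := Int.eq_ofNat_of_zero_le (show 0 ≤ w - r by push_cast at hr; omega)
        have h1 : (w : ℚ) - r = m := by exact_mod_cast hm
        rw [h1]
        exact qNum_ne_zero hN (by push_cast at hr; omega) (by push_cast at hr; omega)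
  -- in general, `X v` has higher weight and is annihilated by `Y ^ (r + 1)`, so `v` is singular
  have main : ∀ (k : ℕ) (r : ℕ) (w : ℤ), (N : ℤ) < w + 2 * k → (r : ℤ) ≤ w → ∀ v ∈ W w,
      (Y ^ r) v = 0 → v = 0 := by
    intro k
    induction k with
    | zero => intro r w hk _ v hv _; exact htop w (by simpa using hk) v hv
    | succ k ih =>
      intro r w hk hr v hv h
      by_cases hw : w ≤ N
      · have hXv : X v = 0 := by
          refine ih (r + 1) (w + 2) (by push_cast at hk ⊢; omega) (by push_cast; omega) _
            (hX w v hv) ?_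
          have h1 := comm r w v hv
          rwa [h, smul_zero, add_zero, pow_succ', Module.End.mul_apply, h, map_zero, map_zero,
            ← pow_succ', eq_comm] at h1
        exact sing r w hr hw v hv hXv h
      · exact htop w (by omega) v hv
  exact main (N + w.natAbs + 1) r w (by omega) hr v hv h

end

section

/-! ### Gradings of the symmetric representations and of their tensor product -/

lemma isGraded_symRep {ħ : ℂ} (hq : Admissible ħ 1) (n : ℕ) :
    IsGraded ħ (symRep ħ n) n SymIdx.A SymIdx.B where
  rep := isRep_symRep hq n
  H_eq i := by
    rw [symRep_H_eq_diagonal]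
    congr 1; funext p
    fin_cases i
    · simp [SymIdx.m_zero]
    · simp [SymIdx.m_one]
  transpose := symRep_transpose

/-- The number of `α₁` subtracted from `(n₁ + n₂) μ₁` in the weight of a product of basis states. -/
def totA {n₁ n₂ : ℕ} (p : SymIdx n₁ × SymIdx n₂) : ℕ := p.1.A + p.2.A

/-- The number of `α₂` subtracted from `(n₁ + n₂) μ₁` in the weight of a product of basis states. -/
def totB {n₁ n₂ : ℕ} (p : SymIdx n₁ × SymIdx n₂) : ℕ := p.1.B + p.2.B

theorem isRep_tensorRep {ħ : ℂ} (hq : Admissible ħ 1) (n₁ n₂ : ℕ) :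
    IsRep ħ (tensorRep ħ n₁ n₂) :=
  isRep_tensor hq (isRep_symRep hq n₁) (isRep_symRep hq n₂) _ _
    symRep_H_eq_diagonal symRep_H_eq_diagonal

lemma isGraded_tensorRep {ħ : ℂ} (hq : Admissible ħ 1) (n₁ n₂ : ℕ) :
    IsGraded ħ (tensorRep ħ n₁ n₂) (n₁ + n₂) totA totB where
  rep := isRep_tensorRep hq n₁ n₂
  H_eq i := by
    rw [tensorRep, tensor_H_eq symRep_H_eq_diagonal symRep_H_eq_diagonal]
    congr 1; funext p
    congr 1
    fin_cases i
    · simp [SymIdx.m_zero, totA, totB]; ring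
    · simp [SymIdx.m_one, totA, totB]; ring
  transpose i := by
    simp only [tensorRep, tensor, Matrix.transpose_add, ← Matrix.kroneckerMap_transpose,
      symRep_transpose, symRep_H_eq_diagonal, qPowMat_diagonal, Matrix.diagonal_transpose]

/-- The product of two basis states. -/
def tket (n₁ n₂ : ℕ) (A₁ B₁ A₂ B₂ : ℤ) : SymIdx n₁ × SymIdx n₂ → ℂ :=
  fun p => ket n₁ A₁ B₁ p.1 * ket n₂ A₂ B₂ p.2

lemma tket_eq_single {n₁ n₂ : ℕ} (p : SymIdx n₁ × SymIdx n₂) :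
    tket n₁ n₂ p.1.A p.1.B p.2.A p.2.B = Pi.single p 1 := by
  funext r
  simp only [tket, ket_eq_single, Pi.single_apply, Prod.ext_iff]
  split_ifs <;> simp_all

lemma tket_eq_zero {n₁ n₂ : ℕ} {A₁ B₁ A₂ B₂ : ℤ}
    (h : ¬ ((0 ≤ B₁ ∧ B₁ ≤ A₁ ∧ A₁ ≤ n₁) ∧ (0 ≤ B₂ ∧ B₂ ≤ A₂ ∧ A₂ ≤ n₂))) :
    tket n₁ n₂ A₁ B₁ A₂ B₂ = 0 := by
  funext p
  rw [not_and_or] at h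
  rcases h with h | h <;> simp [tket, ket_eq_zero h]

lemma pairing_tket {n₁ n₂ : ℕ} (p : SymIdx n₁ × SymIdx n₂) (v : SymIdx n₁ × SymIdx n₂ → ℂ) :
    pairing (tket n₁ n₂ p.1.A p.1.B p.2.A p.2.B) v = v p := by
  rw [tket_eq_single, pairing_eq_dotProduct, single_one_dotProduct]

lemma kronecker_mulVec {ι κ : Type} [Fintype ι] [Fintype κ] (M : Matrix ι ι ℂ) (M' : Matrix κ κ ℂ)
    (v : ι → ℂ) (w : κ → ℂ) :
    (M ⊗ₖ M').mulVec (fun p : ι × κ => v p.1 * w p.2)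
      = fun p => M.mulVec v p.1 * M'.mulVec w p.2 := by
  funext p
  simp only [Matrix.mulVec, dotProduct, Matrix.kroneckerMap_apply, Fintype.sum_prod_type,
    Finset.sum_mul_sum]
  exact Finset.sum_congr rfl fun i _ => Finset.sum_congr rfl fun j _ => by ring

lemma kronecker_mulVec_tket {n₁ n₂ : ℕ} (M : Matrix (SymIdx n₁) (SymIdx n₁) ℂ)
    (M' : Matrix (SymIdx n₂) (SymIdx n₂) ℂ) (A₁ B₁ A₂ B₂ : ℤ) :
    (M ⊗ₖ M').mulVec (tket n₁ n₂ A₁ B₁ A₂ B₂)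
      = fun p => M.mulVec (ket n₁ A₁ B₁) p.1 * M'.mulVec (ket n₂ A₂ B₂) p.2 :=
  kronecker_mulVec M M' _ _

lemma qPowMat_symRep_ket {ħ : ℂ} {n : ℕ} (c : ℚ) (i : Fin 2) (A B : ℤ) :
    (qPowMat ħ c ((symRep ħ n).H i)).mulVec (ket n A B)
      = qPow ħ (c * ![(n : ℚ) / 2 - A + B / 2, (A : ℚ) / 2 - B] i) • ket n A B := by
  rw [symRep_H_eq_diagonal, qPowMat_diagonal]
  funext p
  simp only [Matrix.mulVec_diagonal, Pi.smul_apply, smul_eq_mul, ket]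
  split_ifs with h
  · obtain ⟨rfl, rfl⟩ := h
    fin_cases i
    · simp [SymIdx.m_zero]
    · simp [SymIdx.m_one]
  · simp

variable {ħ : ℂ} {n₁ n₂ : ℕ}

lemma tensorRep_Em_zero_tket (A₁ B₁ A₂ B₂ : ℤ) :
    ((tensorRep ħ n₁ n₂).Em 0).mulVec (tket n₁ n₂ A₁ B₁ A₂ B₂)
      = (qSqrt ħ ((n₁ : ℚ) - A₁) * qSqrt ħ ((A₁ : ℚ) - B₁ + 1)
          * qPow ħ (1 / 2 * ((n₂ : ℚ) / 2 - A₂ + B₂ / 2))) • tket n₁ n₂ (A₁ + 1) B₁ A₂ B₂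
        + (qPow ħ (-1 / 2 * ((n₁ : ℚ) / 2 - A₁ + B₁ / 2))
          * (qSqrt ħ ((n₂ : ℚ) - A₂) * qSqrt ħ ((A₂ : ℚ) - B₂ + 1)))
            • tket n₁ n₂ A₁ B₁ (A₂ + 1) B₂ := by
  funext p
  simp only [tensorRep, tensor, Matrix.add_mulVec, kronecker_mulVec_tket, symRep_Em_zero_ket,
    qPowMat_symRep_ket, Pi.add_apply, Pi.smul_apply, smul_eq_mul, Matrix.cons_val_zero, tket]
  ring

lemma tensorRep_Em_one_tket (A₁ B₁ A₂ B₂ : ℤ) :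
    ((tensorRep ħ n₁ n₂).Em 1).mulVec (tket n₁ n₂ A₁ B₁ A₂ B₂)
      = (qSqrt ħ ((A₁ : ℚ) - B₁) * qSqrt ħ ((B₁ : ℚ) + 1)
          * qPow ħ (1 / 2 * ((A₂ : ℚ) / 2 - B₂))) • tket n₁ n₂ A₁ (B₁ + 1) A₂ B₂
        + (qPow ħ (-1 / 2 * ((A₁ : ℚ) / 2 - B₁))
          * (qSqrt ħ ((A₂ : ℚ) - B₂) * qSqrt ħ ((B₂ : ℚ) + 1)))
            • tket n₁ n₂ A₁ B₁ A₂ (B₂ + 1) := by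
  funext p
  simp only [tensorRep, tensor, Matrix.add_mulVec, kronecker_mulVec_tket, symRep_Em_one_ket,
    qPowMat_symRep_ket, Pi.add_apply, Pi.smul_apply, smul_eq_mul, Matrix.cons_val_one,
    Matrix.cons_val_zero, tket]
  ring

/-! ### Singular vectors of the tensor product -/

/-- A variant of `qSqrt_ne_zero` for arguments that are only propositionally casts. -/
lemma qSqrt_ne_zero' {M : ℕ} (h : Admissible ħ M) {x : ℚ} (m : ℕ) (hx : x = m) (h1 : 1 ≤ m)
    (h2 : m ≤ M) : qSqrt ħ x ≠ 0 := by
  rw [hx]; exact qSqrt_ne_zero h h1 h2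

/-- The relation between neighbouring coefficients of a vector annihilated by `Ep 0`: its pairing
with a vector in the image of `Em 0` vanishes. -/
lemma singular_zero_eq (hq : Admissible ħ 1) {v : SymIdx n₁ × SymIdx n₂ → ℂ}
    (hv : ((tensorRep ħ n₁ n₂).Ep 0).mulVec v = 0) (A₁ B₁ A₂ B₂ : ℤ) :
    (qSqrt ħ ((n₁ : ℚ) - A₁) * qSqrt ħ ((A₁ : ℚ) - B₁ + 1)
          * qPow ħ (1 / 2 * ((n₂ : ℚ) / 2 - A₂ + B₂ / 2)))
        * pairing (tket n₁ n₂ (A₁ + 1) B₁ A₂ B₂) v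
      + (qPow ħ (-1 / 2 * ((n₁ : ℚ) / 2 - A₁ + B₁ / 2))
          * (qSqrt ħ ((n₂ : ℚ) - A₂) * qSqrt ħ ((A₂ : ℚ) - B₂ + 1)))
        * pairing (tket n₁ n₂ A₁ B₁ (A₂ + 1) B₂) v = 0 := by
  have := (isGraded_tensorRep hq n₁ n₂).pairing_Em 0 (tket n₁ n₂ A₁ B₁ A₂ B₂) v
  rwa [hv, pairing_zero_right, tensorRep_Em_zero_tket, pairing_add_left, pairing_smul_left,
    pairing_smul_left] at this

/-- The relation between neighbouring coefficients of a vector annihilated by `Ep 1`. -/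
lemma singular_one_eq (hq : Admissible ħ 1) {v : SymIdx n₁ × SymIdx n₂ → ℂ}
    (hv : ((tensorRep ħ n₁ n₂).Ep 1).mulVec v = 0) (A₁ B₁ A₂ B₂ : ℤ) :
    (qSqrt ħ ((A₁ : ℚ) - B₁) * qSqrt ħ ((B₁ : ℚ) + 1)
          * qPow ħ (1 / 2 * ((A₂ : ℚ) / 2 - B₂)))
        * pairing (tket n₁ n₂ A₁ (B₁ + 1) A₂ B₂) v
      + (qPow ħ (-1 / 2 * ((A₁ : ℚ) / 2 - B₁))
          * (qSqrt ħ ((A₂ : ℚ) - B₂) * qSqrt ħ ((B₂ : ℚ) + 1)))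
        * pairing (tket n₁ n₂ A₁ B₁ A₂ (B₂ + 1)) v = 0 := by
  have := (isGraded_tensorRep hq n₁ n₂).pairing_Em 1 (tket n₁ n₂ A₁ B₁ A₂ B₂) v
  rwa [hv, pairing_zero_right, tensorRep_Em_one_tket, pairing_add_left, pairing_smul_left,
    pairing_smul_left] at this

/-- A singular vector is determined by its coefficients on the states whose first factor is the
highest weight state. -/
lemma singular_eq_zero (hM : Admissible ħ (n₁ + n₂ + 1)) {v : SymIdx n₁ × SymIdx n₂ → ℂ}
    (hv : ∀ i, ((tensorRep ħ n₁ n₂).Ep i).mulVec v = 0)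
    (h0 : ∀ A₂ B₂ : ℤ, pairing (tket n₁ n₂ 0 0 A₂ B₂) v = 0) : v = 0 := by
  have hq : Admissible ħ 1 := hM.mono (by omega)
  -- lower the first factor by `α₁`, then by `α₂`
  have h1 : ∀ A₁ : ℕ, A₁ ≤ n₁ → ∀ A₂ B₂ : ℤ, pairing (tket n₁ n₂ A₁ 0 A₂ B₂) v = 0 := by
    intro A₁
    induction A₁ with
    | zero => intro _; simpa using h0
    | succ A₁ ih =>
      intro hA A₂ B₂
      have := singular_zero_eq hq (hv 0) A₁ 0 A₂ B₂
      rw [ih (by omega), mul_zero, add_zero] at this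
      push_cast
      refine (mul_eq_zero.1 this).resolve_left (mul_ne_zero (mul_ne_zero ?_ ?_) (qPow_ne_zero _ _))
      · exact qSqrt_ne_zero' hM (n₁ - A₁)
          (by push_cast [Nat.cast_sub (show A₁ ≤ n₁ by omega)]; ring)
          (by omega) (by omega)
      · exact qSqrt_ne_zero' hM (A₁ + 1) (by push_cast; ring) (by omega) (by omega)
  have h2 : ∀ B₁ A₁ : ℕ, B₁ ≤ A₁ → A₁ ≤ n₁ → ∀ A₂ B₂ : ℤ,
      pairing (tket n₁ n₂ A₁ B₁ A₂ B₂) v = 0 := by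
    intro B₁
    induction B₁ with
    | zero => intro A₁ _ hA; simpa using h1 A₁ hA
    | succ B₁ ih =>
      intro A₁ hB hA A₂ B₂
      have := singular_one_eq hq (hv 1) A₁ B₁ A₂ B₂
      rw [ih A₁ (by omega) hA, mul_zero, add_zero] at this
      push_cast
      refine (mul_eq_zero.1 this).resolve_left (mul_ne_zero (mul_ne_zero ?_ ?_) (qPow_ne_zero _ _))
      · exact qSqrt_ne_zero' hM (A₁ - B₁)
          (by push_cast [Nat.cast_sub (show B₁ ≤ A₁ by omega)]; ring) (by omega) (by omega)
      · exact qSqrt_ne_zero' hM (B₁ + 1) (by push_cast; ring) (by omega) (by omega)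
  funext p
  rw [← pairing_tket p v, h2 _ _ p.1.B_le_A p.1.A_le]; rfl

/-- `Em 1` annihilates the highest weight state of the first factor, so the relation from `Ep 1` has
a single term. -/
lemma singular_coeff_B (hM : Admissible ħ (n₁ + n₂ + 1)) {v : SymIdx n₁ × SymIdx n₂ → ℂ}
    (hv : ∀ i, ((tensorRep ħ n₁ n₂).Ep i).mulVec v = 0) (A₂ B₂ : ℤ) (hB : B₂ ≠ 0) :
    pairing (tket n₁ n₂ 0 0 A₂ B₂) v = 0 := by
  have hq : Admissible ħ 1 := hM.mono (by omega)
  by_cases h : (0 ≤ B₂ ∧ B₂ ≤ A₂ ∧ A₂ ≤ n₂)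
  · have := singular_one_eq hq (hv 1) 0 0 A₂ (B₂ - 1)
    simp only [Int.cast_zero, sub_zero, qSqrt_zero, zero_mul, zero_add, sub_add_cancel] at this
    refine (mul_eq_zero.1 this).resolve_left (mul_ne_zero (qPow_ne_zero _ _) (mul_ne_zero ?_ ?_))
    · refine qSqrt_ne_zero' hM (A₂ - (B₂ - 1)).toNat ?_ (by omega) (by omega)
      have : (((A₂ - (B₂ - 1)).toNat : ℤ) : ℚ) = ((A₂ - (B₂ - 1) : ℤ) : ℚ) := by
        congr 1; omega
      rw [Int.cast_natCast] at this
      rw [this]; push_cast; ring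
    · refine qSqrt_ne_zero' hM B₂.toNat ?_ (by omega) (by omega)
      have : ((B₂.toNat : ℤ) : ℚ) = (B₂ : ℚ) := by congr 1; omega
      rw [Int.cast_natCast] at this
      rw [this]; push_cast; ring
  · rw [tket_eq_zero (by tauto), pairing_zero_left]

/-- The relations from `Ep 0` link the coefficient to others with a larger coordinate of the first
factor, up to `n₁`, where `Em 0` annihilates the first factor and a single term remains. -/
lemma singular_coeff_A (hM : Admissible ħ (n₁ + n₂ + 1)) {v : SymIdx n₁ × SymIdx n₂ → ℂ}
    (hv : ∀ i, ((tensorRep ħ n₁ n₂).Ep i).mulVec v = 0) (k : ℕ) (hk : n₁ < k) :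
    pairing (tket n₁ n₂ 0 0 k 0) v = 0 := by
  have hq : Admissible ħ 1 := hM.mono (by omega)
  have key : ∀ j : ℕ, j ≤ n₁ → ∀ k : ℕ, j < k → k ≤ n₂ →
      pairing (tket n₁ n₂ ((n₁ : ℤ) - j) 0 k 0) v = 0 := by
    intro j
    induction j with
    | zero =>
      intro _ k hk hk2
      have := singular_zero_eq hq (hv 0) n₁ 0 ((k : ℤ) - 1) 0
      simp only [Int.cast_natCast, sub_self, qSqrt_zero, zero_mul, zero_add, sub_add_cancel] at this
      simp only [Nat.cast_zero, sub_zero]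
      refine (mul_eq_zero.1 this).resolve_left (mul_ne_zero (qPow_ne_zero _ _) (mul_ne_zero ?_ ?_))
      · exact qSqrt_ne_zero' hM (n₂ - k + 1) (by push_cast [Nat.cast_sub hk2]; ring)
          (by omega) (by omega)
      · exact qSqrt_ne_zero' hM k (by push_cast; ring) (by omega) (by omega)
    | succ j ih =>
      intro hj k hk hk2
      have := singular_zero_eq hq (hv 0) ((n₁ : ℤ) - (j + 1 : ℕ)) 0 ((k : ℤ) - 1) 0
      have e : (n₁ : ℤ) - (j + 1 : ℕ) + 1 = n₁ - j := by push_cast; ring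
      have e2 : (k : ℤ) - 1 = (k - 1 : ℕ) := by omega
      rw [sub_add_cancel, e, e2, ih (by omega) (k - 1) (by omega) (by omega), mul_zero,
        zero_add] at this
      refine (mul_eq_zero.1 this).resolve_left (mul_ne_zero (qPow_ne_zero _ _) (mul_ne_zero ?_ ?_))
      · exact qSqrt_ne_zero' hM (n₂ - k + 1) (by
          push_cast [Nat.cast_sub hk2, Nat.cast_sub (show 1 ≤ k by omega)]; ring)
          (by omega) (by omega)
      · exact qSqrt_ne_zero' hM k (by push_cast [Nat.cast_sub (show 1 ≤ k by omega)]; ring)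
          (by omega) (by omega)
  by_cases h : k ≤ n₂
  · simpa using key n₁ le_rfl k hk h
  · rw [tket_eq_zero (by omega), pairing_zero_left]

/-! ### The q-Vandermonde identity and the coefficients of `topState` -/

/-- The q-Vandermonde identity, by double induction from the Pascal rule. It gives the norm of
`topState`. -/
lemma sum_qbin_mul_qbin {M : ℕ} (hM : Admissible ħ M) (a b s : ℕ) (h : a + b + s + 1 ≤ M) :
    ∑ k ∈ Finset.HasAntidiagonal.antidiagonal s,
      qPow ħ ((((b : ℚ) + 1) * k.2 - ((a : ℚ) + 1) * k.1) / 2) * qbin ħ a k.2 * qbin ħ b k.1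
      = qbin ħ (a + b + 1) s := by
  induction a generalizing s with
  | zero =>
    induction s with
    | zero =>
      simp [qbin_zero_right hM (show 0 ≤ M by omega), qbin_zero_right hM (show b ≤ M by omega),
        qbin_zero_right hM (show b + 1 ≤ M by omega)]
    | succ s ih =>
      rw [Finset.Nat.sum_antidiagonal_succ', zero_add, qbin_succ_succ hM (by omega)]
      congr 1
      · rw [qbin_zero_left hM (show 0 ≤ M by omega), mul_one]
        congr 2; push_cast; ring
      · rw [zero_add] at ih
        rw [← ih (by omega), Finset.mul_sum]
        refine Finset.sum_congr rfl fun k hk => ?_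
        have hk := Finset.HasAntidiagonal.mem_antidiagonal.1 hk
        rw [qbin_zero_left hM (show k.2 + 1 ≤ M by omega),
          qbin_zero_left hM (show k.2 ≤ M by omega),
          mul_one, mul_one, ← mul_assoc, ← qPow_add]
        congr 2; push_cast; ring
  | succ a iha =>
    induction s with
    | zero =>
      simp [qbin_zero_right hM (show a + 1 ≤ M by omega), qbin_zero_right hM (show b ≤ M by omega),
        qbin_zero_right hM (show a + 1 + b + 1 ≤ M by omega)]
    | succ s ih =>
      have e : a + 1 + b + 1 = (a + b + 1) + 1 := by ring
      rw [e, qbin_succ_succ hM (by omega), ← iha (s + 1) (by omega), ← e, ← ih (by omega),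
        Finset.Nat.sum_antidiagonal_succ', Finset.Nat.sum_antidiagonal_succ', mul_add, add_assoc,
        Finset.mul_sum, Finset.mul_sum, ← Finset.sum_add_distrib]
      congr 1
      · rw [qbin_zero_right hM (by omega), qbin_zero_right hM (by omega), mul_one, mul_one,
          ← mul_assoc, ← qPow_add]
        congr 2; push_cast; ring
      · refine Finset.sum_congr rfl fun k hk => ?_
        have hk := Finset.HasAntidiagonal.mem_antidiagonal.1 hk
        have hk' : (s : ℚ) = k.1 + k.2 := by exact_mod_cast hk.symm
        rw [qbin_succ_succ hM (by omega)]
        have e1 : qPow ħ ((((b : ℚ) + 1) * ((k.2 + 1 : ℕ) : ℚ) - (((a + 1 : ℕ) : ℚ) + 1) * k.1) / 2)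
            * qPow ħ (-((k.2 : ℚ) + 1) / 2) = qPow ħ (-((s : ℚ) + 1) / 2)
              * qPow ħ ((((b : ℚ) + 1) * ((k.2 + 1 : ℕ) : ℚ) - ((a : ℚ) + 1) * k.1) / 2) := by
          rw [← qPow_add, ← qPow_add, hk']; congr 1; push_cast; ring
        have e2 : qPow ħ ((((b : ℚ) + 1) * ((k.2 + 1 : ℕ) : ℚ) - (((a + 1 : ℕ) : ℚ) + 1) * k.1) / 2)
            * qPow ħ (((a : ℚ) + 1) / 2) = qPow ħ ((((a + b + 1 : ℕ) : ℚ) + 1) / 2)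
              * qPow ħ ((((b : ℚ) + 1) * k.2 - (((a + 1 : ℕ) : ℚ) + 1) * k.1) / 2) := by
          rw [← qPow_add, ← qPow_add]; congr 1; push_cast; ring
        linear_combination (qbin ħ a (k.2 + 1) * qbin ħ b k.1) * e1
          + (qbin ħ (a + 1) k.2 * qbin ħ b k.1) * e2

/-- The closed form of the coefficients of `topState`: at `m = j` the sum over `k` in the q-CG
coefficient has only one term. -/
lemma topCG_eq {a b k₁ k₂ : ℕ} (hM : Admissible ħ (a + b + 2 * (k₁ + k₂) + 1)) :
    topCG ħ (a + (k₁ + k₂)) (b + (k₁ + k₂)) (k₁ + k₂) k₁ k₂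
      = (-1) ^ k₁ * qPow ħ ((((b : ℚ) + 1) * k₂ - ((a : ℚ) + 1) * k₁) / 4)
        * (sfac ħ (a + b + 1) * sfac ħ (k₁ + k₂)
          / (sfac ħ (a + b + (k₁ + k₂) + 1) * sfac ħ a * sfac ħ b))
        * (sfac ħ (a + k₂) * sfac ħ (b + k₁) / (sfac ħ k₁ * sfac ħ k₂)) := by
  rw [topCG, cgSl2, if_pos (by push_cast; ring)]
  have f1 : ⌊(((a + (k₁ + k₂) : ℕ) : ℚ) / 2 - (((a + (k₁ + k₂) : ℕ) : ℚ) / 2 - k₁))⌋ = (k₁ : ℤ) := by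
    rw [sub_sub_cancel]; simp
  rw [f1, sub_self, Nat.floor_zero, zero_add, Finset.sum_range_one]
  have g : ∀ {x : ℚ} (m : ℕ), x = m → qFact ħ x = qfac ħ m := fun m h => qFact_eq m h
  have g' : ∀ {x : ℚ} (m : ℕ), x = m → qSqrtFact ħ x = sfac ħ m := fun m h => qSqrtFact_eq m h
  rw [g (b + k₁) (by push_cast; ring), g (a + k₂) (by push_cast; ring), g 0 (by simp),
    g 0 (by simp), g k₂ (by push_cast; ring), g k₁ (by push_cast; ring),
    g' (k₁ + k₂) (by push_cast; ring), g' k₁ (by push_cast; ring), g' k₂ (by push_cast; ring),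
    g' (a + b) (by push_cast; ring), g' 0 (by simp), g' (a + b + (k₁ + k₂) + 1) (by push_cast; ring),
    g' a (by push_cast; ring), g' b (by push_cast; ring), g' (a + k₂) (by push_cast; ring),
    g' (b + k₁) (by push_cast; ring)]
  have e : (2 * ((((a + (k₁ + k₂) : ℕ) : ℚ) + ((b + (k₁ + k₂) : ℕ) : ℚ)) / 2 - ((k₁ + k₂ : ℕ) : ℚ)) + 1)
      = ((a + b + 1 : ℕ) : ℚ) := by push_cast; ring
  rw [e, sfac_succ ħ (a + b)]
  have n1 := sfac_ne_zero hM (show k₁ ≤ _ by omega)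
  have n2 := sfac_ne_zero hM (show k₂ ≤ _ by omega)
  have n3 := sfac_ne_zero hM (show a + k₂ ≤ _ by omega)
  have n4 := sfac_ne_zero hM (show b + k₁ ≤ _ by omega)
  have n5 := sfac_ne_zero hM (show a ≤ _ by omega)
  have n6 := sfac_ne_zero hM (show b ≤ _ by omega)
  have n7 := sfac_ne_zero hM (show a + b + (k₁ + k₂) + 1 ≤ _ by omega)
  have e2 : qPow ħ ((((b + (k₁ + k₂) : ℕ) : ℚ) / 2 * (((b + (k₁ + k₂) : ℕ) : ℚ) / 2 + 1)
      - ((a + (k₁ + k₂) : ℕ) : ℚ) / 2 * (((a + (k₁ + k₂) : ℕ) : ℚ) / 2 + 1)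
      - ((((a + (k₁ + k₂) : ℕ) : ℚ) + ((b + (k₁ + k₂) : ℕ) : ℚ)) / 2 - ((k₁ + k₂ : ℕ) : ℚ))
        * ((((a + (k₁ + k₂) : ℕ) : ℚ) + ((b + (k₁ + k₂) : ℕ) : ℚ)) / 2 - ((k₁ + k₂ : ℕ) : ℚ) + 1)) / 4
      + ((((a + (k₁ + k₂) : ℕ) : ℚ) + ((b + (k₁ + k₂) : ℕ) : ℚ)) / 2 - ((k₁ + k₂ : ℕ) : ℚ) + 1) / 2
        * (((a + (k₁ + k₂) : ℕ) : ℚ) / 2 - k₁))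
      = qPow ħ ((((b : ℚ) + 1) * k₂ - ((a : ℚ) + 1) * k₁) / 4) := by
    congr 1; push_cast; ring
  rw [e2]
  simp only [← sfac_mul_self, zpow_natCast, sfac_zero, Nat.cast_zero, zero_div, zero_mul, qPow_zero,
    pow_zero]
  field_simp

end

section

/-! ### Singularity, norm and completeness of the vectors `topState` -/

lemma tket_apply {n₁ n₂ : ℕ} (A₁ B₁ A₂ B₂ : ℤ) (p : SymIdx n₁ × SymIdx n₂) :
    tket n₁ n₂ A₁ B₁ A₂ B₂ p
      = if ((p.1.A : ℤ) = A₁ ∧ (p.1.B : ℤ) = B₁) ∧ (p.2.A : ℤ) = A₂ ∧ (p.2.B : ℤ) = B₂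
        then 1 else 0 := by
  simp only [tket, ket]
  split_ifs <;> simp_all

lemma tket_mem_wt {n₁ n₂ : ℕ} (A₁ B₁ A₂ B₂ : ℤ) :
    tket n₁ n₂ A₁ B₁ A₂ B₂ ∈ wt totA totB (A₁ + A₂) (B₁ + B₂) := by
  intro p h
  rw [tket_apply] at h
  split_ifs at h with h1
  · simp only [totA, totB]; omega
  · exact absurd rfl h

variable {ħ : ℂ} {n₁ n₂ : ℕ}

lemma topState_mem_wt (ħ : ℂ) (n₁ n₂ s : ℕ) : topState ħ n₁ n₂ s ∈ wt totA totB s 0 := by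
  intro p h
  simp only [topState] at h
  split_ifs at h with h1
  · simp only [totA, totB]; omega
  · exact absurd rfl h

lemma topState_eq_sum (ħ : ℂ) (n₁ n₂ s : ℕ) :
    topState ħ n₁ n₂ s = ∑ k ∈ Finset.HasAntidiagonal.antidiagonal s,
      topCG ħ n₁ n₂ s k.1 k.2 • tket n₁ n₂ k.1 0 k.2 0 := by
  funext p
  simp only [Finset.sum_apply, Pi.smul_apply, smul_eq_mul, tket_apply, topState]
  split_ifs with h
  · rw [Finset.sum_eq_single_of_mem (p.1.A, p.2.A)
      (Finset.HasAntidiagonal.mem_antidiagonal.2 h.2.2)]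
    · simp [h.1, h.2.1]
    · intro k _ hk
      rw [if_neg, mul_zero]
      rintro ⟨⟨h1, -⟩, h2, -⟩
      exact hk (Prod.ext (by simpa using h1.symm) (by simpa using h2.symm))
  · symm
    refine Finset.sum_eq_zero fun k hk => ?_
    have hk := Finset.HasAntidiagonal.mem_antidiagonal.1 hk
    rw [if_neg (by omega), mul_zero]

lemma pairing_tket_topState {s k₁ k₂ : ℕ} (hk : k₁ + k₂ = s) (h₁ : k₁ ≤ n₁) (h₂ : k₂ ≤ n₂) :
    pairing (tket n₁ n₂ k₁ 0 k₂ 0) (topState ħ n₁ n₂ s) = topCG ħ n₁ n₂ s k₁ k₂ := by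
  have := pairing_tket (SymIdx.mk' h₁ (Nat.zero_le k₁), SymIdx.mk' h₂ (Nat.zero_le k₂))
    (topState ħ n₁ n₂ s)
  simp only [SymIdx.A_mk', SymIdx.B_mk', Nat.cast_zero] at this
  rw [this]
  simp [topState, hk]

lemma wt_eq_zero_of_neg {ι : Type} [Fintype ι] {A B : ι → ℕ} {a b : ℤ} (h : a < 0 ∨ b < 0)
    {v : ι → ℂ} (hv : v ∈ wt A B a b) : v = 0 := by
  funext p
  by_contra h0
  have := hv p h0
  omega

/-- `Ep 1` annihilates `topState` because there is no state of the resulting weight; for `Ep 0` the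
two terms of each coefficient cancel. -/
theorem Ep_topState (hM : Admissible ħ (n₁ + n₂ + 1)) {s : ℕ} (hs : s ≤ min n₁ n₂) (i : Fin 2) :
    ((tensorRep ħ n₁ n₂).Ep i).mulVec (topState ħ n₁ n₂ s) = 0 := by
  have hq : Admissible ħ 1 := hM.mono (by omega)
  have G := isGraded_tensorRep hq n₁ n₂
  have htop := topState_mem_wt ħ n₁ n₂ s
  fin_cases i
  · funext p
    change ((tensorRep ħ n₁ n₂).Ep 0).mulVec (topState ħ n₁ n₂ s) p = 0
    rw [← pairing_tket p (((tensorRep ħ n₁ n₂).Ep 0).mulVec (topState ħ n₁ n₂ s))]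
    rw [← G.pairing_Em]
    by_cases hp : p.1.B = 0 ∧ p.2.B = 0 ∧ p.1.A + p.2.A + 1 = s
    · obtain ⟨hB₁, hB₂, hs'⟩ := hp
      have hA₁ := p.1.A_le
      have hA₂ := p.2.A_le
      rw [hB₁, hB₂]
      generalize hk₁ : p.1.A = k₁ at *
      generalize hk₂ : p.2.A = k₂ at *
      obtain ⟨a, ha⟩ := Nat.exists_eq_add_of_le (show s ≤ n₁ by omega)
      obtain ⟨b, hb⟩ := Nat.exists_eq_add_of_le (show s ≤ n₂ by omega)
      have e1 := pairing_tket_topState (ħ := ħ) (n₁ := n₁) (n₂ := n₂) (s := s) (k₁ := k₁ + 1)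
        (k₂ := k₂) (by omega) (by omega) (by omega)
      have e2 := pairing_tket_topState (ħ := ħ) (n₁ := n₁) (n₂ := n₂) (s := s) (k₁ := k₁)
        (k₂ := k₂ + 1) (by omega) (by omega) (by omega)
      have c1 := topCG_eq (ħ := ħ) (a := a) (b := b) (k₁ := k₁ + 1) (k₂ := k₂)
        (hM.mono (by omega))
      have c2 := topCG_eq (ħ := ħ) (a := a) (b := b) (k₁ := k₁) (k₂ := k₂ + 1)
        (hM.mono (by omega))
      have s1 : a + (k₁ + 1 + k₂) = n₁ := by omega
      have s2 : b + (k₁ + 1 + k₂) = n₂ := by omega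
      have s3 : k₁ + 1 + k₂ = s := by omega
      have s4 : k₁ + (k₂ + 1) = s := by omega
      rw [s1, s2, s3] at c1
      rw [s4, show a + s = n₁ by omega, show b + s = n₂ by omega] at c2
      push_cast at e1 e2
      change pairing (((tensorRep ħ n₁ n₂).Em 0).mulVec _) _ = 0
      rw [Nat.cast_zero, tensorRep_Em_zero_tket, pairing_add_left, pairing_smul_left,
        pairing_smul_left, e1, e2, c1, c2]
      have r1 : (n₁ : ℚ) - ((k₁ : ℤ) : ℚ) = ((a + k₂ + 1 : ℕ) : ℚ) := by
        rw [← s1]; push_cast; ring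
      have r2 : (n₂ : ℚ) - ((k₂ : ℤ) : ℚ) = ((b + k₁ + 1 : ℕ) : ℚ) := by
        rw [← s2]; push_cast; ring
      have r3 : ∀ k : ℕ, ((k : ℤ) : ℚ) - ((0 : ℤ) : ℚ) + 1 = ((k + 1 : ℕ) : ℚ) := fun k => by
        push_cast; ring
      rw [r1, r2, r3, r3]
      -- the powers of `q` of the two terms agree
      have x : qPow ħ (1 / 2 * ((n₂ : ℚ) / 2 - ((k₂ : ℤ) : ℚ) + ((0 : ℤ) : ℚ) / 2))
          * qPow ħ ((((b : ℚ) + 1) * k₂ - ((a : ℚ) + 1) * ((k₁ + 1 : ℕ) : ℚ)) / 4)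
          = qPow ħ (-1 / 2 * ((n₁ : ℚ) / 2 - ((k₁ : ℤ) : ℚ) + ((0 : ℤ) : ℚ) / 2))
          * qPow ħ ((((b : ℚ) + 1) * ((k₂ + 1 : ℕ) : ℚ) - ((a : ℚ) + 1) * k₁) / 4) := by
        rw [← qPow_add, ← qPow_add, ← s1, ← s2]; congr 1; push_cast; ring
      rw [show b + (k₁ + 1) = b + k₁ + 1 by ring, show a + (k₂ + 1) = a + k₂ + 1 by ring,
        sfac_succ ħ (b + k₁), sfac_succ ħ (a + k₂), sfac_succ ħ k₁, sfac_succ ħ k₂, pow_succ]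
      have n1 := sfac_ne_zero hM (show k₁ ≤ _ by omega)
      have n2 := sfac_ne_zero hM (show k₂ ≤ _ by omega)
      have n3 := qSqrt_ne_zero hM (show 1 ≤ k₁ + 1 by omega) (by omega)
      have n4 := qSqrt_ne_zero hM (show 1 ≤ k₂ + 1 by omega) (by omega)
      have n5 := sfac_ne_zero hM (show a ≤ _ by omega)
      have n6 := sfac_ne_zero hM (show b ≤ _ by omega)
      have n7 := sfac_ne_zero hM (show a + b + s + 1 ≤ _ by omega)
      generalize qPow ħ (1 / 2 * ((n₂ : ℚ) / 2 - ((k₂ : ℤ) : ℚ) + ((0 : ℤ) : ℚ) / 2)) = u₁ at x ⊢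
      generalize qPow ħ ((((b : ℚ) + 1) * k₂ - ((a : ℚ) + 1) * ((k₁ + 1 : ℕ) : ℚ)) / 4) = u₂ at x ⊢
      generalize qPow ħ (-1 / 2 * ((n₁ : ℚ) / 2 - ((k₁ : ℤ) : ℚ) + ((0 : ℤ) : ℚ) / 2)) = u₃ at x ⊢
      generalize qPow ħ ((((b : ℚ) + 1) * ((k₂ + 1 : ℕ) : ℚ) - ((a : ℚ) + 1) * k₁) / 4) = u₄ at x ⊢
      field_simp
      linear_combination (-(qSqrt ħ ((a + k₂ + 1 : ℕ) : ℚ) * sfac ħ (a + b + 1) * sfac ħ s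
        * sfac ħ (a + k₂) * sfac ħ (b + k₁) * qSqrt ħ ((b + k₁ + 1 : ℕ) : ℚ) * (-1) ^ k₁)) * x
    · refine pairing_eq_zero_of_wt (G.Em_zero_mem (tket_mem_wt _ _ _ _)) htop ?_
      omega
  · exact wt_eq_zero_of_neg (Or.inr (by norm_num)) (G.Ep_one_mem htop)

/-- The squares of the coefficients of `topState` are the terms of the q-Vandermonde identity,
divided by its right-hand side. -/
theorem pairing_topState_self (hM : Admissible ħ (n₁ + n₂ + 1)) {s : ℕ} (hs : s ≤ min n₁ n₂) :
    pairing (topState ħ n₁ n₂ s) (topState ħ n₁ n₂ s) = 1 := by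
  nth_rewrite 1 [topState_eq_sum]
  rw [pairing_sum_left]
  obtain ⟨a, ha⟩ := Nat.exists_eq_add_of_le (show s ≤ n₁ by omega)
  obtain ⟨b, hb⟩ := Nat.exists_eq_add_of_le (show s ≤ n₂ by omega)
  have n1 := sfac_ne_zero hM (show a + b + 1 ≤ _ by omega)
  have n2 := sfac_ne_zero hM (show s ≤ _ by omega)
  have n5 := sfac_ne_zero hM (show a ≤ _ by omega)
  have n6 := sfac_ne_zero hM (show b ≤ _ by omega)
  have n7 := sfac_ne_zero hM (show a + b + s + 1 ≤ _ by omega)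
  have key : ∀ k ∈ Finset.HasAntidiagonal.antidiagonal s,
      pairing (topCG ħ n₁ n₂ s k.1 k.2 • tket n₁ n₂ k.1 0 k.2 0) (topState ħ n₁ n₂ s)
      = (qbin ħ (a + b + 1) s)⁻¹ *
        (qPow ħ ((((b : ℚ) + 1) * k.2 - ((a : ℚ) + 1) * k.1) / 2) * qbin ħ a k.2 * qbin ħ b k.1) := by
    intro k hk
    have hk := Finset.HasAntidiagonal.mem_antidiagonal.1 hk
    rw [pairing_smul_left, pairing_tket_topState hk (by omega) (by omega)]
    have c := topCG_eq (ħ := ħ) (a := a) (b := b) (k₁ := k.1) (k₂ := k.2) (hM.mono (by omega))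
    rw [hk, show a + s = n₁ by omega, show b + s = n₂ by omega] at c
    rw [c]
    have x : qPow ħ ((((b : ℚ) + 1) * k.2 - ((a : ℚ) + 1) * k.1) / 2)
        = qPow ħ ((((b : ℚ) + 1) * k.2 - ((a : ℚ) + 1) * k.1) / 4) ^ 2 := by
      rw [qPow_pow]; congr 1; push_cast; ring
    have y : ((-1 : ℂ) ^ k.1) ^ 2 = 1 := by rw [← pow_mul, mul_comm, pow_mul]; simp
    simp only [qbin, ← sfac_mul_self, x]
    rw [show a + b + 1 + s = a + b + s + 1 by ring]
    have n3 := sfac_ne_zero hM (show k.1 ≤ _ by omega)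
    have n4 := sfac_ne_zero hM (show k.2 ≤ _ by omega)
    field_simp
    rw [y]; ring
  rw [Finset.sum_congr rfl key, ← Finset.mul_sum, sum_qbin_mul_qbin hM a b s (by omega)]
  refine inv_mul_cancel₀ ?_
  rw [qbin]
  exact div_ne_zero (qfac_ne_zero hM (by omega))
    (mul_ne_zero (qfac_ne_zero hM (by omega)) (qfac_ne_zero hM (by omega)))

/-- The coefficient of `topState` by which singular vectors are compared with it. -/
lemma topCG_zero_ne_zero (hM : Admissible ħ (n₁ + n₂ + 1)) {s : ℕ} (hs : s ≤ min n₁ n₂) :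
    topCG ħ n₁ n₂ s 0 s ≠ 0 := by
  obtain ⟨a, ha⟩ := Nat.exists_eq_add_of_le (show s ≤ n₁ by omega)
  obtain ⟨b, hb⟩ := Nat.exists_eq_add_of_le (show s ≤ n₂ by omega)
  have c := topCG_eq (ħ := ħ) (a := a) (b := b) (k₁ := 0) (k₂ := s) (hM.mono (by omega))
  rw [zero_add, show a + s = n₁ by omega, show b + s = n₂ by omega] at c
  rw [c]
  have n : ∀ m : ℕ, m ≤ n₁ + n₂ + 1 → sfac ħ m ≠ 0 := fun m hm => sfac_ne_zero hM hm
  have n1 := n (a + b + 1) (by omega)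
  have n2 := n s (by omega)
  have n3 := n (a + b + s + 1) (by omega)
  have n4 := n a (by omega)
  have n5 := n b (by omega)
  have n6 := n (a + s) (by omega)
  have n7 := n n₁ (by omega)
  have n8 := qPow_ne_zero ħ ((((b : ℚ) + 1) * s - ((a : ℚ) + 1) * ((0 : ℕ) : ℚ)) / 4)
  have n9 : (-1 : ℂ) ^ 0 ≠ 0 := by norm_num
  simp only [add_zero, sfac_zero, one_mul]
  exact mul_ne_zero (mul_ne_zero (mul_ne_zero n9 n8) (div_ne_zero (mul_ne_zero n1 n2)
    (mul_ne_zero (mul_ne_zero n3 n4) n5))) (div_ne_zero (mul_ne_zero n7 n5) n2)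

/-- The singular vectors of the tensor product are the combinations of the vectors `topState`:
subtracting a suitable combination removes all coefficients on the states whose first factor is the
highest weight state. -/
theorem singular_eq_sum (hM : Admissible ħ (n₁ + n₂ + 1)) {v : SymIdx n₁ × SymIdx n₂ → ℂ}
    (hv : ∀ i, ((tensorRep ħ n₁ n₂).Ep i).mulVec v = 0) :
    ∃ c : ℕ → ℂ, v = ∑ s ∈ Finset.range (min n₁ n₂ + 1), c s • topState ħ n₁ n₂ s := by
  refine ⟨fun s => pairing (tket n₁ n₂ 0 0 s 0) v / topCG ħ n₁ n₂ s 0 s, ?_⟩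
  rw [← sub_eq_zero]
  have hsing : ∀ i, ((tensorRep ħ n₁ n₂).Ep i).mulVec
      (v - ∑ s ∈ Finset.range (min n₁ n₂ + 1),
        (pairing (tket n₁ n₂ 0 0 s 0) v / topCG ħ n₁ n₂ s 0 s) • topState ħ n₁ n₂ s) = 0 := by
    intro i
    rw [Matrix.mulVec_sub, hv, Matrix.mulVec_sum, zero_sub, neg_eq_zero]
    refine Finset.sum_eq_zero fun s hs => ?_
    rw [Matrix.mulVec_smul, Ep_topState hM (by have := Finset.mem_range.1 hs; omega), smul_zero]
  refine singular_eq_zero hM hsing fun A₂ B₂ => ?_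
  by_cases hB : B₂ = 0
  swap
  · exact singular_coeff_B hM hsing A₂ B₂ hB
  subst hB
  by_cases hA : 0 ≤ A₂
  swap
  · rw [tket_eq_zero (by omega), pairing_zero_left]
  obtain ⟨k, rfl⟩ := Int.eq_ofNat_of_zero_le hA
  by_cases hk : n₁ < k
  · exact singular_coeff_A hM hsing k hk
  by_cases hk2 : n₂ < k
  · rw [tket_eq_zero (by omega), pairing_zero_left]
  rw [pairing_sub_right, pairing_sum_right,
    Finset.sum_eq_single_of_mem k (Finset.mem_range.2 (by omega))]
  · rw [pairing_smul_right]
    have := pairing_tket_topState (ħ := ħ) (n₁ := n₁) (n₂ := n₂) (s := k) (k₁ := 0) (k₂ := k)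
      (by omega) (by omega) (by omega)
    rw [Nat.cast_zero] at this
    rw [this, div_mul_cancel₀ _ (topCG_zero_ne_zero hM (by omega)), sub_self]
  · intro s _ hs
    rw [pairing_smul_right, pairing_eq_zero_of_wt (tket_mem_wt _ _ _ _) (topState_mem_wt _ _ _ _)
      (by omega), mul_zero]

end

section

/-! ### Singular vectors, generated subrepresentations and irreducibility -/

section General

variable {ι : Type} [Fintype ι] [DecidableEq ι] {ħ : ℂ} {R : Ops ι} {N : ℕ} {A B : ι → ℕ}

/-- Raising operators decrease the height `A + B` of the weights that occur in a vector. -/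
lemma IsGraded.height_Ep (G : IsGraded ħ R N A B) (i : Fin 2) {v : ι → ℂ} {h : ℕ}
    (hv : ∀ p, v p ≠ 0 → A p + B p < h + 1) {p : ι} (hp : (R.Ep i).mulVec v p ≠ 0) :
    A p + B p < h := by
  obtain ⟨r, -, hr⟩ := Finset.exists_ne_zero_of_sum_ne_zero hp
  have h1 : R.Ep i p r ≠ 0 := left_ne_zero_of_mul hr
  have h2 := hv r (right_ne_zero_of_mul hr)
  rw [G.Ep_apply] at h1
  have := G.Em_shift h1
  fin_cases i <;> simp at this <;> omega

/-- A nonzero subspace stable under the raising operators contains a nonzero singular vector: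
raising a vector until the next step gives zero must stop, as the height of its support drops. -/
lemma IsGraded.exists_singular (G : IsGraded ħ R N A B) {W : Submodule ℂ (ι → ℂ)} (hW : W ≠ ⊥)
    (hE : ∀ i, ∀ v ∈ W, (R.Ep i).mulVec v ∈ W) :
    ∃ v ∈ W, v ≠ 0 ∧ ∀ i, (R.Ep i).mulVec v = 0 := by
  obtain ⟨v, hv, hv0⟩ := W.ne_bot_iff.1 hW
  have main : ∀ (h : ℕ) (v : ι → ℂ), v ∈ W → v ≠ 0 → (∀ p, v p ≠ 0 → A p + B p < h) →
      ∃ v ∈ W, v ≠ 0 ∧ ∀ i, (R.Ep i).mulVec v = 0 := by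
    intro h
    induction h with
    | zero =>
      intro v _ hv0 hs
      obtain ⟨p, hp⟩ := Function.ne_iff.1 hv0
      exact absurd (hs p hp) (by omega)
    | succ h ih =>
      intro v hv hv0 hs
      by_cases h1 : ∀ i, (R.Ep i).mulVec v = 0
      · exact ⟨v, hv, hv0, h1⟩
      · push Not at h1
        obtain ⟨i, hi⟩ := h1
        exact ih _ (hE i v hv) hi fun p hp => G.height_Ep i hs hp
  refine main (∑ p, (A p + B p) + 1) v hv hv0 fun p _ => ?_
  have := Finset.single_le_sum (f := fun p => A p + B p) (fun _ _ => Nat.zero_le _)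
    (Finset.mem_univ p)
  omega

lemma mem_generated (R : Ops ι) (v : ι → ℂ) : v ∈ generated R v :=
  (Submodule.mem_sInf).2 fun _ hW => hW.2

lemma isInvariant_generated (R : Ops ι) (v : ι → ℂ) : IsInvariant R (generated R v) := by
  intro i u hu
  have hu := Submodule.mem_sInf.1 hu
  exact ⟨Submodule.mem_sInf.2 fun W hW => (hW.1 i u (hu W hW)).1,
    Submodule.mem_sInf.2 fun W hW => (hW.1 i u (hu W hW)).2.1,
    Submodule.mem_sInf.2 fun W hW => (hW.1 i u (hu W hW)).2.2⟩

lemma generated_le {R : Ops ι} {v : ι → ℂ} {W : Submodule ℂ (ι → ℂ)} (hW : IsInvariant R W)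
    (hv : v ∈ W) : generated R v ≤ W := sInf_le ⟨hW, hv⟩

/-- The representation generated by a homogeneous singular vector is the smallest subspace which
contains it and is stable under the lowering operators. -/
theorem IsGraded.generated_le_of_lowering (G : IsGraded ħ R N A B) {a b : ℤ} {v : ι → ℂ}
    (hv : v ∈ wt A B a b) (hsing : ∀ i, (R.Ep i).mulVec v = 0) {P : Submodule ℂ (ι → ℂ)}
    (hvP : v ∈ P) (hP : ∀ i, ∀ u ∈ P, (R.Em i).mulVec u ∈ P) : generated R v ≤ P := by
  set S : Submodule ℂ (ι → ℂ) := sInf {W | v ∈ W ∧ ∀ i, ∀ u ∈ W, (R.Em i).mulVec u ∈ W} with hS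
  have hvS : v ∈ S := Submodule.mem_sInf.2 fun W hW => hW.1
  have hES : ∀ i, ∀ u ∈ S, (R.Em i).mulVec u ∈ S := fun i u hu =>
    Submodule.mem_sInf.2 fun W hW => hW.2 i u (Submodule.mem_sInf.1 hu W hW)
  have hSP : S ≤ P := sInf_le ⟨hvP, hP⟩
  -- `S` is spanned by homogeneous vectors which the raising operators map into `S`
  set Q : Submodule ℂ (ι → ℂ) := Submodule.span ℂ
    {u | u ∈ S ∧ (∃ a b, u ∈ wt A B a b) ∧ ∀ i, (R.Ep i).mulVec u ∈ S} with hQ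
  have hSQ : S ≤ Q := by
    refine sInf_le ⟨Submodule.subset_span ⟨hvS, ⟨a, b, hv⟩, fun i => ?_⟩, fun j u hu => ?_⟩
    · rw [hsing]; exact S.zero_mem
    · induction hu using Submodule.span_induction with
      | mem u hu =>
        obtain ⟨hu, ⟨a, b, hab⟩, hE⟩ := hu
        refine Submodule.subset_span ⟨hES j u hu, ?_, fun i => ?_⟩
        · fin_cases j
          · exact ⟨_, _, G.Em_zero_mem hab⟩
          · exact ⟨_, _, G.Em_one_mem hab⟩
        · by_cases hij : i = j
          · subst hij
            fin_cases i
            · exact (G.Ep_Em_zero hab) ▸ S.add_mem (hES _ _ (hE 0)) (S.smul_mem _ hu)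
            · exact (G.Ep_Em_one hab) ▸ S.add_mem (hES _ _ (hE 1)) (S.smul_mem _ hu)
          · rw [G.Ep_Em_of_ne hij]
            exact hES _ _ (hE i)
      | zero => rw [Matrix.mulVec_zero]; exact Q.zero_mem
      | add x y _ _ hx hy => rw [Matrix.mulVec_add]; exact Q.add_mem hx hy
      | smul c x _ hx => rw [Matrix.mulVec_smul]; exact Q.smul_mem c hx
  refine le_trans (generated_le (fun i u hu => ⟨?_, ?_, hES i u hu⟩) hvS) hSP
  · have hu' := hSQ hu
    clear hu
    induction hu' using Submodule.span_induction with
    | mem u hu =>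
      obtain ⟨hu, ⟨a, b, hab⟩, hE⟩ := hu
      rw [G.H_mulVec hab]
      exact S.smul_mem _ hu
    | zero => rw [Matrix.mulVec_zero]; exact S.zero_mem
    | add x y _ _ hx hy => rw [Matrix.mulVec_add]; exact S.add_mem hx hy
    | smul c x _ hx => rw [Matrix.mulVec_smul]; exact S.smul_mem c hx
  · have hu' := hSQ hu
    clear hu
    induction hu' using Submodule.span_induction with
    | mem u hu => exact hu.2.2 i
    | zero => rw [Matrix.mulVec_zero]; exact S.zero_mem
    | add x y _ _ hx hy => rw [Matrix.mulVec_add]; exact S.add_mem hx hy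
    | smul c x _ hx => rw [Matrix.mulVec_smul]; exact S.smul_mem c hx

/-- The representation generated by a homogeneous singular vector contains the homogeneous
components of its elements. -/
lemma IsGraded.wtProj_mem_generated (G : IsGraded ħ R N A B) {a b : ℤ} {v : ι → ℂ}
    (hv : v ∈ wt A B a b) (hsing : ∀ i, (R.Ep i).mulVec v = 0) {u : ι → ℂ}
    (hu : u ∈ generated R v) (a' b' : ℤ) : wtProj A B a' b' u ∈ generated R v := by
  let P : Submodule ℂ (ι → ℂ) := ⨅ a' : ℤ, ⨅ b' : ℤ, (generated R v).comap (wtProj A B a' b')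
  have hmem : ∀ u, u ∈ P ↔ ∀ a' b', wtProj A B a' b' u ∈ generated R v := by
    intro u; simp [P, Submodule.mem_iInf]
  refine (hmem u).1 (G.generated_le_of_lowering (P := P) hv hsing ((hmem v).2 fun a' b' => ?_)
    (fun i u hu => (hmem _).2 fun a' b' => ?_) hu) a' b'
  · by_cases h : a = a' ∧ b = b'
    · rw [← h.1, ← h.2, wtProj_of_mem hv]; exact mem_generated R v
    · rw [wtProj_of_mem_of_ne hv h]; exact Submodule.zero_mem _
  · fin_cases i
    · exact (G.wtProj_Em_zero a' b' u) ▸ (isInvariant_generated R v 0 _ ((hmem u).1 hu _ _)).2.2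
    · exact (G.wtProj_Em_one a' b' u) ▸ (isInvariant_generated R v 1 _ ((hmem u).1 hu _ _)).2.2

end General

section SymRep

variable {ħ : ℂ} {n : ℕ}

lemma pairing_ket (p : SymIdx n) (v : SymIdx n → ℂ) : pairing (ket n p.A p.B) v = v p := by
  rw [ket_eq_single, pairing_eq_dotProduct]; simp

lemma symRep_singular (hM : Admissible ħ (n + 1)) {v : SymIdx n → ℂ}
    (hv : ∀ i, ((symRep ħ n).Ep i).mulVec v = 0) : ∃ c : ℂ, v = c • ket n 0 0 := by
  have hq : Admissible ħ 1 := hM.mono (by omega)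
  have G := isGraded_symRep hq n
  refine ⟨pairing (ket n 0 0) v, funext fun p => ?_⟩
  have hBA := p.B_le_A
  have hA := p.A_le
  by_cases h0 : p.A = 0 ∧ p.B = 0
  · have h1 : ket n 0 0 = ket n p.A p.B := by rw [h0.1, h0.2]; rfl
    rw [h1, pairing_ket, ket_eq_single]; simp
  have hr : (pairing (ket n 0 0) v • ket n 0 0) p = 0 := by
    simp only [Pi.smul_apply, smul_eq_mul, ket]
    rw [if_neg (by omega), mul_zero]
  rw [hr, ← pairing_ket p v]
  have hz : ∀ i w, pairing (((symRep ħ n).Em i).mulVec w) v = 0 := fun i w => by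
    rw [G.pairing_Em, hv, pairing_zero_right]
  by_cases hB : p.B = 0
  · have := hz 0 (ket n ((p.A - 1 : ℕ) : ℤ) 0)
    rw [symRep_Em_zero_ket, pairing_smul_left] at this
    have e : (((p.A - 1 : ℕ) : ℤ) + 1) = p.A := by omega
    rw [e] at this
    rw [hB]
    refine (mul_eq_zero.1 this).resolve_left (mul_ne_zero ?_ ?_)
    · exact qSqrt_ne_zero' hM (n - (p.A - 1))
        (by push_cast [Nat.cast_sub (show p.A - 1 ≤ n by omega)]; ring)
        (by omega) (by omega)
    · exact qSqrt_ne_zero' hM p.A (by push_cast [Nat.cast_sub (show 1 ≤ p.A by omega)]; ring)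
        (by omega) (by omega)
  · have := hz 1 (ket n p.A ((p.B - 1 : ℕ) : ℤ))
    rw [symRep_Em_one_ket, pairing_smul_left] at this
    have e : (((p.B - 1 : ℕ) : ℤ) + 1) = p.B := by omega
    rw [e] at this
    refine (mul_eq_zero.1 this).resolve_left (mul_ne_zero ?_ ?_)
    · exact qSqrt_ne_zero' hM (p.A - (p.B - 1))
        (by push_cast [Nat.cast_sub (show p.B - 1 ≤ p.A by omega)]; ring)
        (by omega) (by omega)
    · exact qSqrt_ne_zero' hM p.B (by push_cast [Nat.cast_sub (show 1 ≤ p.B by omega)]; ring)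
        (by omega) (by omega)

lemma symRep_eq_top (hM : Admissible ħ (n + 1)) {W : Submodule ℂ (SymIdx n → ℂ)}
    (hW : IsInvariant (symRep ħ n) W) (h0 : ket n 0 0 ∈ W) : W = ⊤ := by
  have hA : ∀ a : ℕ, a ≤ n → ket n a 0 ∈ W := by
    intro a
    induction a with
    | zero => intro _; exact h0
    | succ a ih =>
      intro ha
      have := (hW 0 _ (ih (by omega))).2.2
      rw [symRep_Em_zero_ket] at this
      push_cast
      refine (W.smul_mem_iff (mul_ne_zero ?_ ?_)).1 this
      · exact qSqrt_ne_zero' hM (n - a) (by push_cast [Nat.cast_sub (show a ≤ n by omega)]; ring)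
          (by omega) (by omega)
      · exact qSqrt_ne_zero' hM (a + 1) (by push_cast; ring) (by omega) (by omega)
  have hB : ∀ a b : ℕ, a ≤ n → b ≤ a → ket n a b ∈ W := by
    intro a b ha
    induction b with
    | zero => intro _; exact hA a ha
    | succ b ih =>
      intro hb
      have := (hW 1 _ (ih (by omega))).2.2
      rw [symRep_Em_one_ket] at this
      push_cast
      refine (W.smul_mem_iff (mul_ne_zero ?_ ?_)).1 this
      · exact qSqrt_ne_zero' hM (a - b) (by push_cast [Nat.cast_sub (show b ≤ a by omega)]; ring)
          (by omega) (by omega)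
      · exact qSqrt_ne_zero' hM (b + 1) (by push_cast; ring) (by omega) (by omega)
  refine eq_top_iff.2 fun v _ => ?_
  have : v = ∑ p : SymIdx n, v p • ket n p.A p.B := by
    conv_lhs => rw [← Finset.univ_sum_single v]
    refine Finset.sum_congr rfl fun p _ => ?_
    rw [ket_eq_single, ← Pi.single_smul]; simp
  rw [this]
  exact W.sum_mem fun p _ => W.smul_mem _ (hB _ _ p.A_le p.B_le_A)

/-- A nonzero subrepresentation contains a singular vector, hence the highest weight state, which
generates everything. -/
theorem isIrreducibleSub_symRep (hM : Admissible ħ (n + 1)) :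
    IsIrreducibleSub (symRep ħ n) ⊤ := by
  have G := isGraded_symRep (ħ := ħ) (hM.mono (by omega)) n
  refine ⟨fun _ _ _ => ⟨trivial, trivial, trivial⟩, ?_, fun W _ hW => ?_⟩
  · refine (Submodule.ne_bot_iff _).2 ⟨ket n 0 0, trivial, fun h => ?_⟩
    have := congrFun h (SymIdx.mk' (Nat.zero_le n) le_rfl)
    simp [ket] at this
  · by_cases h : W = ⊥
    · exact Or.inl h
    · right
      obtain ⟨v, hvW, hv0, hv⟩ := G.exists_singular h fun i v hv => (hW i v hv).2.1
      obtain ⟨c, rfl⟩ := symRep_singular hM hv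
      exact symRep_eq_top hM hW ((W.smul_mem_iff (fun hc => hv0 (by rw [hc, zero_smul]))).1 hvW)

theorem isHighestWeight_symRep (ħ : ℂ) (n : ℕ) :
    IsHighestWeight (symRep ħ n) n 0 (ket n 0 0) := by
  refine ⟨fun h => ?_, fun i => ?_, fun i => ?_⟩
  · have := congrFun h (SymIdx.mk' (Nat.zero_le n) le_rfl)
    simp [ket] at this
  · have := symRep_H_ket (ħ := ħ) (n := n) i 0 0
    rw [this]
    congr 1
    fin_cases i <;> simp [magM]
  · fin_cases i
    · have := symRep_Ep_zero_ket (ħ := ħ) (n := n) 0 0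
      simpa [qSqrt_zero] using this
    · have := symRep_Ep_one_ket (ħ := ħ) (n := n) 0 0
      simpa [qSqrt_zero] using this

end SymRep

end

section

/-! ### Decomposition of the tensor product -/

variable {ħ : ℂ} {n₁ n₂ : ℕ}

lemma topState_ne_zero (hM : Admissible ħ (n₁ + n₂ + 1)) {s : ℕ} (hs : s ≤ min n₁ n₂) :
    topState ħ n₁ n₂ s ≠ 0 := by
  intro h
  have := pairing_topState_self hM hs
  rw [h, pairing_zero_left] at this
  exact zero_ne_one this

lemma pairing_topState_of_ne (ħ : ℂ) (n₁ n₂ : ℕ) {s s' : ℕ} (h : s ≠ s') :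
    pairing (topState ħ n₁ n₂ s) (topState ħ n₁ n₂ s') = 0 :=
  pairing_eq_zero_of_wt (topState_mem_wt _ _ _ _) (topState_mem_wt _ _ _ _) (by omega)

lemma summand_le_of_lowering (hM : Admissible ħ (n₁ + n₂ + 1)) {s : ℕ} (hs : s ≤ min n₁ n₂)
    {P : Submodule ℂ (SymIdx n₁ × SymIdx n₂ → ℂ)} (h : topState ħ n₁ n₂ s ∈ P)
    (hP : ∀ i, ∀ u ∈ P, ((tensorRep ħ n₁ n₂).Em i).mulVec u ∈ P) : summand ħ n₁ n₂ s ≤ P :=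
  (isGraded_tensorRep (hM.mono (by omega)) n₁ n₂).generated_le_of_lowering
    (topState_mem_wt _ _ _ _) (Ep_topState hM hs) h hP

/-- By contravariance, a singular vector is orthogonal to all lowered states. -/
lemma pairing_summand_topState (hM : Admissible ħ (n₁ + n₂ + 1)) {s s' : ℕ} (hs : s ≤ min n₁ n₂)
    (hs' : s' ≤ min n₁ n₂) (h : s ≠ s') {x : SymIdx n₁ × SymIdx n₂ → ℂ}
    (hx : x ∈ summand ħ n₁ n₂ s) : pairing x (topState ħ n₁ n₂ s') = 0 := by
  let P : Submodule ℂ (SymIdx n₁ × SymIdx n₂ → ℂ) :=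
    { carrier := {x | pairing x (topState ħ n₁ n₂ s') = 0}
      zero_mem' := pairing_zero_left _
      add_mem' := fun {x y} (hx : pairing x _ = 0) (hy : pairing y _ = 0) => by
        change pairing (x + y) _ = 0
        rw [pairing_add_left, hx, hy, add_zero]
      smul_mem' := fun c x (hx : pairing x _ = 0) => by
        change pairing (c • x) _ = 0
        rw [pairing_smul_left, hx, mul_zero] }
  refine summand_le_of_lowering (P := P) hM hs (pairing_topState_of_ne ħ n₁ n₂ h)
    (fun i u _ => ?_) hx
  change pairing (((tensorRep ħ n₁ n₂).Em i).mulVec u) _ = 0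
  rw [(isGraded_tensorRep (hM.mono (by omega)) n₁ n₂).pairing_Em, Ep_topState hM hs',
    pairing_zero_right]

/-- The coefficients in the expansion of a singular vector are its pairings with the vectors
`topState`. -/
lemma singular_eq_sum_pairing (hM : Admissible ħ (n₁ + n₂ + 1)) {v : SymIdx n₁ × SymIdx n₂ → ℂ}
    (hv : ∀ i, ((tensorRep ħ n₁ n₂).Ep i).mulVec v = 0) :
    v = ∑ s ∈ Finset.range (min n₁ n₂ + 1),
      pairing v (topState ħ n₁ n₂ s) • topState ħ n₁ n₂ s := by
  obtain ⟨c, hc⟩ := singular_eq_sum hM hv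
  have : ∀ s ∈ Finset.range (min n₁ n₂ + 1), pairing v (topState ħ n₁ n₂ s) = c s := by
    intro s hs
    rw [hc, pairing_sum_left, Finset.sum_eq_single_of_mem s hs]
    · rw [pairing_smul_left, pairing_topState_self hM (by have := Finset.mem_range.1 hs; omega),
        mul_one]
    · intro s' _ h
      rw [pairing_smul_left, pairing_topState_of_ne _ _ _ h, mul_zero]
  conv_lhs => rw [hc]
  exact Finset.sum_congr rfl fun s hs => by rw [this s hs]

lemma singular_eq_smul_topState (hM : Admissible ħ (n₁ + n₂ + 1)) {s : ℕ} (hs : s ≤ min n₁ n₂)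
    {v : SymIdx n₁ × SymIdx n₂ → ℂ} (hv : ∀ i, ((tensorRep ħ n₁ n₂).Ep i).mulVec v = 0)
    (h : ∀ s' ≤ min n₁ n₂, s' ≠ s → pairing v (topState ħ n₁ n₂ s') = 0) :
    v = pairing v (topState ħ n₁ n₂ s) • topState ħ n₁ n₂ s := by
  conv_lhs => rw [singular_eq_sum_pairing hM hv]
  refine Finset.sum_eq_single_of_mem s (Finset.mem_range.2 (by omega)) fun s' hs' hne => ?_
  rw [h s' (by have := Finset.mem_range.1 hs'; omega) hne, zero_smul]

lemma singular_eq_zero_of_pairing (hM : Admissible ħ (n₁ + n₂ + 1))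
    {v : SymIdx n₁ × SymIdx n₂ → ℂ} (hv : ∀ i, ((tensorRep ħ n₁ n₂).Ep i).mulVec v = 0)
    (h : ∀ s ≤ min n₁ n₂, pairing v (topState ħ n₁ n₂ s) = 0) : v = 0 := by
  rw [singular_eq_sum_pairing hM hv]
  refine Finset.sum_eq_zero fun s hs => ?_
  rw [h s (by have := Finset.mem_range.1 hs; omega), zero_smul]

/-- A homogeneous singular vector whose weight is not that of any `topState` is zero. -/
lemma singular_eq_zero_of_wt (hM : Admissible ħ (n₁ + n₂ + 1)) {a b : ℤ}
    {v : SymIdx n₁ × SymIdx n₂ → ℂ} (hv : ∀ i, ((tensorRep ħ n₁ n₂).Ep i).mulVec v = 0)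
    (hw : v ∈ wt totA totB a b) (hab : ∀ s : ℕ, s ≤ min n₁ n₂ → ¬ (a = s ∧ b = 0)) : v = 0 :=
  singular_eq_zero_of_pairing hM hv fun s hs =>
    pairing_eq_zero_of_wt hw (topState_mem_wt _ _ _ _) (hab s hs)

/-- A singular vector in the summand is orthogonal to the other vectors `topState`, hence a multiple
of the generator. -/
theorem isIrreducibleSub_summand (hM : Admissible ħ (n₁ + n₂ + 1)) {s : ℕ} (hs : s ≤ min n₁ n₂) :
    IsIrreducibleSub (tensorRep ħ n₁ n₂) (summand ħ n₁ n₂ s) := by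
  refine ⟨isInvariant_generated _ _, (Submodule.ne_bot_iff _).2 ⟨_, mem_generated _ _,
    topState_ne_zero hM hs⟩, fun W hW hinv => ?_⟩
  by_cases h : W = ⊥
  · exact Or.inl h
  right
  obtain ⟨v, hvW, hv0, hv⟩ := (isGraded_tensorRep (hM.mono (by omega)) n₁ n₂).exists_singular h
    fun i v hv => (hinv i v hv).2.1
  have e := singular_eq_smul_topState hM hs hv fun s' hs' hne =>
    pairing_summand_topState hM hs hs' hne.symm (hW hvW)
  refine le_antisymm hW (generated_le hinv ?_)
  rw [e] at hvW
  refine (W.smul_mem_iff fun hc => hv0 ?_).1 hvW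
  rw [e, hc, zero_smul]

/-- Both the intersection of a summand with the sum of the others and the orthogonal complement of
the sum of all summands are stable under the raising operators. If nonzero, they contain a singular
vector, which is orthogonal to every `topState` and hence zero. -/
theorem isInternal_summand (hM : Admissible ħ (n₁ + n₂ + 1)) :
    DirectSum.IsInternal (fun s : Fin (min n₁ n₂ + 1) => summand ħ n₁ n₂ s) := by
  have G := isGraded_tensorRep (hM.mono (show 1 ≤ _ by omega)) n₁ n₂
  refine DirectSum.isInternal_submodule_of_iSupIndep_of_iSup_eq_top ?_ ?_
  · intro s
    rw [disjoint_iff]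
    by_contra hne
    have hsup : ∀ i, ∀ v ∈ ⨆ j, ⨆ (_ : j ≠ s), summand ħ n₁ n₂ (j : Fin (min n₁ n₂ + 1)),
        ((tensorRep ħ n₁ n₂).Ep i).mulVec v
          ∈ ⨆ j, ⨆ (_ : j ≠ s), summand ħ n₁ n₂ (j : Fin (min n₁ n₂ + 1)) := by
      intro i v hv
      have : (⨆ j, ⨆ (_ : j ≠ s), summand ħ n₁ n₂ (j : Fin (min n₁ n₂ + 1)))
          ≤ (⨆ j, ⨆ (_ : j ≠ s), summand ħ n₁ n₂ (j : Fin (min n₁ n₂ + 1))).comap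
            ((tensorRep ħ n₁ n₂).Ep i).mulVecLin := by
        refine iSup₂_le fun j hj x hx => ?_
        exact Submodule.mem_iSup_of_mem j (Submodule.mem_iSup_of_mem hj
          (isInvariant_generated _ _ i x hx).2.1)
      exact this hv
    obtain ⟨v, hvW, hv0, hv⟩ := G.exists_singular hne fun i v hv =>
      ⟨(isInvariant_generated _ _ i v hv.1).2.1, hsup i v hv.2⟩
    refine hv0 (singular_eq_zero_of_pairing hM hv fun s' hs' => ?_)
    by_cases h : (s : ℕ) = s'
    · have : ∀ x ∈ ⨆ j, ⨆ (_ : j ≠ s), summand ħ n₁ n₂ (j : Fin (min n₁ n₂ + 1)),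
          pairing x (topState ħ n₁ n₂ s') = 0 := by
        intro x hx
        refine Submodule.iSup_induction' _ (motive := fun x _ => pairing x _ = 0) ?_
          (pairing_zero_left _) (fun x y _ _ hx hy => by rw [pairing_add_left, hx, hy, add_zero]) hx
        intro j x hx
        by_cases hj : j = s
        · simp only [hj, ne_eq, not_true_eq_false, iSup_false, Submodule.mem_bot] at hx
          rw [hx, pairing_zero_left]
        · simp only [ne_eq, hj, not_false_eq_true, iSup_pos] at hx
          refine pairing_summand_topState hM (by omega) hs' ?_ hx
          rw [← h]; exact fun h' => hj (Fin.ext h')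
      exact this v hvW.2
    · exact pairing_summand_topState hM (by omega) hs' h hvW.1
  · by_contra hne
    set V := ⨆ s : Fin (min n₁ n₂ + 1), summand ħ n₁ n₂ s with hV
    obtain ⟨f, hf0, hf⟩ := Submodule.exists_le_ker_of_lt_top V (lt_top_iff_ne_top.2 hne)
    have hVE : ∀ i, ∀ x ∈ V, ((tensorRep ħ n₁ n₂).Em i).mulVec x ∈ V := by
      intro i x hx
      have : V ≤ V.comap ((tensorRep ħ n₁ n₂).Em i).mulVecLin := iSup_le fun s x hx =>
        Submodule.mem_iSup_of_mem s (isInvariant_generated _ _ i x hx).2.2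
      exact this hx
    -- the orthogonal complement of `V`; it is nonzero as `V` is annihilated by a functional `f`
    let W : Submodule ℂ (SymIdx n₁ × SymIdx n₂ → ℂ) :=
      { carrier := {w | ∀ x ∈ V, pairing x w = 0}
        zero_mem' := fun x _ => pairing_zero_right x
        add_mem' := fun {u w} hu hw x hx => by rw [pairing_add_right, hu x hx, hw x hx, add_zero]
        smul_mem' := fun c w hw x hx => by rw [pairing_smul_right, hw x hx, mul_zero] }
    have hW : W ≠ ⊥ := by
      have hfp : ∀ x, f x = pairing x (fun p => f (Pi.single p 1)) := fun x => by
        rw [pairing, LinearMap.pi_apply_eq_sum_univ f x]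
        refine Finset.sum_congr rfl fun p _ => ?_
        rw [smul_eq_mul]; congr 2
        funext r; simp [Pi.single_apply, eq_comm]
      refine (Submodule.ne_bot_iff _).2 ⟨fun p => f (Pi.single p 1), fun x hx => ?_, fun h0 => ?_⟩
      · rw [← hfp]; exact hf hx
      · refine hf0 (LinearMap.ext fun x => ?_)
        rw [hfp, h0, pairing_zero_right]; rfl
    obtain ⟨v, hvW, hv0, hv⟩ := G.exists_singular hW fun i w hw x hx => by
      rw [← G.pairing_Em]; exact hw _ (hVE i x hx)
    refine hv0 (singular_eq_zero_of_pairing hM hv fun s hs => ?_)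
    rw [pairing_comm]
    exact hvW _ (Submodule.mem_iSup_of_mem (⟨s, by omega⟩ : Fin (min n₁ n₂ + 1))
      (mem_generated _ _))

/-- The weight `Λ - A α₁ - B α₂` with `Λ = (n₁ + n₂) μ₁ - s α₁`. -/
lemma hasWeight_iff (hq : Admissible ħ 1) {s : ℕ} (hs : s ≤ min n₁ n₂) (A B : ℕ)
    (v : SymIdx n₁ × SymIdx n₂ → ℂ) :
    HasWeight (tensorRep ħ n₁ n₂) (n₁ + n₂ - 2 * s) s A B v
      ↔ v ∈ wt totA totB ((s + A : ℕ) : ℤ) B := by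
  have G := isGraded_tensorRep hq n₁ n₂
  have hcast : ((n₁ + n₂ - 2 * s : ℕ) : ℚ) = ((n₁ + n₂ : ℕ) : ℚ) - 2 * s := by
    rw [Nat.cast_sub (by omega)]; push_cast; ring
  constructor
  · intro h p hp
    have key : ∀ i, (![((n₁ + n₂ : ℕ) : ℚ) / 2 - totA p + totB p / 2, (totA p : ℚ) / 2 - totB p] i)
        = magM i (n₁ + n₂ - 2 * s) s A B := by
      intro i
      have := congrFun (h i) p
      rw [G.H_eq, Matrix.mulVec_diagonal] at this
      exact_mod_cast mul_right_cancel₀ hp this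
    have k0 := key 0
    have k1 := key 1
    simp [magM, rootDot, hcast] at k0 k1
    have hb : (totB p : ℚ) = B := by linarith
    have ha : (totA p : ℚ) = s + A := by linarith
    exact ⟨by exact_mod_cast ha, by exact_mod_cast hb⟩
  · intro h i
    rw [G.H_mulVec h]
    congr 2
    fin_cases i
    · simp [magM, rootDot, hcast]; ring
    · simp [magM, rootDot]; ring

lemma weightSpace_eq (hq : Admissible ħ 1) {s : ℕ} (hs : s ≤ min n₁ n₂) (A B : ℕ)
    (W : Submodule ℂ (SymIdx n₁ × SymIdx n₂ → ℂ)) :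
    weightSpace (tensorRep ħ n₁ n₂) W (n₁ + n₂ - 2 * s) s A B
      = W ⊓ wt totA totB ((s + A : ℕ) : ℤ) B := by
  ext v
  rw [weightSpace, Submodule.mem_inf, Submodule.mem_inf, ← hasWeight_iff hq hs]
  simp only [HasWeight, Submodule.mem_iInf, LinearMap.mem_ker, LinearMap.sub_apply,
    Matrix.mulVecLin_apply, LinearMap.smul_apply, LinearMap.id_apply, sub_eq_zero]

theorem isHighestWeight_and_pairing_iff (hM : Admissible ħ (n₁ + n₂ + 1)) {s : ℕ}
    (hs : s ≤ min n₁ n₂) (v : SymIdx n₁ × SymIdx n₂ → ℂ) :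
    (IsHighestWeight (tensorRep ħ n₁ n₂) (n₁ + n₂ - 2 * s) s v ∧ pairing v v = 1) ↔
      (v = topState ħ n₁ n₂ s ∨ v = -topState ħ n₁ n₂ s) := by
  have hq : Admissible ħ 1 := hM.mono (by omega)
  have hself := pairing_topState_self hM hs
  constructor
  · rintro ⟨⟨-, hw, hv⟩, h1⟩
    rw [hasWeight_iff hq hs] at hw
    have e := singular_eq_smul_topState hM hs hv fun s' _ hne =>
      pairing_eq_zero_of_wt hw (topState_mem_wt _ _ _ _) (by omega)
    rw [e, pairing_smul_left, pairing_smul_right, hself, mul_one] at h1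
    rcases mul_self_eq_one_iff.1 h1 with h | h
    · left; rw [e, h, one_smul]
    · right; rw [e, h, neg_one_smul]
  · have hw : HasWeight (tensorRep ħ n₁ n₂) (n₁ + n₂ - 2 * s) s 0 0 (topState ħ n₁ n₂ s) :=
      (hasWeight_iff hq hs 0 0 _).2 (by simpa using topState_mem_wt ħ n₁ n₂ s)
    rintro (rfl | rfl)
    · exact ⟨⟨topState_ne_zero hM hs, hw, Ep_topState hM hs⟩, hself⟩
    · refine ⟨⟨neg_ne_zero.2 (topState_ne_zero hM hs), fun i => ?_, fun i => ?_⟩, ?_⟩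
      · rw [Matrix.mulVec_neg, hw i, smul_neg]
      · rw [Matrix.mulVec_neg, Ep_topState hM hs, neg_zero]
      · rw [← neg_one_smul ℂ, pairing_smul_left, pairing_smul_right, hself]; norm_num

end

section

/-! ### Ladders: norms and coefficients of the lowered states -/

section Ladder

variable {ι : Type} [Fintype ι] [DecidableEq ι] {ħ : ℂ} {R : Ops ι} {N : ℕ} {A B : ι → ℕ}

lemma mulVecLin_pow_apply (M : Matrix ι ι ℂ) (l : ℕ) (v : ι → ℂ) :
    (M.mulVecLin ^ l) v = (M ^ l).mulVec v := by
  induction l with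
  | zero => simp
  | succ l ih => rw [pow_succ', Module.End.mul_apply, ih, Matrix.mulVecLin_apply,
      Matrix.mulVec_mulVec, ← pow_succ']

lemma pow_succ_mulVec (M : Matrix ι ι ℂ) (l : ℕ) (v : ι → ℂ) :
    (M ^ (l + 1)).mulVec v = M.mulVec ((M ^ l).mulVec v) := by
  rw [Matrix.mulVec_mulVec, ← pow_succ']

/-- The homogeneous vectors whose weight `(a, b)` satisfies `f a b = w`. -/
def homog (A B : ι → ℕ) (f : ℤ → ℤ → ℤ) (w : ℤ) : Set (ι → ℂ) :=
  {v | ∃ a b, v ∈ wt A B a b ∧ f a b = w}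

lemma IsGraded.Ep_Em_pow_zero (G : IsGraded ħ R N A B) (hq : Admissible ħ 1) (r : ℕ) {a b : ℤ}
    {v : ι → ℂ} (hv : v ∈ wt A B a b) :
    (R.Ep 0).mulVec ((R.Em 0 ^ (r + 1)).mulVec v)
      = (R.Em 0 ^ (r + 1)).mulVec ((R.Ep 0).mulVec v)
        + (qNum ħ ((r : ℚ) + 1) * qNum ħ ((N : ℚ) - 2 * a + b - r)) • (R.Em 0 ^ r).mulVec v := by
  have := raising_lowering_pow hq (R.Ep 0).mulVecLin (R.Em 0).mulVecLin
    (homog A B fun a b => N - 2 * a + b) ?_ ?_ r (N - 2 * a + b) v ⟨a, b, hv, rfl⟩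
  · simp only [mulVecLin_pow_apply, Matrix.mulVecLin_apply] at this
    rw [this]; push_cast; rfl
  · rintro w v ⟨a, b, hv, rfl⟩
    have := G.Ep_Em_zero hv
    push_cast
    exact this
  · rintro w v ⟨a, b, hv, rfl⟩
    exact ⟨_, _, G.Em_zero_mem hv, by beta_reduce; ring⟩

lemma IsGraded.Ep_Em_pow_one (G : IsGraded ħ R N A B) (hq : Admissible ħ 1) (r : ℕ) {a b : ℤ}
    {v : ι → ℂ} (hv : v ∈ wt A B a b) :
    (R.Ep 1).mulVec ((R.Em 1 ^ (r + 1)).mulVec v)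
      = (R.Em 1 ^ (r + 1)).mulVec ((R.Ep 1).mulVec v)
        + (qNum ħ ((r : ℚ) + 1) * qNum ħ ((a : ℚ) - 2 * b - r)) • (R.Em 1 ^ r).mulVec v := by
  have := raising_lowering_pow hq (R.Ep 1).mulVecLin (R.Em 1).mulVecLin
    (homog A B fun a b => a - 2 * b) ?_ ?_ r (a - 2 * b) v ⟨a, b, hv, rfl⟩
  · simp only [mulVecLin_pow_apply, Matrix.mulVecLin_apply] at this
    rw [this]; push_cast; rfl
  · rintro w v ⟨a, b, hv, rfl⟩
    have := G.Ep_Em_one hv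
    push_cast
    exact this
  · rintro w v ⟨a, b, hv, rfl⟩
    exact ⟨_, _, G.Em_one_mem hv, by beta_reduce; ring⟩

lemma IsGraded.Em_pow_zero_mem (G : IsGraded ħ R N A B) (r : ℕ) {a b : ℤ}
    {v : ι → ℂ} (hv : v ∈ wt A B a b) : (R.Em 0 ^ r).mulVec v ∈ wt A B (a + r) b := by
  induction r with
  | zero => simpa using hv
  | succ r ih =>
    rw [pow_succ_mulVec]; convert G.Em_zero_mem ih using 2; push_cast; ring

lemma IsGraded.Em_pow_one_mem (G : IsGraded ħ R N A B) (r : ℕ) {a b : ℤ}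
    {v : ι → ℂ} (hv : v ∈ wt A B a b) : (R.Em 1 ^ r).mulVec v ∈ wt A B a (b + r) := by
  induction r with
  | zero => simpa using hv
  | succ r ih =>
    rw [pow_succ_mulVec]; convert G.Em_one_mem ih using 2; push_cast; ring

lemma IsGraded.Ep_Em_pow_of_ne (G : IsGraded ħ R N A B) {i j : Fin 2} (hij : i ≠ j) (r : ℕ)
    (v : ι → ℂ) : (R.Ep i).mulVec ((R.Em j ^ r).mulVec v)
      = (R.Em j ^ r).mulVec ((R.Ep i).mulVec v) := by
  induction r with
  | zero => simp
  | succ r ih => rw [pow_succ_mulVec, G.Ep_Em_of_ne hij, ih, pow_succ_mulVec]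

/-- The norm of the `l`-th state of a ladder of length `p` over a state `v` which is annihilated
by the raising operator. -/
lemma IsGraded.pairing_Em_pow (G : IsGraded ħ R N A B) {i : Fin 2} {v : ι → ℂ} {p : ℕ}
    (hp : Admissible ħ p)
    (h : ∀ r : ℕ, (R.Ep i).mulVec ((R.Em i ^ (r + 1)).mulVec v)
      = (qNum ħ ((r : ℚ) + 1) * qNum ħ ((p : ℚ) - r)) • (R.Em i ^ r).mulVec v) {l : ℕ}
    (hl : l ≤ p) :
    pairing ((R.Em i ^ l).mulVec v) ((R.Em i ^ l).mulVec v)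
      = qfac ħ p * qfac ħ l / qfac ħ (p - l) * pairing v v := by
  induction l with
  | zero => simp [div_self (qfac_ne_zero hp le_rfl)]
  | succ l ih =>
    nth_rewrite 1 [pow_succ_mulVec]
    rw [G.pairing_Em, h, pairing_smul_right, ih (by omega)]
    obtain ⟨d, rfl⟩ := Nat.exists_eq_add_of_le hl
    have e1 : l + 1 + d - l = d + 1 := by omega
    have e2 : l + 1 + d - (l + 1) = d := by omega
    rw [e1, e2, qfac_succ ħ l, qfac_succ ħ d]
    have e3 : ((l + 1 + d : ℕ) : ℚ) - l = ((d + 1 : ℕ) : ℚ) := by push_cast; ring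
    rw [e3, ← Nat.cast_succ]
    have n1 := qfac_ne_zero hp (show d ≤ _ by omega)
    have n2 := qNum_ne_zero hp (show 1 ≤ d + 1 by omega) (by omega)
    field_simp

end Ladder

section Coefficients

variable {ħ : ℂ}

/-- The product of the matrix elements of `x` steps down a ladder of length `J`, starting at
position `a`. -/
def ladderProd (ħ : ℂ) (J a x : ℕ) : ℂ :=
  ∏ i ∈ Finset.range x, (qSqrt ħ ((J : ℚ) - a - i) * qSqrt ħ ((a : ℚ) + i + 1))

lemma ladderProd_eq {M J a x : ℕ} (hM : Admissible ħ M) (hJ : J ≤ M) (h : a + x ≤ J) :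
    ladderProd ħ J a x
      = sfac ħ (J - a) / sfac ħ a * (sfac ħ (a + x) / sfac ħ (J - a - x)) := by
  induction x with
  | zero =>
    have n1 := sfac_ne_zero hM (show J - a ≤ M by omega)
    have n2 := sfac_ne_zero hM (show a ≤ M by omega)
    simp [ladderProd]
    field_simp
  | succ x ih =>
    have := ih (by omega)
    rw [ladderProd] at this ⊢
    rw [Finset.prod_range_succ, this]
    obtain ⟨d, rfl⟩ := Nat.exists_eq_add_of_le h
    have e1 : a + (x + 1) + d - a - x = d + 1 := by omega
    have e2 : a + (x + 1) + d - a - (x + 1) = d := by omega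
    rw [e1, e2, ← add_assoc, sfac_succ ħ d, sfac_succ ħ (a + x)]
    have e3 : ((a + x + 1 + d : ℕ) : ℚ) - a - x = ((d + 1 : ℕ) : ℚ) := by push_cast; ring
    have e4 : (a : ℚ) + x + 1 = ((a + x + 1 : ℕ) : ℚ) := by push_cast; ring
    rw [e3, e4]
    have n1 := sfac_ne_zero hM (show d ≤ _ by omega)
    have n2 := qSqrt_ne_zero hM (show 1 ≤ d + 1 by omega) (by omega)
    field_simp

/-- The coefficients of powers of the coproduct of a lowering operator, on states at the positions
`a` and `b` of ladders of lengths `J₁` and `J₂`. -/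
def ladderF (ħ : ℂ) (x y J₁ a J₂ b : ℕ) : ℂ :=
  qPow ħ ((x * ((J₂ : ℚ) / 2 - b) - y * ((J₁ : ℚ) / 2 - a)) / 2) * qbin ħ x y
    * (ladderProd ħ J₁ a x * ladderProd ħ J₂ b y)

/-- The q-binomial theorem for the coproduct of a lowering operator, by Pascal's rule for the
Gaussian binomial coefficients. -/
lemma pow_apply_eq_sum_ladderF {V : Type*} [AddCommGroup V] [Module ℂ V] {M : ℕ}
    (hM : Admissible ħ M) (f : V →ₗ[ℂ] V) (J₁ J₂ : ℕ) (T : ℕ → ℕ → V)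
    (hf : ∀ a b : ℕ, f (T a b)
      = (qSqrt ħ ((J₁ : ℚ) - a) * qSqrt ħ ((a : ℚ) + 1) * qPow ħ (1 / 2 * ((J₂ : ℚ) / 2 - b)))
          • T (a + 1) b
        + (qPow ħ (-1 / 2 * ((J₁ : ℚ) / 2 - a)) * (qSqrt ħ ((J₂ : ℚ) - b) * qSqrt ħ ((b : ℚ) + 1)))
          • T a (b + 1)) (a b : ℕ) {l : ℕ} (hl : l ≤ M) :
    (f ^ l) (T a b) = ∑ x ∈ Finset.HasAntidiagonal.antidiagonal l,
      ladderF ħ x.1 x.2 J₁ a J₂ b • T (a + x.1) (b + x.2) := by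
  induction l with
  | zero => simp [ladderF, ladderProd, qbin, qPow_zero]
  | succ l ih =>
    have hM1 : Admissible ħ 1 := hM.mono (by omega)
    -- the two halves of Pascal's rule
    let g : ℕ × ℕ → ℂ := fun x => qfac ħ l / (qfac ħ x.1 * qfac ħ x.2) *
      (qPow ħ ((x.1 * ((J₂ : ℚ) / 2 - b) - x.2 * ((J₁ : ℚ) / 2 - a)) / 2)
        * (ladderProd ħ J₁ a x.1 * ladderProd ħ J₂ b x.2))
    have h1 : ∀ x ∈ Finset.HasAntidiagonal.antidiagonal (l + 1),
        ladderF ħ x.1 x.2 J₁ a J₂ b • T (a + x.1) (b + x.2)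
          = (qPow ħ (-(x.2 : ℚ) / 2) * qNum ħ x.1 * g x) • T (a + x.1) (b + x.2)
            + (qPow ħ ((x.1 : ℚ) / 2) * qNum ħ x.2 * g x) • T (a + x.1) (b + x.2) := by
      intro x hx
      have hx := Finset.HasAntidiagonal.mem_antidiagonal.1 hx
      rw [← add_smul]
      congr 1
      have e := qNum_add ħ x.1 x.2
      have e' : (x.1 : ℚ) + x.2 = ((l + 1 : ℕ) : ℚ) := by rw [← hx]; push_cast; ring
      rw [e'] at e
      simp only [ladderF, g, qbin, hx, qfac_succ ħ l]
      rw [e]; ring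
    rw [Finset.sum_congr rfl h1, Finset.sum_add_distrib, Finset.Nat.sum_antidiagonal_succ,
      Finset.Nat.sum_antidiagonal_succ' (n := l), pow_succ', Module.End.mul_apply, ih (by omega),
      map_sum]
    simp only [Nat.cast_zero, qNum_zero, mul_zero, zero_mul, zero_smul, zero_add, add_zero]
    rw [← Finset.sum_add_distrib]
    refine Finset.sum_congr rfl fun x hx => ?_
    have hx := Finset.HasAntidiagonal.mem_antidiagonal.1 hx
    rw [map_smul, hf, smul_add, smul_smul, smul_smul]
    have n1 := qfac_ne_zero hM (show x.1 ≤ _ by omega)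
    have n2 := qfac_ne_zero hM (show x.2 ≤ _ by omega)
    have n3 := qNum_ne_zero hM (show 1 ≤ x.1 + 1 by omega) (by omega)
    have n4 := qNum_ne_zero hM (show 1 ≤ x.2 + 1 by omega) (by omega)
    have l1 : ladderProd ħ J₁ a (x.1 + 1) = ladderProd ħ J₁ a x.1
        * (qSqrt ħ ((J₁ : ℚ) - a - x.1) * qSqrt ħ ((a : ℚ) + x.1 + 1)) :=
      Finset.prod_range_succ _ _
    have l2 : ladderProd ħ J₂ b (x.2 + 1) = ladderProd ħ J₂ b x.2
        * (qSqrt ħ ((J₂ : ℚ) - b - x.2) * qSqrt ħ ((b : ℚ) + x.2 + 1)) :=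
      Finset.prod_range_succ _ _
    congr 1
    · rw [← add_assoc a]
      congr 1
      simp only [ladderF, g, qbin, hx, l1, qfac_succ ħ x.1]
      have e1 : (J₁ : ℚ) - ((a + x.1 : ℕ) : ℚ) = J₁ - a - x.1 := by push_cast; ring
      have e2 : (((a + x.1 : ℕ) : ℚ) + 1) = a + x.1 + 1 := by push_cast; ring
      have e3 : qPow ħ ((x.1 * ((J₂ : ℚ) / 2 - b) - x.2 * ((J₁ : ℚ) / 2 - a)) / 2)
            * qPow ħ (1 / 2 * ((J₂ : ℚ) / 2 - ((b + x.2 : ℕ) : ℚ)))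
          = qPow ħ (-(x.2 : ℚ) / 2)
            * qPow ħ ((((x.1 + 1 : ℕ) : ℚ) * ((J₂ : ℚ) / 2 - b) - x.2 * ((J₁ : ℚ) / 2 - a)) / 2) := by
        rw [← qPow_add, ← qPow_add]; congr 1; push_cast; ring
      rw [e1, e2]
      generalize qPow ħ ((x.1 * ((J₂ : ℚ) / 2 - b) - x.2 * ((J₁ : ℚ) / 2 - a)) / 2) = u₁ at e3 ⊢
      generalize qPow ħ (1 / 2 * ((J₂ : ℚ) / 2 - ((b + x.2 : ℕ) : ℚ))) = u₂ at e3 ⊢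
      generalize qPow ħ (-(x.2 : ℚ) / 2) = u₃ at e3 ⊢
      generalize qPow ħ ((((x.1 + 1 : ℕ) : ℚ) * ((J₂ : ℚ) / 2 - b)
        - x.2 * ((J₁ : ℚ) / 2 - a)) / 2) = u₄ at e3 ⊢
      generalize qNum ħ ((x.1 + 1 : ℕ) : ℚ) = z at n3 ⊢
      generalize qSqrt ħ ((J₁ : ℚ) - a - x.1) = s₁
      generalize qSqrt ħ ((a : ℚ) + x.1 + 1) = s₂
      field_simp
      linear_combination (ladderProd ħ J₁ a x.1 * ladderProd ħ J₂ b x.2 * s₁ * s₂ * qfac ħ l) * e3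
    · rw [← add_assoc b]
      congr 1
      simp only [ladderF, g, qbin, hx, l2, qfac_succ ħ x.2]
      have e1 : (J₂ : ℚ) - ((b + x.2 : ℕ) : ℚ) = J₂ - b - x.2 := by push_cast; ring
      have e2 : (((b + x.2 : ℕ) : ℚ) + 1) = b + x.2 + 1 := by push_cast; ring
      have e3 : qPow ħ ((x.1 * ((J₂ : ℚ) / 2 - b) - x.2 * ((J₁ : ℚ) / 2 - a)) / 2)
            * qPow ħ (-1 / 2 * ((J₁ : ℚ) / 2 - ((a + x.1 : ℕ) : ℚ)))
          = qPow ħ ((x.1 : ℚ) / 2)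
            * qPow ħ ((x.1 * ((J₂ : ℚ) / 2 - b) - ((x.2 + 1 : ℕ) : ℚ) * ((J₁ : ℚ) / 2 - a)) / 2) := by
        rw [← qPow_add, ← qPow_add]; congr 1; push_cast; ring
      rw [e1, e2]
      generalize qPow ħ ((x.1 * ((J₂ : ℚ) / 2 - b) - x.2 * ((J₁ : ℚ) / 2 - a)) / 2) = u₁ at e3 ⊢
      generalize qPow ħ (-1 / 2 * ((J₁ : ℚ) / 2 - ((a + x.1 : ℕ) : ℚ))) = u₂ at e3 ⊢
      generalize qPow ħ ((x.1 : ℚ) / 2) = u₃ at e3 ⊢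
      generalize qPow ħ ((x.1 * ((J₂ : ℚ) / 2 - b)
        - ((x.2 + 1 : ℕ) : ℚ) * ((J₁ : ℚ) / 2 - a)) / 2) = u₄ at e3 ⊢
      generalize qNum ħ ((x.2 + 1 : ℕ) : ℚ) = z at n4 ⊢
      generalize qSqrt ħ ((J₂ : ℚ) - b - x.2) = s₁
      generalize qSqrt ħ ((b : ℚ) + x.2 + 1) = s₂
      field_simp
      linear_combination (ladderProd ħ J₁ a x.1 * ladderProd ħ J₂ b x.2 * s₁ * s₂ * qfac ħ l) * e3

end Coefficients

section Black

variable {ħ : ℂ} {n₁ n₂ : ℕ}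

lemma tensorRep_Em_pow_zero_tket {M : ℕ} (hM : Admissible ħ M) {l : ℕ} (hl : l ≤ M) (a b : ℕ) :
    ((tensorRep ħ n₁ n₂).Em 0 ^ l).mulVec (tket n₁ n₂ a 0 b 0)
      = ∑ x ∈ Finset.HasAntidiagonal.antidiagonal l, ladderF ħ x.1 x.2 n₁ a n₂ b
          • tket n₁ n₂ ((a + x.1 : ℕ) : ℤ) 0 ((b + x.2 : ℕ) : ℤ) 0 := by
  rw [← mulVecLin_pow_apply]
  refine pow_apply_eq_sum_ladderF hM _ n₁ n₂ (fun a b => tket n₁ n₂ a 0 b 0) (fun a b => ?_) a b hl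
  rw [Matrix.mulVecLin_apply, tensorRep_Em_zero_tket]
  simp

lemma tensorRep_Em_pow_one_tket {M : ℕ} (hM : Admissible ħ M) {l : ℕ} (hl : l ≤ M) (a b : ℕ) :
    ((tensorRep ħ n₁ n₂).Em 1 ^ l).mulVec (tket n₁ n₂ a 0 b 0)
      = ∑ x ∈ Finset.HasAntidiagonal.antidiagonal l, ladderF ħ x.1 x.2 a 0 b 0
          • tket n₁ n₂ a x.1 b x.2 := by
  rw [← mulVecLin_pow_apply]
  have := pow_apply_eq_sum_ladderF hM ((tensorRep ħ n₁ n₂).Em 1).mulVecLin a b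
    (fun x y => tket n₁ n₂ a x b y) (fun x y => ?_) 0 0 hl
  · simpa using this
  rw [Matrix.mulVecLin_apply, tensorRep_Em_one_tket]
  simp

lemma lowered_eq_sum (hM : Admissible ħ (n₁ + n₂ + 1)) (s : ℕ) {l₁ l₂ : ℕ}
    (h₁ : l₁ ≤ n₁ + n₂ + 1) (h₂ : l₂ ≤ n₁ + n₂ + 1) :
    lowered ħ n₁ n₂ s l₁ l₂ = ∑ k ∈ Finset.HasAntidiagonal.antidiagonal s,
      ∑ x ∈ Finset.HasAntidiagonal.antidiagonal l₁, ∑ z ∈ Finset.HasAntidiagonal.antidiagonal l₂,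
        (topCG ħ n₁ n₂ s k.1 k.2 * (ladderF ħ x.1 x.2 n₁ k.1 n₂ k.2
          * ladderF ħ z.1 z.2 (k.1 + x.1) 0 (k.2 + x.2) 0))
          • tket n₁ n₂ ((k.1 + x.1 : ℕ) : ℤ) z.1 ((k.2 + x.2 : ℕ) : ℤ) z.2 := by
  rw [lowered, ← Matrix.mulVec_mulVec, topState_eq_sum]
  simp only [Matrix.mulVec_sum, Matrix.mulVec_smul, tensorRep_Em_pow_zero_tket hM h₁,
    tensorRep_Em_pow_one_tket hM h₂, Finset.smul_sum, smul_smul, mul_assoc]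

lemma coprodF_zero_eq (hM : Admissible ħ (n₁ + n₂ + 1)) {x y k₁ k₂ : ℕ} (h₁ : k₁ + x ≤ n₁)
    (h₂ : k₂ + y ≤ n₂) :
    coprodF ħ 0 x y n₁ k₁ 0 n₂ k₂ 0 = ladderF ħ x y n₁ k₁ n₂ k₂ := by
  rw [ladderF, ladderProd_eq hM (by omega) h₁, ladderProd_eq hM (by omega) h₂, coprodF]
  have hm : ∀ n k : ℕ, magM 0 n 0 k 0 = (n : ℚ) / 2 - k := fun n k => by simp [magM, rootDot]
  have hj : ∀ n k : ℕ, spinJ 0 n 0 k 0 = (n : ℚ) / 2 := fun n k => by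
    simp [spinJ, magM, rootDot]
  simp only [hm, hj]
  rw [qSqrtFact_eq (n₂ - k₂) (by push_cast [Nat.cast_sub (show k₂ ≤ n₂ by omega)]; ring),
    qSqrtFact_eq (n₁ - k₁) (by push_cast [Nat.cast_sub (show k₁ ≤ n₁ by omega)]; ring),
    qSqrtFact_eq k₂ (by ring), qSqrtFact_eq k₁ (by ring),
    qSqrtFact_eq (k₂ + y) (by push_cast; ring), qSqrtFact_eq (k₁ + x) (by push_cast; ring),
    qSqrtFact_eq (n₂ - k₂ - y) (by
      push_cast [Nat.cast_sub (show k₂ ≤ n₂ by omega), Nat.cast_sub (show y ≤ n₂ - k₂ by omega)]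
      ring),
    qSqrtFact_eq (n₁ - k₁ - x) (by
      push_cast [Nat.cast_sub (show k₁ ≤ n₁ by omega), Nat.cast_sub (show x ≤ n₁ - k₁ by omega)]
      ring), ← Nat.cast_add, qFact_natCast, qFact_natCast, qFact_natCast, qbin]
  ring

lemma coprodF_one_eq (hM : Admissible ħ (n₁ + n₂ + 1)) {x y a₁ a₂ : ℕ} (h₁ : x ≤ a₁)
    (h₂ : y ≤ a₂) (ha₁ : a₁ ≤ n₁) (ha₂ : a₂ ≤ n₂) :
    coprodF ħ 1 x y n₁ a₁ 0 n₂ a₂ 0 = ladderF ħ x y a₁ 0 a₂ 0 := by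
  rw [ladderF, ladderProd_eq hM (show a₁ ≤ _ by omega) (by omega),
    ladderProd_eq hM (show a₂ ≤ _ by omega) (by omega), coprodF]
  have hm : ∀ n a : ℕ, magM 1 n 0 a 0 = (a : ℚ) / 2 := fun n a => by
    simp [magM, rootDot]; ring
  have hj : ∀ n a : ℕ, a ≤ n → spinJ 1 n 0 a 0 = (a : ℚ) / 2 := fun n a h => by
    simp [spinJ, magM, rootDot, Nat.sub_eq_zero_of_le h]; ring
  simp only [hm, hj n₁ a₁ ha₁, hj n₂ a₂ ha₂]
  rw [qSqrtFact_eq a₂ (by ring), qSqrtFact_eq a₁ (by ring),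
    qSqrtFact_eq (x := (a₂ : ℚ) / 2 - a₂ / 2) 0 (by simp),
    qSqrtFact_eq (x := (a₁ : ℚ) / 2 - a₁ / 2) 0 (by simp),
    qSqrtFact_eq y (by ring), qSqrtFact_eq x (by ring),
    qSqrtFact_eq (a₂ - y) (by push_cast [Nat.cast_sub h₂]; ring),
    qSqrtFact_eq (a₁ - x) (by push_cast [Nat.cast_sub h₁]; ring), ← Nat.cast_add, qFact_natCast,
    qFact_natCast, qFact_natCast, qbin]
  simp only [Nat.cast_zero, sub_zero, Nat.sub_zero, zero_add, sfac_zero]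
  ring

lemma ladderH_zero_eq (ħ : ℂ) {l p : ℕ} (s : ℕ) (h : l ≤ p) :
    ladderH ħ 0 l p s 0 0 = sfac ħ p * sfac ħ l / sfac ħ (p - l) := by
  have hm : magM 0 p s 0 0 = (p : ℚ) / 2 := by simp [magM]
  have hj : spinJ 0 p s 0 0 = (p : ℚ) / 2 := by simp [spinJ, magM]
  simp only [ladderH, hm, hj]
  rw [qSqrtFact_eq p (by ring), qSqrtFact_eq l (by ring),
    qSqrtFact_eq (p - l) (by push_cast [Nat.cast_sub h]; ring), qSqrtFact_eq 0 (by simp)]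
  simp

lemma ladderH_one_eq (ħ : ℂ) {l₁ l₂ p s : ℕ} (h₁ : l₁ ≤ p) (h₂ : l₂ ≤ s + l₁) :
    ladderH ħ 1 l₂ p s l₁ 0 = sfac ħ (s + l₁) * sfac ħ l₂ / sfac ħ (s + l₁ - l₂) := by
  have hm : magM 1 p s l₁ 0 = ((s + l₁ : ℕ) : ℚ) / 2 := by
    simp [magM, rootDot]; ring
  have hj : spinJ 1 p s l₁ 0 = ((s + l₁ : ℕ) : ℚ) / 2 := by
    simp [spinJ, magM, rootDot, Nat.sub_eq_zero_of_le h₁]; ring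
  simp only [ladderH, hm, hj]
  rw [qSqrtFact_eq (s + l₁) (by ring), qSqrtFact_eq l₂ (by ring),
    qSqrtFact_eq (s + l₁ - l₂) (by rw [Nat.cast_sub h₂]; ring), qSqrtFact_eq 0 (by simp)]
  simp

theorem blackState_apply (hM : Admissible ħ (n₁ + n₂ + 1)) {s l₁ l₂ : ℕ} (hs : s ≤ min n₁ n₂)
    (h₁ : l₁ ≤ n₁ + n₂ - 2 * s) (h₂ : l₂ ≤ s + l₁) (p₁ : SymIdx n₁) (p₂ : SymIdx n₂) :
    blackState ħ n₁ n₂ s l₁ l₂ (p₁, p₂) = blackCG ħ n₁ n₂ s l₁ l₂ p₁.A p₁.B p₂.A p₂.B := by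
  rw [blackState, lowered_eq_sum hM s (by omega) (by omega), blackCG]
  simp only [Pi.smul_apply, Finset.sum_apply, smul_eq_mul, Finset.mul_sum, tket_apply]
  refine Finset.sum_congr rfl fun k _ => Finset.sum_congr rfl fun x _ =>
    Finset.sum_congr rfl fun z _ => ?_
  have hA₁ := p₁.A_le
  have hA₂ := p₂.A_le
  have hB₁ := p₁.B_le_A
  have hB₂ := p₂.B_le_A
  by_cases h : k.1 + x.1 = p₁.A ∧ z.1 = p₁.B ∧ k.2 + x.2 = p₂.A ∧ z.2 = p₂.B
  · rw [if_pos (by omega), if_pos h, coprodF_zero_eq hM (by omega) (by omega),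
      coprodF_one_eq hM (by omega) (by omega) (by omega) (by omega)]
    ring
  · rw [if_neg (by omega), if_neg h]; ring

theorem pairing_lowered (hM : Admissible ħ (n₁ + n₂ + 1)) {s l₁ l₂ : ℕ} (hs : s ≤ min n₁ n₂)
    (h₁ : l₁ ≤ n₁ + n₂ - 2 * s) (h₂ : l₂ ≤ s + l₁) :
    pairing (lowered ħ n₁ n₂ s l₁ l₂) (lowered ħ n₁ n₂ s l₁ l₂)
      = (qfac ħ (s + l₁) * qfac ħ l₂ / qfac ħ (s + l₁ - l₂))
        * (qfac ħ (n₁ + n₂ - 2 * s) * qfac ħ l₁ / qfac ħ (n₁ + n₂ - 2 * s - l₁)) := by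
  have hq : Admissible ħ 1 := hM.mono (by omega)
  have G := isGraded_tensorRep hq n₁ n₂
  have ht := topState_mem_wt ħ n₁ n₂ s
  rw [lowered, ← Matrix.mulVec_mulVec, G.pairing_Em_pow (hM.mono (by omega)) (fun r => ?_) h₂,
    G.pairing_Em_pow (hM.mono (by omega)) (fun r => ?_) h₁, pairing_topState_self hM hs, mul_one]
  · rw [G.Ep_Em_pow_zero hq r ht, Ep_topState hM hs, Matrix.mulVec_zero, zero_add]
    congr 3
    push_cast [Nat.cast_sub (show 2 * s ≤ n₁ + n₂ by omega)]; ring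
  · rw [G.Ep_Em_pow_one hq r (G.Em_pow_zero_mem l₁ ht), G.Ep_Em_pow_of_ne (by decide),
      Ep_topState hM hs, Matrix.mulVec_zero, Matrix.mulVec_zero, zero_add]
    congr 3
    push_cast; ring

theorem pairing_blackState (hM : Admissible ħ (n₁ + n₂ + 1)) {s l₁ l₂ : ℕ} (hs : s ≤ min n₁ n₂)
    (h₁ : l₁ ≤ n₁ + n₂ - 2 * s) (h₂ : l₂ ≤ s + l₁) :
    pairing (blackState ħ n₁ n₂ s l₁ l₂) (blackState ħ n₁ n₂ s l₁ l₂) = 1 := by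
  rw [blackState, pairing_smul_left, pairing_smul_right, pairing_lowered hM hs h₁ h₂,
    ladderH_zero_eq ħ s h₁, ladderH_one_eq ħ h₁ h₂]
  simp only [← sfac_mul_self]
  have n1 := sfac_ne_zero hM (show s + l₁ ≤ _ by omega)
  have n2 := sfac_ne_zero hM (show l₂ ≤ _ by omega)
  have n3 := sfac_ne_zero hM (show s + l₁ - l₂ ≤ _ by omega)
  have n4 := sfac_ne_zero hM (show n₁ + n₂ - 2 * s ≤ _ by omega)
  have n5 := sfac_ne_zero hM (show l₁ ≤ _ by omega)
  have n6 := sfac_ne_zero hM (show n₁ + n₂ - 2 * s - l₁ ≤ _ by omega)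
  have y : ((-1 : ℂ) ^ s) ^ 2 = 1 := by rw [← pow_mul, mul_comm, pow_mul]; simp
  field_simp
  exact y

end Black

end

section

/-! ### Lowering operators modulo the image of `Em3` -/

variable {ι : Type} [Fintype ι] [DecidableEq ι] {ħ : ℂ} {ε : ℤ} {R : Ops ι} {N : ℕ} {A B : ι → ℕ}

/-- `top` is a highest weight vector of weight `p μ₁ + s μ₂ = N μ₁ - s α₁` on which the powers
of the lowering operators vanish as in a finite-dimensional irreducible representation. -/
structure IsTop (ħ : ℂ) (R : Ops ι) (N : ℕ) (A B : ι → ℕ) (s p : ℕ) (top : ι → ℂ) : Prop where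
  graded : IsGraded ħ R N A B
  adm : Admissible ħ (N + 1)
  hN : p + 2 * s = N
  hA : ∀ i, A i ≤ N
  hB : ∀ i, B i ≤ N
  mem : top ∈ wt A B s 0
  sing : ∀ i, (R.Ep i).mulVec top = 0
  Em_pow_zero : (R.Em 0 ^ (p + 1)).mulVec top = 0
  Em_pow_one : (R.Em 1 ^ (s + 1)).mulVec top = 0

/-- The states from which the powers of the lowering operator of `α₃` start, of weight
`Λ - x α₁ - y α₂`. For `y ≤ x` and for `x < y` the order of the lowering operators is that of
`colorState`. -/
def cornerState (R : Ops ι) (top : ι → ℂ) (x y : ℕ) : ι → ℂ :=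
  if y ≤ x then (R.Em 0 ^ (x - y)).mulVec ((R.Em 1 ^ y).mulVec ((R.Em 0 ^ y).mulVec top))
  else (R.Em 1 ^ y).mulVec ((R.Em 0 ^ x).mulVec top)

lemma pow_mulVec_pow (M : Matrix ι ι ℂ) (k l : ℕ) (v : ι → ℂ) :
    (M ^ k).mulVec ((M ^ l).mulVec v) = (M ^ (k + l)).mulVec v := by
  rw [Matrix.mulVec_mulVec, ← pow_add]

lemma pow_mulVec_mem {M : Matrix ι ι ℂ} {W : Submodule ℂ (ι → ℂ)} (h : ∀ v ∈ W, M.mulVec v ∈ W)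
    (l : ℕ) {v : ι → ℂ} (hv : v ∈ W) : (M ^ l).mulVec v ∈ W := by
  induction l with
  | zero => simpa using hv
  | succ l ih => rw [pow_succ_mulVec]; exact h _ ih

lemma IsGraded.cornerState_mem_wt (G : IsGraded ħ R N A B) {a b : ℤ} {top : ι → ℂ}
    (h : top ∈ wt A B a b) (x y : ℕ) : cornerState R top x y ∈ wt A B (a + x) (b + y) := by
  rw [cornerState]
  split_ifs with hxy
  · convert G.Em_pow_zero_mem (x - y) (G.Em_pow_one_mem y (G.Em_pow_zero_mem y h)) using 2
    rw [Nat.cast_sub hxy]; ring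
  · exact G.Em_pow_one_mem y (G.Em_pow_zero_mem x h)

lemma Em_mem_generated (R : Ops ι) (top : ι → ℂ) (i : Fin 2) :
    ∀ v ∈ generated R top, (R.Em i).mulVec v ∈ generated R top :=
  fun v hv => (isInvariant_generated R top i v hv).2.2

lemma Ep_mem_generated (R : Ops ι) (top : ι → ℂ) (i : Fin 2) :
    ∀ v ∈ generated R top, (R.Ep i).mulVec v ∈ generated R top :=
  fun v hv => (isInvariant_generated R top i v hv).2.1

lemma Em3_mem_generated (R : Ops ι) (top : ι → ℂ) :
    ∀ v ∈ generated R top, (Em3 ħ ε R).mulVec v ∈ generated R top := fun v hv => by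
  rw [IsGraded.Em3_mulVec]
  exact Submodule.sub_mem _ (Em_mem_generated R top 1 _ (Em_mem_generated R top 0 v hv))
    (Submodule.smul_mem _ _ (Em_mem_generated R top 0 _ (Em_mem_generated R top 1 v hv)))

lemma Ep3_mem_generated (R : Ops ι) (top : ι → ℂ) :
    ∀ v ∈ generated R top, (Ep3 ħ ε R).mulVec v ∈ generated R top := fun v hv => by
  rw [IsGraded.Ep3_mulVec]
  exact Submodule.sub_mem _ (Ep_mem_generated R top 0 _ (Ep_mem_generated R top 1 v hv))
    (Submodule.smul_mem _ _ (Ep_mem_generated R top 1 _ (Ep_mem_generated R top 0 v hv)))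

lemma cornerState_mem_generated (R : Ops ι) (top : ι → ℂ) (x y : ℕ) :
    cornerState R top x y ∈ generated R top := by
  have h := mem_generated R top
  have h0 := Em_mem_generated R top 0
  have h1 := Em_mem_generated R top 1
  rw [cornerState]
  split_ifs
  · exact pow_mulVec_mem h0 _ (pow_mulVec_mem h1 _ (pow_mulVec_mem h0 _ h))
  · exact pow_mulVec_mem h1 _ (pow_mulVec_mem h0 _ h)

lemma IsGraded.Em_zero_Em3 (G : IsGraded ħ R N A B) (hq : Admissible ħ 1) (hε : ε = 1 ∨ ε = -1)
    (v : ι → ℂ) : (R.Em 0).mulVec ((Em3 ħ ε R).mulVec v)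
      = qPow ħ ((ε : ℚ) / 2) • (Em3 ħ ε R).mulVec ((R.Em 0).mulVec v) := by
  have := congrArg (fun M => qPow ħ ((ε : ℚ) / 2) • M.mulVec v) (G.Em3_mul_Em_zero hq hε)
  simp only [Matrix.smul_mulVec, ← Matrix.mulVec_mulVec, smul_smul, ← qPow_add] at this
  rw [this, show (ε : ℚ) / 2 + -(ε : ℚ) / 2 = 0 by ring, qPow_zero, one_smul]

lemma IsGraded.Em_one_Em3 (G : IsGraded ħ R N A B) (hq : Admissible ħ 1) (hε : ε = 1 ∨ ε = -1)
    (v : ι → ℂ) : (R.Em 1).mulVec ((Em3 ħ ε R).mulVec v)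
      = qPow ħ (-(ε : ℚ) / 2) • (Em3 ħ ε R).mulVec ((R.Em 1).mulVec v) := by
  have := congrArg (fun M => M.mulVec v) (G.Em_one_mul_Em3 hq hε)
  simpa only [Matrix.smul_mulVec, ← Matrix.mulVec_mulVec] using this

/-- The image of the operator `Em3` on a subrepresentation is stable under the lowering
operators. -/
lemma IsGraded.Em_mem_map_Em3 (G : IsGraded ħ R N A B) (hq : Admissible ħ 1)
    (hε : ε = 1 ∨ ε = -1) (top : ι → ℂ) (i : Fin 2) :
    ∀ v ∈ (generated R top).map (Em3 ħ ε R).mulVecLin,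
      (R.Em i).mulVec v ∈ (generated R top).map (Em3 ħ ε R).mulVecLin := by
  rintro _ ⟨v, hv, rfl⟩
  rw [Matrix.mulVecLin_apply]
  fin_cases i
  · exact (G.Em_zero_Em3 hq hε v) ▸ Submodule.smul_mem _ _
      ⟨_, Em_mem_generated R top 0 v hv, rfl⟩
  · exact (G.Em_one_Em3 hq hε v) ▸ Submodule.smul_mem _ _
      ⟨_, Em_mem_generated R top 1 v hv, rfl⟩

/-- Modulo the image of `Em3`, the two lowering operators commute up to powers of `q`. -/
lemma IsGraded.pow_comm_mod_Em3 (G : IsGraded ħ R N A B) (hq : Admissible ħ 1)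
    (hε : ε = 1 ∨ ε = -1) {top : ι → ℂ} (a b : ℕ) {v : ι → ℂ} (hv : v ∈ generated R top) :
    (R.Em 1 ^ b).mulVec ((R.Em 0 ^ a).mulVec v)
      - qPow ħ ((ε : ℚ) * a * b / 2) • (R.Em 0 ^ a).mulVec ((R.Em 1 ^ b).mulVec v)
        ∈ (generated R top).map (Em3 ħ ε R).mulVecLin := by
  have hI := G.Em_mem_map_Em3 hq hε top
  have h0 := Em_mem_generated R top 0
  have h1 := Em_mem_generated R top 1
  have one : ∀ (b : ℕ), ∀ v ∈ generated R top, (R.Em 1 ^ b).mulVec ((R.Em 0).mulVec v)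
      - qPow ħ ((ε : ℚ) * b / 2) • (R.Em 0).mulVec ((R.Em 1 ^ b).mulVec v)
        ∈ (generated R top).map (Em3 ħ ε R).mulVecLin := by
    intro b
    induction b with
    | zero => intro v hv; simp [qPow_zero]
    | succ b ih =>
      intro v hv
      have i1 := hI 1 _ (ih v hv)
      have i2 : (Em3 ħ ε R).mulVec ((R.Em 1 ^ b).mulVec v)
          ∈ (generated R top).map (Em3 ħ ε R).mulVecLin := ⟨_, pow_mulVec_mem h1 b hv, rfl⟩
      rw [IsGraded.Em3_mulVec] at i2
      rw [Matrix.mulVec_sub, Matrix.mulVec_smul] at i1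
      convert Submodule.add_mem _ i1 (Submodule.smul_mem _ (qPow ħ ((ε : ℚ) * b / 2)) i2) using 1
      rw [pow_succ_mulVec, pow_succ_mulVec, smul_sub, smul_smul, ← qPow_add,
        show (ε : ℚ) * ((b + 1 : ℕ) : ℚ) / 2 = ε * b / 2 + ε / 2 by push_cast; ring]
      abel
  induction a with
  | zero => simp [qPow_zero]
  | succ a ih =>
    have i1 := one b _ (pow_mulVec_mem h0 a hv)
    have i2 := hI 0 _ ih
    rw [Matrix.mulVec_sub, Matrix.mulVec_smul] at i2
    convert Submodule.add_mem _ i1 (Submodule.smul_mem _ (qPow ħ ((ε : ℚ) * b / 2)) i2) using 1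
    rw [pow_succ_mulVec, pow_succ_mulVec, smul_sub, smul_smul, ← qPow_add,
      show (ε : ℚ) * ((a + 1 : ℕ) : ℚ) * b / 2 = ε * b / 2 + ε * a * b / 2 by push_cast; ring]
    abel

namespace IsTop

variable {s p : ℕ} {top : ι → ℂ}

/-- Modulo the image of `Em3` one state of each weight `Λ - x α₁ - y α₂`, `x ≤ p`, `y ≤ s`, is
enough: the lowering operators can be reordered, and `Em 0 ^ (p + 1)` and `Em 1 ^ (s + 1)` annihilate the
highest weight vector. -/
lemma generated_le_sup (T : IsTop ħ R N A B s p top) (hε : ε = 1 ∨ ε = -1) :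
    generated R top ≤ (generated R top).map (Em3 ħ ε R).mulVecLin
      ⊔ Submodule.span ℂ {v | ∃ x y : ℕ, x ≤ p ∧ y ≤ s ∧ v = cornerState R top x y} := by
  have G := T.graded
  have hq : Admissible ħ 1 := T.adm.mono (by omega)
  set I := (generated R top).map (Em3 ħ ε R).mulVecLin with hIdef
  have hI : ∀ i, ∀ v ∈ I, (R.Em i).mulVec v ∈ I := G.Em_mem_map_Em3 hq hε top
  have h0 := Em_mem_generated R top 0
  have h1 := Em_mem_generated R top 1
  have htop := mem_generated R top
  have first : generated R top ≤ I ⊔ Submodule.span ℂ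
      {v | ∃ a b : ℕ, v = (R.Em 1 ^ b).mulVec ((R.Em 0 ^ a).mulVec top)} := by
    refine G.generated_le_of_lowering T.mem T.sing ?_ fun i u hu => ?_
    · exact Submodule.mem_sup_right (Submodule.subset_span ⟨0, 0, by simp⟩)
    · obtain ⟨w, hw, z, hz, rfl⟩ := Submodule.mem_sup.1 hu
      rw [Matrix.mulVec_add]
      refine Submodule.add_mem _ (Submodule.mem_sup_left (hI i w hw)) ?_
      induction hz using Submodule.span_induction with
      | mem z hz =>
        obtain ⟨a, b, rfl⟩ := hz
        fin_cases i
        · have := G.pow_comm_mod_Em3 hq hε 1 b (pow_mulVec_mem h0 a htop)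
          rw [pow_one, ← pow_succ_mulVec] at this
          refine ((Submodule.smul_mem_iff _ (qPow_ne_zero ħ ((ε : ℚ) * ((1 : ℕ) : ℚ) * b / 2))).1 ?_)
          have hab : (R.Em 1 ^ b).mulVec ((R.Em 0 ^ (a + 1)).mulVec top) ∈ Submodule.span ℂ
              {v | ∃ a b : ℕ, v = (R.Em 1 ^ b).mulVec ((R.Em 0 ^ a).mulVec top)} :=
            Submodule.subset_span ⟨a + 1, b, rfl⟩
          convert Submodule.sub_mem _ (Submodule.mem_sup_right (S := I) hab)
            (Submodule.mem_sup_left this) using 1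
          rw [sub_sub_cancel]; rfl
        · exact Submodule.mem_sup_right (Submodule.subset_span
            ⟨a, b + 1, (pow_succ_mulVec _ _ _).symm⟩)
      | zero => rw [Matrix.mulVec_zero]; exact Submodule.zero_mem _
      | add x y _ _ hx hy =>
        rw [Matrix.mulVec_add]
        exact Submodule.add_mem _ (hx (Submodule.mem_sup.2 ⟨w, hw, x, by assumption, rfl⟩))
          (hy (Submodule.mem_sup.2 ⟨w, hw, y, by assumption, rfl⟩))
      | smul c x _ hx =>
        rw [Matrix.mulVec_smul]
        exact Submodule.smul_mem _ _ (hx (Submodule.mem_sup.2 ⟨w, hw, x, by assumption, rfl⟩))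
  refine first.trans (sup_le le_sup_left (Submodule.span_le.2 ?_))
  rintro _ ⟨a, b, rfl⟩
  change _ ∈ I ⊔ _
  by_cases ha : p < a
  · obtain ⟨d, rfl⟩ := Nat.exists_eq_add_of_lt ha
    rw [show p + d + 1 = d + (p + 1) by ring, ← pow_mulVec_pow, T.Em_pow_zero, Matrix.mulVec_zero,
      Matrix.mulVec_zero]
    exact Submodule.zero_mem _
  by_cases hb : s < b
  · have := G.pow_comm_mod_Em3 hq hε a b htop
    obtain ⟨d, rfl⟩ := Nat.exists_eq_add_of_lt hb
    have h2 : (R.Em 1 ^ (s + d + 1)).mulVec top = 0 := by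
      rw [show s + d + 1 = d + (s + 1) by ring, ← pow_mulVec_pow, T.Em_pow_one, Matrix.mulVec_zero]
    rw [h2, Matrix.mulVec_zero, smul_zero, sub_zero] at this
    exact Submodule.mem_sup_left this
  have hu : cornerState R top a b ∈ Submodule.span ℂ
      {v | ∃ x y : ℕ, x ≤ p ∧ y ≤ s ∧ v = cornerState R top x y} :=
    Submodule.subset_span ⟨a, b, by omega, by omega, rfl⟩
  rw [cornerState] at hu
  split_ifs at hu with hab
  · have := G.pow_comm_mod_Em3 hq hε (a - b) b (pow_mulVec_mem h0 b htop)
    rw [pow_mulVec_pow, Nat.sub_add_cancel hab] at this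
    convert Submodule.add_mem _ (Submodule.mem_sup_left this)
      (Submodule.smul_mem _ (qPow ħ ((ε : ℚ) * ((a - b : ℕ) : ℚ) * b / 2))
        (Submodule.mem_sup_right (S := I) hu)) using 1
    rw [sub_add_cancel]
  · exact Submodule.mem_sup_right hu

end IsTop

end

section

/-! ### Weight spaces and their reflections in the root `α₃` -/

variable {ι : Type} [Fintype ι] [DecidableEq ι] {ħ : ℂ} {ε : ℤ} {R : Ops ι} {N : ℕ} {A B : ι → ℕ}

/-- Two injective linear maps in opposite directions between finite-dimensional subspaces are
bijective. -/
lemma map_eq_of_injective_of_injective {V : Type*} [AddCommGroup V] [Module ℂ V]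
    [FiniteDimensional ℂ V] {f g : V →ₗ[ℂ] V} {P Q : Submodule ℂ V} (hf : P.map f ≤ Q)
    (hg : Q.map g ≤ P) (hf0 : ∀ v ∈ P, f v = 0 → v = 0) (hg0 : ∀ v ∈ Q, g v = 0 → v = 0) :
    P.map f = Q := by
  have key : ∀ (f : V →ₗ[ℂ] V) (P : Submodule ℂ V), (∀ v ∈ P, f v = 0 → v = 0) →
      Module.finrank ℂ (P.map f) = Module.finrank ℂ P := by
    intro f P h
    rw [← LinearMap.range_domRestrict]
    refine LinearMap.finrank_range_of_inj ((injective_iff_map_eq_zero _).2 fun v hv => ?_)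
    exact Subtype.ext (h v v.2 hv)
  refine Submodule.eq_of_le_of_finrank_le hf ?_
  rw [key f P hf0, ← key g Q hg0]
  exact Submodule.finrank_mono hg

lemma IsGraded.wtProj_Em3 (G : IsGraded ħ R N A B) (a b : ℤ) (v : ι → ℂ) :
    wtProj A B a b ((Em3 ħ ε R).mulVec v)
      = (Em3 ħ ε R).mulVec (wtProj A B (a - 1) (b - 1) v) := by
  simp only [Em3_mulVec, map_sub, map_smul, G.wtProj_Em_zero, G.wtProj_Em_one]

lemma IsGraded.Em3_pow_mem (G : IsGraded ħ R N A B) (r : ℕ) {a b : ℤ} {v : ι → ℂ}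
    (hv : v ∈ wt A B a b) : (Em3 ħ ε R ^ r).mulVec v ∈ wt A B (a + r) (b + r) := by
  induction r with
  | zero => simpa using hv
  | succ r ih =>
    rw [pow_succ_mulVec]; convert G.Em3_mem ih using 2 <;> push_cast <;> ring

lemma IsGraded.Ep3_pow_mem (G : IsGraded ħ R N A B) (r : ℕ) {a b : ℤ} {v : ι → ℂ}
    (hv : v ∈ wt A B a b) : (Ep3 ħ ε R ^ r).mulVec v ∈ wt A B (a - r) (b - r) := by
  induction r with
  | zero => simpa using hv
  | succ r ih =>
    rw [pow_succ_mulVec]; convert G.Ep3_mem ih using 2 <;> push_cast <;> ring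

namespace IsTop

variable {s p : ℕ} {top : ι → ℂ}

lemma wtProj_mem (T : IsTop ħ R N A B s p top) {v : ι → ℂ} (hv : v ∈ generated R top) (a b : ℤ) :
    wtProj A B a b v ∈ generated R top :=
  T.graded.wtProj_mem_generated T.mem T.sing hv a b

/-- The weight spaces are spanned by the states `Em3 ^ j (cornerState x y)`, by induction on the
depth of the weight along `α₂`, which `Em3` increases. -/
lemma wt_le_span (T : IsTop ħ R N A B s p top) (hε : ε = 1 ∨ ε = -1) (a b : ℤ) :
    generated R top ⊓ wt A B (s + a) b ≤ Submodule.span ℂ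
      {v | ∃ x y j : ℕ, (x : ℤ) + j = a ∧ (y : ℤ) + j = b ∧ x ≤ p ∧ y ≤ s
        ∧ v = (Em3 ħ ε R ^ j).mulVec (cornerState R top x y)} := by
  have G := T.graded
  have main : ∀ (m : ℕ) (a b : ℤ), b < m → generated R top ⊓ wt A B (s + a) b ≤ Submodule.span ℂ
      {v | ∃ x y j : ℕ, (x : ℤ) + j = a ∧ (y : ℤ) + j = b ∧ x ≤ p ∧ y ≤ s
        ∧ v = (Em3 ħ ε R ^ j).mulVec (cornerState R top x y)} := by
    intro m
    induction m with
    | zero =>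
      intro a b hb v hv
      rw [wt_eq_zero_of_neg (Or.inr (by simpa using hb)) hv.2]
      exact Submodule.zero_mem _
    | succ m ih =>
      intro a b hb v hv
      obtain ⟨_, ⟨w, hw, rfl⟩, z, hz, hwz⟩ := Submodule.mem_sup.1 (T.generated_le_sup hε hv.1)
      rw [← wtProj_of_mem hv.2, ← hwz, map_add, Matrix.mulVecLin_apply, G.wtProj_Em3]
      refine Submodule.add_mem _ ?_ ?_
      · have hw' := ih (a - 1) (b - 1) (by push_cast at hb; omega) (x := wtProj A B (s + a - 1)
          (b - 1) w) ⟨T.wtProj_mem hw _ _, by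
            rw [← add_sub_assoc]; exact QuantumSl3.wtProj_mem _ _ _ _ _⟩
        generalize wtProj A B (s + a - 1) (b - 1) w = w' at hw'
        induction hw' using Submodule.span_induction with
        | mem u hu =>
          obtain ⟨x, y, j, hx, hy, hxp, hys, rfl⟩ := hu
          refine Submodule.subset_span ⟨x, y, j + 1, by push_cast; omega, by push_cast; omega,
            hxp, hys, (pow_succ_mulVec _ _ _).symm⟩
        | zero => rw [Matrix.mulVec_zero]; exact Submodule.zero_mem _
        | add x y _ _ hx hy => rw [Matrix.mulVec_add]; exact Submodule.add_mem _ hx hy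
        | smul c x _ hx => rw [Matrix.mulVec_smul]; exact Submodule.smul_mem _ c hx
      · clear hwz
        induction hz using Submodule.span_induction with
        | mem u hu =>
          obtain ⟨x, y, hx, hy, rfl⟩ := hu
          have hc := G.cornerState_mem_wt T.mem x y
          by_cases h : (s : ℤ) + x = s + a ∧ 0 + (y : ℤ) = b
          · rw [← h.1, ← h.2, wtProj_of_mem hc]
            exact Submodule.subset_span ⟨x, y, 0, by simp; omega, by simp, hx, hy, by simp⟩
          · rw [wtProj_of_mem_of_ne hc h]; exact Submodule.zero_mem _
        | zero => rw [map_zero]; exact Submodule.zero_mem _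
        | add x y _ _ hx hy => rw [map_add]; exact Submodule.add_mem _ hx hy
        | smul c x _ hx => rw [map_smul]; exact Submodule.smul_mem _ c hx
  exact main (b.toNat + 1) a b (by omega)

/-- The weights with respect to `α₃` lie between `-N` and `N`. -/
lemma eq_zero_of_homog (T : IsTop ħ R N A B s p top) {a b : ℤ} {v : ι → ℂ}
    (hv : v ∈ wt A B a b) (h : (N : ℤ) - a - b < -N ∨ (N : ℤ) < N - a - b) : v = 0 := by
  funext i
  by_contra h0
  have := hv i h0
  have h1 := T.hA i
  have h2 := T.hB i
  omega

/-- The power of `Em3` from a weight space to its reflection is bijective, since both this power and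
that of `Ep3` in the opposite direction are injective. -/
lemma map_Em3_pow (T : IsTop ħ R N A B s p top) (hε : ε = 1 ∨ ε = -1) (r : ℕ) {a b : ℤ}
    (h : a + b = p + s + r) :
    (generated R top ⊓ wt A B (s + (a - r)) (b - r)).map ((Em3 ħ ε R).mulVecLin ^ r)
      = generated R top ⊓ wt A B (s + a) b := by
  have G := T.graded
  have hq : Admissible ħ 1 := T.adm.mono (by omega)
  have hN := T.hN
  have hcomm : ∀ w : ℤ, ∀ v ∈ homog A B (fun a b => N - a - b) w,
      (Ep3 ħ ε R).mulVecLin ((Em3 ħ ε R).mulVecLin v)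
        = (Em3 ħ ε R).mulVecLin ((Ep3 ħ ε R).mulVecLin v) + qNum ħ w • v := by
    rintro w v ⟨a, b, hv, rfl⟩
    have := G.Ep3_Em3 hq hε hv
    push_cast
    exact this
  have hE : ∀ w : ℤ, ∀ v ∈ homog A B (fun a b => N - a - b) w,
      (Ep3 ħ ε R).mulVecLin v ∈ homog A B (fun a b => N - a - b) (w + 2) := by
    rintro w v ⟨a, b, hv, rfl⟩
    exact ⟨_, _, G.Ep3_mem hv, by beta_reduce; ring⟩
  have hF : ∀ w : ℤ, ∀ v ∈ homog A B (fun a b => N - a - b) w,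
      (Em3 ħ ε R).mulVecLin v ∈ homog A B (fun a b => N - a - b) (w - 2) := by
    rintro w v ⟨a, b, hv, rfl⟩
    exact ⟨_, _, G.Em3_mem hv, by beta_reduce; ring⟩
  refine map_eq_of_injective_of_injective (g := (Ep3 ħ ε R).mulVecLin ^ r) ?_ ?_ ?_ ?_
  · rintro _ ⟨v, hv, rfl⟩
    rw [mulVecLin_pow_apply]
    refine ⟨pow_mulVec_mem (Em3_mem_generated R top) r hv.1, ?_⟩
    have := G.Em3_pow_mem (ε := ε) r hv.2
    rwa [show (s : ℤ) + (a - r) + r = s + a by ring, show b - r + r = b by ring] at this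
  · rintro _ ⟨v, hv, rfl⟩
    rw [mulVecLin_pow_apply]
    refine ⟨pow_mulVec_mem (Ep3_mem_generated R top) r hv.1, ?_⟩
    have := G.Ep3_pow_mem (ε := ε) r hv.2
    rwa [show (s : ℤ) + a - r = s + (a - r) by ring] at this
  · rintro v hv h0
    refine eq_zero_of_lowering_pow_eq_zero T.adm (Ep3 ħ ε R).mulVecLin (Em3 ħ ε R).mulVecLin
      (homog A B fun a b => N - a - b) hE hcomm hF ?_ r r le_rfl v
      ⟨_, _, hv.2, by beta_reduce; omega⟩ h0
    rintro w hw v ⟨a, b, hv, rfl⟩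
    exact T.eq_zero_of_homog hv (Or.inr (by push_cast at hw; omega))
  · rintro v hv h0
    -- the opposite pair, with opposite weights
    refine eq_zero_of_lowering_pow_eq_zero T.adm (Em3 ħ ε R).mulVecLin (Ep3 ħ ε R).mulVecLin
      (fun w => homog A B (fun a b => N - a - b) (-w)) ?_ ?_ ?_ ?_ r r le_rfl v
      ⟨_, _, hv.2, by beta_reduce; omega⟩ h0
    · intro w v hv
      have := hF _ v hv
      rwa [show -w - 2 = -(w + 2) by ring] at this
    · intro w v hv
      have e : qNum ħ ((-w : ℤ) : ℚ) = - qNum ħ w := by rw [Int.cast_neg, qNum_neg]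
      rw [hcomm _ v hv, e]
      module
    · intro w v hv
      have := hE _ v hv
      rwa [show -w + 2 = -(w - 2) by ring] at this
    · rintro w hw v ⟨a, b, hv, hab⟩
      exact T.eq_zero_of_homog hv (Or.inl (by beta_reduce at hab; push_cast at hw; omega))

/-- The weight spaces are spanned by the states `Em3 ^ j (cornerState x y)` with
`x + y + j ≤ p + s`: below the middle, `Em3` maps weight spaces onto their reflections. -/
theorem wt_eq_span (T : IsTop ħ R N A B s p top) (hε : ε = 1 ∨ ε = -1) (a b : ℤ) :
    generated R top ⊓ wt A B (s + a) b = Submodule.span ℂ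
      {v | ∃ x y j : ℕ, ((x : ℤ) + j = a ∧ (y : ℤ) + j = b) ∧ (x ≤ p ∧ y ≤ s ∧ x + y + j ≤ p + s)
        ∧ v = (Em3 ħ ε R ^ j).mulVec (cornerState R top x y)} := by
  have G := T.graded
  refine le_antisymm ?_ (Submodule.span_le.2 ?_)
  · by_cases h : a + b ≤ p + s
    · refine (T.wt_le_span hε a b).trans (Submodule.span_mono ?_)
      rintro _ ⟨x, y, j, hx, hy, hxp, hys, rfl⟩
      exact ⟨x, y, j, ⟨hx, hy⟩, ⟨hxp, hys, by omega⟩, rfl⟩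
    · obtain ⟨r, hr⟩ := Int.eq_ofNat_of_zero_le (show 0 ≤ a + b - (p + s) by omega)
      rw [← T.map_Em3_pow hε r (show a + b = p + s + r by omega)]
      refine (Submodule.map_mono (T.wt_le_span hε _ _)).trans ?_
      rw [Submodule.map_span]
      refine Submodule.span_mono ?_
      rintro _ ⟨_, ⟨x, y, j, hx, hy, hxp, hys, rfl⟩, rfl⟩
      refine ⟨x, y, r + j, ⟨by push_cast; omega, by push_cast; omega⟩, ⟨hxp, hys, by omega⟩, ?_⟩
      rw [mulVecLin_pow_apply, pow_mulVec_pow]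
  · rintro _ ⟨x, y, j, ⟨hx, hy⟩, -, rfl⟩
    refine ⟨pow_mulVec_mem (Em3_mem_generated R top) j (cornerState_mem_generated R top x y), ?_⟩
    have := G.Em3_pow_mem (ε := ε) j (G.cornerState_mem_wt T.mem x y)
    rwa [show (s : ℤ) + x + j = s + a by omega, show 0 + (y : ℤ) + j = b by omega] at this

end IsTop

section Tensor

variable {n₁ n₂ : ℕ}

/-- The powers of the lowering operators in `IsTop` vanish on `topState` because they give singular
vectors of weights at which there is no `topState`. -/
lemma isTop_topState (hM : Admissible ħ (n₁ + n₂ + 1)) {s : ℕ} (hs : s ≤ min n₁ n₂) :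
    IsTop ħ (tensorRep ħ n₁ n₂) (n₁ + n₂) totA totB s (n₁ + n₂ - 2 * s) (topState ħ n₁ n₂ s) := by
  have hq : Admissible ħ 1 := hM.mono (by omega)
  have G := isGraded_tensorRep hq n₁ n₂
  have ht := topState_mem_wt ħ n₁ n₂ s
  refine ⟨G, hM, by omega, fun p => ?_, fun p => ?_, ht, Ep_topState hM hs, ?_, ?_⟩
  · have := p.1.A_le; have := p.2.A_le; simp only [totA]; omega
  · have := p.1.A_le; have := p.2.A_le; have := p.1.B_le_A; have := p.2.B_le_A
    simp only [totB]; omega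
  · refine singular_eq_zero_of_wt hM (fun i => ?_) (G.Em_pow_zero_mem _ ht) (by omega)
    fin_cases i
    · refine (G.Ep_Em_pow_zero hq _ ht).trans ?_
      have : ((n₁ + n₂ : ℕ) : ℚ) - 2 * ((s : ℤ) : ℚ) + ((0 : ℤ) : ℚ) - ((n₁ + n₂ - 2 * s : ℕ) : ℚ)
          = 0 := by
        push_cast [Nat.cast_sub (show 2 * s ≤ n₁ + n₂ by omega)]; ring
      rw [this, qNum_zero, Ep_topState hM hs]; simp
    · refine (G.Ep_Em_pow_of_ne (by decide) _ _).trans ?_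
      rw [Ep_topState hM hs, Matrix.mulVec_zero]
  · refine singular_eq_zero_of_wt hM (fun i => ?_) (G.Em_pow_one_mem _ ht) (by omega)
    fin_cases i
    · refine (G.Ep_Em_pow_of_ne (by decide) _ _).trans ?_
      rw [Ep_topState hM hs, Matrix.mulVec_zero]
    · refine (G.Ep_Em_pow_one hq _ ht).trans ?_
      have : ((s : ℤ) : ℚ) - 2 * ((0 : ℤ) : ℚ) - (s : ℚ) = 0 := by push_cast; ring
      rw [this, qNum_zero, Ep_topState hM hs]; simp

end Tensor

end

section

/-! ### Counting: the spanning states form a basis -/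

lemma sum_range_sub (Q : ℚ) (b : ℕ) :
    ∑ y ∈ Finset.range b, (Q - y) = b * (2 * Q - b + 1) / 2 := by
  induction b with
  | zero => simp
  | succ b ih => rw [Finset.sum_range_succ, ih]; push_cast; ring

lemma sum_range_sum_range_sub (Q : ℚ) (a b : ℕ) :
    ∑ x ∈ Finset.range a, ∑ y ∈ Finset.range b, (Q - x - y)
      = a * b * (2 * Q - a - b + 2) / 2 := by
  induction a with
  | zero => simp
  | succ a ih => rw [Finset.sum_range_succ, ih, sum_range_sub]; push_cast; ring

lemma sum_range_dim (N : ℚ) (k : ℕ) :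
    ∑ s ∈ Finset.range k, (N - 2 * s + 1) * (s + 1) * (N - s + 2) / 2
      = k * (k + 1) * (N - k + 2) * (N - k + 3) / 4 := by
  induction k with
  | zero => simp
  | succ k ih => rw [Finset.sum_range_succ, ih]; push_cast; ring

/-- The labels `(s, x, y, j)` of the states `Em3 ^ j (cornerState x y)` of the summands. -/
def wordIndex (n₁ n₂ : ℕ) : Finset ((_ : ℕ) × (_ : ℕ) × (_ : ℕ) × ℕ) :=
  (Finset.range (min n₁ n₂ + 1)).sigma fun s =>
    (Finset.range (n₁ + n₂ - 2 * s + 1)).sigma fun x =>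
      (Finset.range (s + 1)).sigma fun y => Finset.range (n₁ + n₂ - 2 * s + s + 1 - x - y)

/-- The number of labels is the dimension of the tensor product. -/
lemma card_wordIndex (n₁ n₂ : ℕ) : ((wordIndex n₁ n₂).card : ℚ)
    = ((n₁ : ℚ) + 1) * (n₁ + 2) / 2 * ((n₂ + 1) * (n₂ + 2) / 2) := by
  have h : ∀ s ∈ Finset.range (min n₁ n₂ + 1),
      ∑ x ∈ Finset.range (n₁ + n₂ - 2 * s + 1), ∑ y ∈ Finset.range (s + 1),
        ((n₁ + n₂ - 2 * s + s + 1 - x - y : ℕ) : ℚ)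
      = (((n₁ : ℚ) + n₂) - 2 * s + 1) * (s + 1) * ((n₁ + n₂) - s + 2) / 2 := by
    intro s hs
    have hs := Finset.mem_range.1 hs
    obtain ⟨p, hp⟩ := Nat.exists_eq_add_of_le (show 2 * s ≤ n₁ + n₂ by omega)
    have hp' : (n₁ : ℚ) + n₂ = 2 * s + p := by exact_mod_cast hp
    rw [show n₁ + n₂ - 2 * s = p by omega, hp']
    have : ∀ x ∈ Finset.range (p + 1), ∑ y ∈ Finset.range (s + 1), ((p + s + 1 - x - y : ℕ) : ℚ)
        = ∑ y ∈ Finset.range (s + 1), (((p : ℚ) + s + 1) - x - y) := by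
      intro x hx
      refine Finset.sum_congr rfl fun y hy => ?_
      have hx := Finset.mem_range.1 hx
      have hy := Finset.mem_range.1 hy
      rw [Nat.cast_sub (by omega), Nat.cast_sub (by omega)]
      push_cast; ring
    rw [Finset.sum_congr rfl this, sum_range_sum_range_sub]
    push_cast; ring
  simp only [wordIndex, Finset.card_sigma, Finset.card_range]
  push_cast only [Nat.cast_sum]
  rw [Finset.sum_congr rfl h, sum_range_dim]
  rcases le_total n₁ n₂ with h | h
  · rw [min_eq_left h]; push_cast; ring
  · rw [min_eq_right h]; push_cast; ring

lemma card_symIdx (n : ℕ) : (Fintype.card (SymIdx n) : ℚ) = ((n : ℚ) + 1) * (n + 2) / 2 := by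
  have : Fintype.card (SymIdx n) = ∑ i : Fin (n + 1), ((i : ℕ) + 1) := by
    rw [Fintype.card_subtype, Finset.card_filter, Fintype.sum_prod_type]
    refine Finset.sum_congr rfl fun i _ => ?_
    rw [← Finset.card_filter, ← Fin.card_Iic i]
    congr 1
    ext j; simp
  rw [this, Fin.sum_univ_eq_sum_range (fun i => i + 1)]
  clear this
  induction n with
  | zero => simp
  | succ n ih => rw [Finset.sum_range_succ, Nat.cast_add, ih]; push_cast; ring

variable {ħ : ℂ} {ε : ℤ} {n₁ n₂ : ℕ}

/-- The state with label `(s, x, y, j)`. -/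
def word (ħ : ℂ) (ε : ℤ) (n₁ n₂ : ℕ) (t : (_ : ℕ) × (_ : ℕ) × (_ : ℕ) × ℕ) :
    SymIdx n₁ × SymIdx n₂ → ℂ :=
  (Em3 ħ ε (tensorRep ħ n₁ n₂) ^ t.2.2.2).mulVec
    (cornerState (tensorRep ħ n₁ n₂) (topState ħ n₁ n₂ t.1) t.2.1 t.2.2.1)

lemma mem_wordIndex {s x y j : ℕ} : (⟨s, x, y, j⟩ : (_ : ℕ) × (_ : ℕ) × (_ : ℕ) × ℕ)
    ∈ wordIndex n₁ n₂ ↔ s ≤ min n₁ n₂ ∧ x ≤ n₁ + n₂ - 2 * s ∧ y ≤ s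
      ∧ x + y + j ≤ n₁ + n₂ - 2 * s + s := by
  simp only [wordIndex, Finset.mem_sigma, Finset.mem_range]
  omega

lemma top_le_span_word (hM : Admissible ħ (n₁ + n₂ + 1)) (hε : ε = 1 ∨ ε = -1) :
    ⊤ ≤ Submodule.span ℂ (Set.range fun t : wordIndex n₁ n₂ => word ħ ε n₁ n₂ t) := by
  rw [← (isInternal_summand hM).submodule_iSup_eq_top]
  refine iSup_le fun s v hv => ?_
  have hs : (s : ℕ) ≤ min n₁ n₂ := by omega
  have T := isTop_topState hM hs
  refine mem_of_wtProj_mem (A := totA) (B := totB) fun a b => ?_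
  have h1 : wtProj totA totB a b v ∈ generated (tensorRep ħ n₁ n₂) (topState ħ n₁ n₂ s)
      ⊓ wt totA totB ((s : ℕ) + ((a : ℤ) - (s : ℕ))) b :=
    ⟨T.wtProj_mem hv a b, by rw [add_sub_cancel]; exact wtProj_mem _ _ _ _ _⟩
  rw [T.wt_eq_span hε] at h1
  refine Submodule.span_mono ?_ h1
  rintro _ ⟨x, y, j, -, h, rfl⟩
  exact ⟨⟨⟨s, x, y, j⟩, mem_wordIndex.2 ⟨hs, h⟩⟩, rfl⟩

/-- The states span the tensor product and their number is its dimension. -/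
theorem linearIndependent_word (hM : Admissible ħ (n₁ + n₂ + 1)) (hε : ε = 1 ∨ ε = -1) :
    LinearIndependent ℂ (fun t : wordIndex n₁ n₂ => word ħ ε n₁ n₂ t) := by
  refine linearIndependent_of_top_le_span_of_card_eq_finrank (top_le_span_word hM hε) ?_
  rw [Module.finrank_fintype_fun_eq_card, Fintype.card_coe, Fintype.card_prod]
  have := card_wordIndex n₁ n₂
  rw [← card_symIdx, ← card_symIdx] at this
  exact_mod_cast this

/-- The multiplicity of the weight `Λ - A α₁ - B α₂` in the irreducible representation of highest
weight `Λ = p μ₁ + s μ₂`. -/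
def weightMult (p s A B : ℕ) : ℕ :=
  min (min (min A B + 1) (p + min A B + 1 - A)) (min (s + min A B + 1 - B) (p + s + 1 - max A B))

/-- The label of `colorState` number `c`: the power of `Em3` decreases from `min A B` to `0`. -/
lemma colorState_eq_word (s A B c : ℕ) :
    colorState ħ ε n₁ n₂ s A B c
      = word ħ ε n₁ n₂ ⟨s, A - min A B + c, B - min A B + c, min A B - c⟩ := by
  simp only [colorState, word, cornerState, lowered]
  by_cases h : B ≤ A
  · rw [if_pos h, min_eq_right h, if_pos (by omega), show B - B + c = c by omega,
      show A - B + c - c = A - B by omega, ← Matrix.mulVec_mulVec, ← Matrix.mulVec_mulVec]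
  · rw [if_neg h, min_eq_left (by omega), if_neg (by omega), show A - A + c = c by omega,
      ← Matrix.mulVec_mulVec, ← Matrix.mulVec_mulVec, pow_mulVec_pow]

theorem linearIndependent_colorState (hM : Admissible ħ (n₁ + n₂ + 1)) (hε : ε = 1 ∨ ε = -1)
    {s : ℕ} (hs : s ≤ min n₁ n₂) (A B : ℕ) :
    LinearIndependent ℂ (fun c : Fin (weightMult (n₁ + n₂ - 2 * s) s A B) =>
      colorState ħ ε n₁ n₂ s A B c) := by
  let f : Fin (weightMult (n₁ + n₂ - 2 * s) s A B) → wordIndex n₁ n₂ := fun c =>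
    ⟨⟨s, A - min A B + c, B - min A B + c, min A B - c⟩, mem_wordIndex.2 (by
      have := c.2; simp only [weightMult] at this; omega)⟩
  have hf : Function.Injective f := by
    intro c d h
    simp only [f, Subtype.mk.injEq, Sigma.mk.injEq, heq_eq_eq] at h
    exact Fin.ext (by omega)
  have e : (fun c : Fin (weightMult (n₁ + n₂ - 2 * s) s A B) => colorState ħ ε n₁ n₂ s A B c)
      = (fun t : wordIndex n₁ n₂ => word ħ ε n₁ n₂ t) ∘ f :=
    funext fun c => colorState_eq_word _ _ _ _
  rw [e]
  exact (linearIndependent_word hM hε).comp f hf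

theorem span_colorState (hM : Admissible ħ (n₁ + n₂ + 1)) (hε : ε = 1 ∨ ε = -1)
    {s : ℕ} (hs : s ≤ min n₁ n₂) (A B : ℕ) :
    Submodule.span ℂ (Set.range (fun c : Fin (weightMult (n₁ + n₂ - 2 * s) s A B) =>
      colorState ħ ε n₁ n₂ s A B c))
      = weightSpace (tensorRep ħ n₁ n₂) (summand ħ n₁ n₂ s) (n₁ + n₂ - 2 * s) s A B := by
  rw [weightSpace_eq (hM.mono (by omega)) hs, summand, Nat.cast_add,
    (isTop_topState hM hs).wt_eq_span hε]
  congr 1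
  ext v
  constructor
  · rintro ⟨c, rfl⟩
    have hc := c.2
    simp only [weightMult] at hc
    beta_reduce
    rw [colorState_eq_word]
    refine ⟨A - min A B + c, B - min A B + c, min A B - c, ?_, ?_, rfl⟩ <;> omega
  · rintro ⟨x, y, j, ⟨hx, hy⟩, h, rfl⟩
    refine ⟨⟨min A B - j, by simp only [weightMult]; omega⟩, ?_⟩
    beta_reduce
    rw [colorState_eq_word, word]
    simp only
    congr 2 <;> omega

/-- In particular the multiplicity does not depend on `ħ`. -/
theorem multiplicity_eq (hM : Admissible ħ (n₁ + n₂ + 1)) {s : ℕ} (hs : s ≤ min n₁ n₂)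
    (A B : ℕ) : multiplicity ħ n₁ n₂ s A B = weightMult (n₁ + n₂ - 2 * s) s A B := by
  rw [multiplicity, ← span_colorState hM (Or.inl rfl) hs,
    finrank_span_eq_card (linearIndependent_colorState hM (Or.inl rfl) hs A B), Fintype.card_fin]

end

section

/-! ### Gram–Schmidt for a bilinear pairing -/

section GramSchmidt

variable {ι : Type} [Fintype ι] [DecidableEq ι]

/-- The Gram matrix of the first `k` vectors of a sequence. -/
def gram (v : ℕ → ι → ℂ) (k : ℕ) : Matrix (Fin k) (Fin k) ℂ :=
  Matrix.of fun c d => pairing (v c) (v d)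

lemma gram_mulVec (v : ℕ → ι → ℂ) (k : ℕ) (x : Fin k → ℂ) (c : Fin k) :
    (gram v k).mulVec x c = pairing (v c) (∑ d, x d • v d) := by
  rw [pairing_sum_right, Matrix.mulVec, dotProduct]
  refine Finset.sum_congr rfl fun d _ => ?_
  rw [pairing_smul_right, mul_comm]; rfl

lemma linearIndependent_of_det_gram_ne_zero {v : ℕ → ι → ℂ} {k : ℕ} (h : (gram v k).det ≠ 0) :
    LinearIndependent ℂ (fun c : Fin k => v c) := by
  rw [Fintype.linearIndependent_iff]
  intro x hx
  refine congrFun (Matrix.eq_zero_of_mulVec_eq_zero h (funext fun c => ?_))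
  rw [gram_mulVec, hx, pairing_zero_right]; rfl

lemma range_fin_eq_image (v : ℕ → ι → ℂ) (k : ℕ) :
    Set.range (fun c : Fin k => v c) = v '' Set.Iio k := by
  ext w
  constructor
  · rintro ⟨c, rfl⟩; exact ⟨c, c.2, rfl⟩
  · rintro ⟨c, hc, rfl⟩; exact ⟨⟨c, hc⟩, rfl⟩

lemma Iio_succ_eq_insert (k : ℕ) : Set.Iio (k + 1) = insert k (Set.Iio k) := by
  ext c; simp only [Set.mem_Iio, Set.mem_insert_iff]; omega

lemma gramSchmidt_sub_mem (v : ℕ → ι → ℂ) (c : ℕ) :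
    v c - gramSchmidt v c ∈ Submodule.span ℂ (gramSchmidt v '' Set.Iio c) := by
  rw [gramSchmidt, sub_sub_cancel]
  exact Submodule.sum_mem _ fun d _ => Submodule.smul_mem _ _
    (Submodule.subset_span ⟨d, d.2, rfl⟩)

lemma span_gramSchmidt (v : ℕ → ι → ℂ) (k : ℕ) :
    Submodule.span ℂ (gramSchmidt v '' Set.Iio k) = Submodule.span ℂ (v '' Set.Iio k) := by
  induction k with
  | zero => simp
  | succ k ih =>
    have h := gramSchmidt_sub_mem v k
    rw [Iio_succ_eq_insert, Set.image_insert_eq, Set.image_insert_eq, Submodule.span_insert,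
      Submodule.span_insert, ← ih]
    refine le_antisymm (sup_le ?_ le_sup_right) (sup_le ?_ le_sup_right)
    · rw [Submodule.span_singleton_le_iff_mem]
      rw [← sub_sub_cancel (v k) (gramSchmidt v k)]
      exact Submodule.sub_mem _ (Submodule.mem_sup_left (Submodule.mem_span_singleton_self _))
        (Submodule.mem_sup_right h)
    · rw [Submodule.span_singleton_le_iff_mem]
      rw [← sub_add_cancel (v k) (gramSchmidt v k)]
      exact Submodule.add_mem _ (Submodule.mem_sup_right h)
        (Submodule.mem_sup_left (Submodule.mem_span_singleton_self _))

/-- If the leading Gram determinants do not vanish, the Gram–Schmidt vectors are orthogonal and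
not isotropic: an isotropic one would be orthogonal to the span of the vectors before it and
itself, on which the pairing is nondegenerate. -/
theorem pairing_gramSchmidt {v : ℕ → ι → ℂ} {n : ℕ} (h : ∀ k ≤ n, (gram v k).det ≠ 0) (c : ℕ)
    (hc : c < n) : pairing (gramSchmidt v c) (gramSchmidt v c) ≠ 0 ∧
      ∀ d < c, pairing (gramSchmidt v d) (gramSchmidt v c) = 0 := by
  induction c using Nat.strong_induction_on with
  | _ c ih =>
    have horth : ∀ d < c, pairing (gramSchmidt v d) (gramSchmidt v c) = 0 := by
      intro d hd
      rw [gramSchmidt.eq_1 v c, pairing_sub_right, pairing_sum_right,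
        Finset.sum_eq_single_of_mem (⟨d, hd⟩ : Fin c) (Finset.mem_univ _)]
      · rw [pairing_smul_right, div_mul_cancel₀ _ (ih d hd (hd.trans hc)).1, sub_self]
      · intro e _ hne
        rw [pairing_smul_right]
        rcases lt_trichotomy (e : ℕ) d with hed | hed | hed
        · rw [pairing_comm (gramSchmidt v d), (ih d hd (hd.trans hc)).2 e hed, mul_zero]
        · exact absurd (Fin.ext hed) hne
        · rw [(ih e e.2 (e.2.trans hc)).2 d hed, mul_zero]
    refine ⟨fun h0 => ?_, horth⟩
    have hdet := h (c + 1) (by omega)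
    have hperp : ∀ w ∈ Submodule.span ℂ (v '' Set.Iio (c + 1)),
        pairing w (gramSchmidt v c) = 0 := by
      intro w hw
      rw [← span_gramSchmidt] at hw
      induction hw using Submodule.span_induction with
      | mem u hu =>
        obtain ⟨d, hd, rfl⟩ := hu
        rcases Nat.lt_succ_iff_lt_or_eq.1 hd with hd | rfl
        · exact horth d hd
        · exact h0
      | zero => exact pairing_zero_left _
      | add x y _ _ hx hy => rw [pairing_add_left, hx, hy, add_zero]
      | smul a x _ hx => rw [pairing_smul_left, hx, mul_zero]
    have hmem : gramSchmidt v c ∈ Submodule.span ℂ (Set.range fun d : Fin (c + 1) => v d) := by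
      rw [range_fin_eq_image, ← span_gramSchmidt]
      exact Submodule.subset_span ⟨c, Nat.lt_succ_self c, rfl⟩
    obtain ⟨x, hx⟩ := (Submodule.mem_span_range_iff_exists_fun ℂ).1 hmem
    have hx0 : x = 0 := Matrix.eq_zero_of_mulVec_eq_zero hdet (funext fun d => by
      rw [gram_mulVec, hx]
      exact hperp _ (Submodule.subset_span ⟨d, d.2, rfl⟩))
    have hzero : gramSchmidt v c = 0 := by rw [← hx, hx0]; simp
    have hli := linearIndependent_of_det_gram_ne_zero hdet
    rw [linearIndependent_finSucc'] at hli
    refine hli.2 ?_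
    have e : Set.range (Fin.init fun d : Fin (c + 1) => v d) = v '' Set.Iio c := by
      rw [← range_fin_eq_image]; rfl
    rw [e, ← span_gramSchmidt]
    have := gramSchmidt_sub_mem v c
    rw [hzero, sub_zero] at this
    simpa using this

lemma pairing_normalized (u w : ι → ℂ) : pairing (normalized u) (normalized w)
    = (pairing u u ^ (1 / 2 : ℂ))⁻¹ * ((pairing w w ^ (1 / 2 : ℂ))⁻¹ * pairing u w) := by
  rw [normalized, normalized, pairing_smul_left, pairing_smul_right]

theorem pairing_gramSchmidtNormed {v : ℕ → ι → ℂ} {n : ℕ} (h : ∀ k ≤ n, (gram v k).det ≠ 0)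
    (c d : Fin n) :
    pairing (gramSchmidtNormed v c) (gramSchmidtNormed v d) = if c = d then 1 else 0 := by
  rw [gramSchmidtNormed, gramSchmidtNormed, pairing_normalized]
  split_ifs with hcd
  · subst hcd
    have h0 := (pairing_gramSchmidt h c c.2).1
    set g := pairing (gramSchmidt v c) (gramSchmidt v c)
    have h1 : g ^ (1 / 2 : ℂ) * g ^ (1 / 2 : ℂ) = g := by
      rw [← Complex.cpow_add _ _ h0]; norm_num
    have h2 : g ^ (1 / 2 : ℂ) ≠ 0 := fun h2 => h0 (by rw [← h1, h2, mul_zero])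
    nth_rewrite 3 [← h1]
    field_simp
  · rcases lt_or_gt_of_ne (fun h => hcd (Fin.ext h) : (c : ℕ) ≠ d) with hlt | hlt
    · rw [(pairing_gramSchmidt h d d.2).2 c hlt, mul_zero, mul_zero]
    · rw [pairing_comm (gramSchmidt v c) (gramSchmidt v d), (pairing_gramSchmidt h c c.2).2 d hlt,
        mul_zero, mul_zero]

theorem span_gramSchmidtNormed {v : ℕ → ι → ℂ} {n : ℕ} (h : ∀ k ≤ n, (gram v k).det ≠ 0) :
    Submodule.span ℂ (Set.range fun c : Fin n => gramSchmidtNormed v c)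
      = Submodule.span ℂ (Set.range fun c : Fin n => v c) := by
  rw [range_fin_eq_image v, ← span_gramSchmidt, ← range_fin_eq_image]
  refine le_antisymm (Submodule.span_le.2 ?_) (Submodule.span_le.2 ?_)
  · rintro _ ⟨c, rfl⟩
    exact Submodule.smul_mem _ _ (Submodule.subset_span ⟨c, rfl⟩)
  · rintro _ ⟨c, rfl⟩
    have h0 := (pairing_gramSchmidt h c c.2).1
    refine (Submodule.smul_mem_iff _ (s := (pairing (gramSchmidt v c) (gramSchmidt v c)
      ^ (1 / 2 : ℂ))⁻¹) ?_).1 (Submodule.subset_span ⟨c, rfl⟩)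
    rw [ne_eq, inv_eq_zero, Complex.cpow_eq_zero_iff]
    exact fun h => h0 h.1

open scoped ComplexOrder in
/-- Linearly independent vectors with real coordinates have a nonzero Gram determinant. -/
theorem det_gram_ne_zero_of_star_eq {v : ℕ → ι → ℂ} {k : ℕ}
    (hli : LinearIndependent ℂ (fun c : Fin k => v c)) (hv : ∀ c < k, star (v c) = v c) :
    (gram v k).det ≠ 0 := by
  intro h0
  obtain ⟨x, hx0, hx⟩ := Matrix.exists_mulVec_eq_zero_iff.2 h0
  set w := ∑ d : Fin k, x d • v d with hw
  have h1 : pairing (star w) w = 0 := by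
    rw [hw, star_sum, pairing_sum_left]
    refine Finset.sum_eq_zero fun c _ => ?_
    rw [star_smul, hv c c.2, pairing_smul_left, ← gram_mulVec, hx]
    simp
  have h2 : w = 0 := dotProduct_star_self_eq_zero.1 h1
  exact hx0 (funext (Fintype.linearIndependent_iff.1 hli x h2))

end GramSchmidt

end

section

/-! ### Laurent polynomials in `q ^ (1/2)` -/

/-- `f` is a Laurent polynomial in `q ^ (1/2) = exp (ħ / 2)` at all `ħ` with `Admissible ħ M`. -/
def IsLaurent (M : ℕ) (f : ℂ → ℂ) : Prop :=
  ∃ (P : Polynomial ℂ) (n : ℕ), ∀ ħ, Admissible ħ M →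
    f ħ * Complex.exp (ħ / 2) ^ n = P.eval (Complex.exp (ħ / 2))

namespace IsLaurent

variable {M : ℕ} {f g : ℂ → ℂ}

lemma congr (hf : IsLaurent M f) (h : ∀ ħ, Admissible ħ M → g ħ = f ħ) : IsLaurent M g := by
  obtain ⟨P, n, hP⟩ := hf
  exact ⟨P, n, fun ħ hM => by rw [h ħ hM, hP ħ hM]⟩

lemma const (c : ℂ) : IsLaurent M fun _ => c := ⟨Polynomial.C c, 0, fun ħ _ => by simp⟩

lemma add (hf : IsLaurent M f) (hg : IsLaurent M g) : IsLaurent M fun ħ => f ħ + g ħ := by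
  obtain ⟨P, n, hP⟩ := hf
  obtain ⟨Q, m, hQ⟩ := hg
  refine ⟨P * Polynomial.X ^ m + Q * Polynomial.X ^ n, n + m, fun ħ hM => ?_⟩
  simp only [Polynomial.eval_add, Polynomial.eval_mul, Polynomial.eval_pow, Polynomial.eval_X,
    ← hP ħ hM, ← hQ ħ hM]
  ring

lemma mul (hf : IsLaurent M f) (hg : IsLaurent M g) : IsLaurent M fun ħ => f ħ * g ħ := by
  obtain ⟨P, n, hP⟩ := hf
  obtain ⟨Q, m, hQ⟩ := hg
  refine ⟨P * Q, n + m, fun ħ hM => ?_⟩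
  simp only [Polynomial.eval_mul, ← hP ħ hM, ← hQ ħ hM]
  ring

lemma neg (hf : IsLaurent M f) : IsLaurent M fun ħ => - f ħ :=
  ((const (-1)).mul hf).congr fun ħ _ => by ring

lemma sum {α : Type*} (s : Finset α) {F : α → ℂ → ℂ} (h : ∀ a ∈ s, IsLaurent M (F a)) :
    IsLaurent M fun ħ => ∑ a ∈ s, F a ħ := by
  classical
  induction s using Finset.induction_on with
  | empty => simpa using const 0
  | insert a s ha ih =>
    refine ((h a (Finset.mem_insert_self a s)).add
      (ih fun b hb => h b (Finset.mem_insert_of_mem hb))).congr fun ħ _ => ?_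
    rw [Finset.sum_insert ha]

lemma prod {α : Type*} (s : Finset α) {F : α → ℂ → ℂ} (h : ∀ a ∈ s, IsLaurent M (F a)) :
    IsLaurent M fun ħ => ∏ a ∈ s, F a ħ := by
  classical
  induction s using Finset.induction_on with
  | empty => simpa using const 1
  | insert a s ha ih =>
    refine ((h a (Finset.mem_insert_self a s)).mul
      (ih fun b hb => h b (Finset.mem_insert_of_mem hb))).congr fun ħ _ => ?_
    rw [Finset.prod_insert ha]

lemma det {k : ℕ} {F : ℂ → Matrix (Fin k) (Fin k) ℂ} (h : ∀ c d, IsLaurent M fun ħ => F ħ c d) :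
    IsLaurent M fun ħ => (F ħ).det := by
  simp only [Matrix.det_apply']
  exact sum _ fun σ _ => (const _).mul (prod _ fun c _ => h _ _)

lemma qPow_half (k : ℤ) : IsLaurent M fun ħ => qPow ħ ((k : ℚ) / 2) := by
  have e : ∀ ħ, qPow ħ ((k : ℚ) / 2) = Complex.exp (ħ / 2) ^ k := by
    intro ħ
    rw [← Complex.exp_int_mul, qPow]
    congr 1; push_cast; ring
  simp only [e]
  obtain ⟨m, rfl | rfl⟩ := Int.eq_nat_or_neg k
  · exact ⟨Polynomial.X ^ m, 0, fun ħ _ => by simp⟩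
  · refine ⟨1, m, fun ħ _ => ?_⟩
    beta_reduce
    rw [zpow_neg, zpow_natCast, inv_mul_cancel₀ (pow_ne_zero _ (Complex.exp_ne_zero _))]
    simp

lemma qNum_int (hM : 1 ≤ M) (k : ℤ) : IsLaurent M fun ħ => qNum ħ k := by
  have nat : ∀ m : ℕ, IsLaurent M fun ħ => qNum ħ m := by
    intro m
    induction m with
    | zero => simpa [qNum_zero] using const 0
    | succ m ih =>
      refine (((qPow_half (-1)).mul ih).add (qPow_half m)).congr fun ħ hħ => ?_
      rw [Nat.cast_succ, qNum_add, qNum_one (hħ.mono hM)]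
      push_cast; ring
  obtain ⟨m, rfl | rfl⟩ := Int.eq_nat_or_neg k
  · simpa using nat m
  · simpa [qNum_neg] using (nat m).neg

end IsLaurent

/-- At a real `ħ ≠ 0` the parameter `q` is not a root of unity. -/
lemma admissible_of_real {r : ℝ} (hr : r ≠ 0) (M : ℕ) : Admissible (r : ℂ) M := by
  intro m h1 _ h
  have h2 : Real.exp (r * m) = 1 := by
    have : ((Real.exp (r * m) : ℝ) : ℂ) = 1 := by push_cast; exact h
    exact_mod_cast this
  rw [Real.exp_eq_one_iff] at h2
  rcases mul_eq_zero.1 h2 with h2 | h2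
  · exact hr h2
  · have : m = 0 := by exact_mod_cast h2
    omega

/-- A Laurent polynomial which does not vanish for real `ħ ≠ 0` vanishes only at finitely many
values of `q ^ (1/2)`, none of them a positive real number other than `1`. -/
lemma IsLaurent.exists_finset {M : ℕ} {f : ℂ → ℂ} (hf : IsLaurent M f)
    (h : ∀ r : ℝ, r ≠ 0 → f r ≠ 0) :
    ∃ S : Finset ℂ, (∀ x : ℝ, 0 < x → x ≠ 1 → (x : ℂ) ∉ S) ∧
      ∀ ħ, Admissible ħ M → Complex.exp (ħ / 2) ∉ S → f ħ ≠ 0 := by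
  obtain ⟨P, n, hP⟩ := hf
  have hreal : ∀ x : ℝ, 0 < x → x ≠ 1 → P.eval (x : ℂ) ≠ 0 := by
    intro x hx hx1
    have hr : 2 * Real.log x ≠ 0 :=
      mul_ne_zero two_ne_zero (Real.log_ne_zero_of_pos_of_ne_one hx hx1)
    have he : Complex.exp (((2 * Real.log x : ℝ) : ℂ) / 2) = x := by
      have : ((2 * Real.log x : ℝ) : ℂ) / 2 = (Real.log x : ℝ) := by push_cast; ring
      rw [this, ← Complex.ofReal_exp, Real.exp_log hx]
    have := hP _ (admissible_of_real hr M)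
    rw [he] at this
    rw [← this]
    exact mul_ne_zero (h _ hr) (pow_ne_zero _ (by exact_mod_cast hx.ne'))
  have hP0 : P ≠ 0 := by
    rintro rfl
    exact hreal 2 (by norm_num) (by norm_num) (by simp)
  refine ⟨P.roots.toFinset, fun x hx hx1 hmem => ?_, fun ħ hM hmem h0 => hmem ?_⟩
  · rw [Multiset.mem_toFinset, Polynomial.mem_roots hP0] at hmem
    exact hreal x hx hx1 hmem
  · rw [Multiset.mem_toFinset, Polynomial.mem_roots hP0]
    change P.eval _ = 0
    rw [← hP ħ hM, h0, zero_mul]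

/-! ### Families of lowered states -/

section Families

variable {n₁ n₂ s : ℕ}

/-- Families of vectors of weight `(a, b)` obtained from `topState` by lowering operators and
linear combinations with Laurent polynomials as coefficients. The coordinates of these vectors
involve square roots of q-numbers, but their pairings do not. -/
inductive IsLoweredFamily (n₁ n₂ s : ℕ) :
    ℤ → ℤ → (ℂ → SymIdx n₁ × SymIdx n₂ → ℂ) → Prop
  | top : IsLoweredFamily n₁ n₂ s s 0 fun ħ => topState ħ n₁ n₂ s
  | zero (a b : ℤ) : IsLoweredFamily n₁ n₂ s a b fun _ => 0
  | Em_zero {a b : ℤ} {u} : IsLoweredFamily n₁ n₂ s a b u →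
      IsLoweredFamily n₁ n₂ s (a + 1) b fun ħ => ((tensorRep ħ n₁ n₂).Em 0).mulVec (u ħ)
  | Em_one {a b : ℤ} {u} : IsLoweredFamily n₁ n₂ s a b u →
      IsLoweredFamily n₁ n₂ s a (b + 1) fun ħ => ((tensorRep ħ n₁ n₂).Em 1).mulVec (u ħ)
  | add {a b : ℤ} {u w} : IsLoweredFamily n₁ n₂ s a b u → IsLoweredFamily n₁ n₂ s a b w →
      IsLoweredFamily n₁ n₂ s a b fun ħ => u ħ + w ħ
  | smul {a b : ℤ} {c : ℂ → ℂ} {u} : IsLaurent (n₁ + n₂ + 1) c → IsLoweredFamily n₁ n₂ s a b u →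
      IsLoweredFamily n₁ n₂ s a b fun ħ => c ħ • u ħ

namespace IsLoweredFamily

variable {a b : ℤ} {u w : ℂ → SymIdx n₁ × SymIdx n₂ → ℂ}

lemma of_eq (h : IsLoweredFamily n₁ n₂ s a b u) {a' b' : ℤ} (ha : a = a') (hb : b = b') :
    IsLoweredFamily n₁ n₂ s a' b' u := ha ▸ hb ▸ h

lemma mem_wt (h : IsLoweredFamily n₁ n₂ s a b u) {ħ : ℂ} (hM : Admissible ħ (n₁ + n₂ + 1)) :
    u ħ ∈ wt totA totB a b := by
  have G := isGraded_tensorRep (hM.mono (show 1 ≤ _ by omega)) n₁ n₂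
  induction h with
  | top => exact topState_mem_wt _ _ _ _
  | zero => exact Submodule.zero_mem _
  | Em_zero _ ih => exact G.Em_zero_mem ih
  | Em_one _ ih => exact G.Em_one_mem ih
  | add _ _ ih ih' => exact Submodule.add_mem _ ih ih'
  | smul _ _ ih => exact Submodule.smul_mem _ _ ih

/-- Raising operators map lowered families to lowered families: moving `Ep 0` past the lowering
operators produces only q-numbers of integers. -/
lemma exists_Ep_zero (hs : s ≤ min n₁ n₂) (h : IsLoweredFamily n₁ n₂ s a b u) :
    ∃ w, IsLoweredFamily n₁ n₂ s (a - 1) b w ∧ ∀ ħ, Admissible ħ (n₁ + n₂ + 1) →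
      ((tensorRep ħ n₁ n₂).Ep 0).mulVec (u ħ) = w ħ := by
  have G := fun (ħ : ℂ) (hM : Admissible ħ (n₁ + n₂ + 1)) =>
    isGraded_tensorRep (hM.mono (show 1 ≤ _ by omega)) n₁ n₂
  induction h with
  | top => exact ⟨_, zero _ _, fun ħ hM => Ep_topState hM hs 0⟩
  | zero => exact ⟨_, zero _ _, fun ħ hM => Matrix.mulVec_zero _⟩
  | @Em_zero a b u hu ih =>
    obtain ⟨w, hw, he⟩ := ih
    refine ⟨_, (hw.Em_zero.of_eq (by ring) rfl).add ((hu.smul (IsLaurent.qNum_int (by omega)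
      (((n₁ + n₂ : ℕ) : ℤ) - 2 * a + b))).of_eq (by ring) rfl), fun ħ hM => ?_⟩
    rw [(G ħ hM).Ep_Em_zero (hu.mem_wt hM), he ħ hM]
    push_cast; rfl
  | @Em_one a b u hu ih =>
    obtain ⟨w, hw, he⟩ := ih
    exact ⟨_, hw.Em_one, fun ħ hM => by rw [(G ħ hM).Ep_Em_of_ne zero_ne_one, he ħ hM]⟩
  | add _ _ ih ih' =>
    obtain ⟨w, hw, he⟩ := ih
    obtain ⟨w', hw', he'⟩ := ih'
    exact ⟨_, hw.add hw', fun ħ hM => by rw [Matrix.mulVec_add, he ħ hM, he' ħ hM]⟩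
  | smul hc _ ih =>
    obtain ⟨w, hw, he⟩ := ih
    exact ⟨_, hw.smul hc, fun ħ hM => by rw [Matrix.mulVec_smul, he ħ hM]⟩

/-- The analogue of `exists_Ep_zero` for `Ep 1`. -/
lemma exists_Ep_one (hs : s ≤ min n₁ n₂) (h : IsLoweredFamily n₁ n₂ s a b u) :
    ∃ w, IsLoweredFamily n₁ n₂ s a (b - 1) w ∧ ∀ ħ, Admissible ħ (n₁ + n₂ + 1) →
      ((tensorRep ħ n₁ n₂).Ep 1).mulVec (u ħ) = w ħ := by
  have G := fun (ħ : ℂ) (hM : Admissible ħ (n₁ + n₂ + 1)) =>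
    isGraded_tensorRep (hM.mono (show 1 ≤ _ by omega)) n₁ n₂
  induction h with
  | top => exact ⟨_, zero _ _, fun ħ hM => Ep_topState hM hs 1⟩
  | zero => exact ⟨_, zero _ _, fun ħ hM => Matrix.mulVec_zero _⟩
  | @Em_one a b u hu ih =>
    obtain ⟨w, hw, he⟩ := ih
    refine ⟨_, (hw.Em_one.of_eq rfl (by ring)).add ((hu.smul (IsLaurent.qNum_int (by omega)
      (a - 2 * b))).of_eq rfl (by ring)), fun ħ hM => ?_⟩
    rw [(G ħ hM).Ep_Em_one (hu.mem_wt hM), he ħ hM]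
    push_cast; rfl
  | @Em_zero a b u hu ih =>
    obtain ⟨w, hw, he⟩ := ih
    exact ⟨_, hw.Em_zero, fun ħ hM => by rw [(G ħ hM).Ep_Em_of_ne one_ne_zero, he ħ hM]⟩
  | add _ _ ih ih' =>
    obtain ⟨w, hw, he⟩ := ih
    obtain ⟨w', hw', he'⟩ := ih'
    exact ⟨_, hw.add hw', fun ħ hM => by rw [Matrix.mulVec_add, he ħ hM, he' ħ hM]⟩
  | smul hc _ ih =>
    obtain ⟨w, hw, he⟩ := ih
    exact ⟨_, hw.smul hc, fun ħ hM => by rw [Matrix.mulVec_smul, he ħ hM]⟩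

lemma isLaurent_pairing_top (hs : s ≤ min n₁ n₂) (h : IsLoweredFamily n₁ n₂ s a b u) :
    IsLaurent (n₁ + n₂ + 1) fun ħ => pairing (u ħ) (topState ħ n₁ n₂ s) := by
  have lower : ∀ (i : Fin 2) (u : ℂ → SymIdx n₁ × SymIdx n₂ → ℂ), IsLaurent (n₁ + n₂ + 1)
      fun ħ => pairing (((tensorRep ħ n₁ n₂).Em i).mulVec (u ħ)) (topState ħ n₁ n₂ s) :=
    fun i u => (IsLaurent.const 0).congr fun ħ hM => by
      rw [(isGraded_tensorRep (hM.mono (show 1 ≤ _ by omega)) n₁ n₂).pairing_Em,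
        Ep_topState hM hs, pairing_zero_right]
  induction h with
  | top => exact (IsLaurent.const 1).congr fun ħ hM => pairing_topState_self hM hs
  | zero => exact (IsLaurent.const 0).congr fun ħ hM => pairing_zero_left _
  | Em_zero _ _ => exact lower 0 _
  | Em_one _ _ => exact lower 1 _
  | add _ _ ih ih' => exact (ih.add ih').congr fun ħ _ => pairing_add_left _ _ _
  | smul hc _ ih => exact (hc.mul ih).congr fun ħ _ => pairing_smul_left _ _ _

/-- The pairing of two such families is a Laurent polynomial: lowering operators on one side are
moved to the other side as raising operators. -/
theorem isLaurent_pairing (hs : s ≤ min n₁ n₂) (h : IsLoweredFamily n₁ n₂ s a b u) {a' b' : ℤ}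
    (hw : IsLoweredFamily n₁ n₂ s a' b' w) :
    IsLaurent (n₁ + n₂ + 1) fun ħ => pairing (u ħ) (w ħ) := by
  induction h generalizing w a' b' with
  | top => exact (hw.isLaurent_pairing_top hs).congr fun ħ _ => pairing_comm _ _
  | zero => exact (IsLaurent.const 0).congr fun ħ hM => pairing_zero_left _
  | Em_zero _ ih =>
    obtain ⟨w', hw', he⟩ := hw.exists_Ep_zero hs
    exact (ih hw').congr fun ħ hM => by
      rw [(isGraded_tensorRep (hM.mono (show 1 ≤ _ by omega)) n₁ n₂).pairing_Em, he ħ hM]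
  | Em_one _ ih =>
    obtain ⟨w', hw', he⟩ := hw.exists_Ep_one hs
    exact (ih hw').congr fun ħ hM => by
      rw [(isGraded_tensorRep (hM.mono (show 1 ≤ _ by omega)) n₁ n₂).pairing_Em, he ħ hM]
  | add _ _ ih ih' => exact ((ih hw).add (ih' hw)).congr fun ħ _ => pairing_add_left _ _ _
  | smul hc _ ih => exact (hc.mul (ih hw)).congr fun ħ _ => pairing_smul_left _ _ _

lemma Em_pow_zero (h : IsLoweredFamily n₁ n₂ s a b u) (l : ℕ) :
    IsLoweredFamily n₁ n₂ s (a + l) b fun ħ => ((tensorRep ħ n₁ n₂).Em 0 ^ l).mulVec (u ħ) := by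
  induction l with
  | zero => simpa using h
  | succ l ih =>
    simp only [pow_succ_mulVec]
    convert ih.Em_zero using 1; push_cast; ring

lemma Em_pow_one (h : IsLoweredFamily n₁ n₂ s a b u) (l : ℕ) :
    IsLoweredFamily n₁ n₂ s a (b + l) fun ħ => ((tensorRep ħ n₁ n₂).Em 1 ^ l).mulVec (u ħ) := by
  induction l with
  | zero => simpa using h
  | succ l ih =>
    simp only [pow_succ_mulVec]
    convert ih.Em_one using 1; push_cast; ring

lemma Em3_pow (h : IsLoweredFamily n₁ n₂ s a b u) (ε : ℤ) (l : ℕ) :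
    IsLoweredFamily n₁ n₂ s (a + l) (b + l)
      fun ħ => (Em3 ħ ε (tensorRep ħ n₁ n₂) ^ l).mulVec (u ħ) := by
  induction l with
  | zero => simpa using h
  | succ l ih =>
    simp only [pow_succ_mulVec, IsGraded.Em3_mulVec]
    have h1 := ih.Em_zero.Em_one.add
      (ih.Em_one.Em_zero.smul (IsLaurent.qPow_half (M := n₁ + n₂ + 1) ε).neg)
    simp only [neg_smul, ← sub_eq_add_neg] at h1
    convert h1 using 1 <;> push_cast <;> ring

lemma lowered (n₁ n₂ s l₁ l₂ : ℕ) :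
    IsLoweredFamily n₁ n₂ s (s + l₁) (0 + l₂) fun ħ => lowered ħ n₁ n₂ s l₁ l₂ := by
  simp only [QuantumSl3.lowered, ← Matrix.mulVec_mulVec]
  exact (top.Em_pow_zero l₁).Em_pow_one l₂

lemma exists_colorState (ε : ℤ) (n₁ n₂ s A B c : ℕ) :
    ∃ a b, IsLoweredFamily n₁ n₂ s a b fun ħ => colorState ħ ε n₁ n₂ s A B c := by
  by_cases h : B ≤ A
  · simp only [colorState, if_pos h, ← Matrix.mulVec_mulVec]
    exact ⟨_, _, ((lowered n₁ n₂ s c c).Em_pow_zero _).Em3_pow ε _⟩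
  · simp only [colorState, if_neg h, ← Matrix.mulVec_mulVec]
    exact ⟨_, _, ((lowered n₁ n₂ s c c).Em_pow_one _).Em3_pow ε _⟩

end IsLoweredFamily

end Families

end

section

/-! ### Reality of the states at real `ħ` -/

section Real

variable {r : ℝ} {n₁ n₂ : ℕ}

lemma star_qPow (r : ℝ) (x : ℚ) : star (qPow r x) = qPow r x := by
  rw [qPow, Complex.star_def, ← Complex.exp_conj]
  simp

/-- At real `ħ` the q-number of `x ≥ 0` is a nonnegative real number. For `ħ = 0` this is the junk
value `0 / 0 = 0`. -/
lemma star_qSqrt (r : ℝ) {x : ℚ} (hx : 0 ≤ x) : star (qSqrt r x) = qSqrt r x := by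
  have hx' : (0 : ℝ) ≤ x := by exact_mod_cast hx
  set y : ℝ := (Real.exp (r * (x / 2)) - Real.exp (r * (-x / 2)))
    / (Real.exp (r * (1 / 2)) - Real.exp (r * (-1 / 2))) with hy
  have h1 : qNum r x = (y : ℂ) := by
    rw [hy, qNum]; simp only [qPow]; push_cast; rfl
  have h2 : 0 ≤ y := by
    rcases le_total 0 r with hr | hr
    · refine div_nonneg (sub_nonneg.2 (Real.exp_le_exp.2 ?_)) (sub_nonneg.2 (Real.exp_le_exp.2 ?_))
      · nlinarith [mul_nonneg hr hx']
      · nlinarith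
    · refine div_nonneg_of_nonpos (sub_nonpos.2 (Real.exp_le_exp.2 ?_))
        (sub_nonpos.2 (Real.exp_le_exp.2 ?_))
      · nlinarith [mul_nonneg (neg_nonneg.2 hr) hx']
      · nlinarith
  have h3 : qSqrt r x = ((y ^ (1 / 2 : ℝ) : ℝ) : ℂ) := by
    rw [qSqrt, h1, Complex.ofReal_cpow h2]; push_cast; rfl
  rw [h3, Complex.star_def, Complex.conj_ofReal]

lemma star_sfac (r : ℝ) (m : ℕ) : star (sfac r m) = sfac r m := by
  rw [sfac, star_prod]
  exact Finset.prod_congr rfl fun i _ => star_qSqrt r (by positivity)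

lemma star_tket (A₁ B₁ A₂ B₂ : ℤ) : star (tket n₁ n₂ A₁ B₁ A₂ B₂) = tket n₁ n₂ A₁ B₁ A₂ B₂ := by
  funext p
  rw [Pi.star_apply, tket_apply]
  split_ifs <;> simp

lemma star_mulVec_of_star_apply {ι : Type} [Fintype ι] {M : Matrix ι ι ℂ}
    (h : ∀ p q, star (M p q) = M p q) (v : ι → ℂ) : star (M.mulVec v) = M.mulVec (star v) := by
  funext p
  simp only [Pi.star_apply, Matrix.mulVec, dotProduct, star_sum, star_mul', h]

lemma star_Em_mulVec (r : ℝ) (i : Fin 2) (v : SymIdx n₁ × SymIdx n₂ → ℂ) :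
    star (((tensorRep (r : ℂ) n₁ n₂).Em i).mulVec v)
      = ((tensorRep (r : ℂ) n₁ n₂).Em i).mulVec (star v) := by
  refine star_mulVec_of_star_apply (fun p q => ?_) v
  have h : ∀ p, (tensorRep (r : ℂ) n₁ n₂).Em i p q
      = ((tensorRep (r : ℂ) n₁ n₂).Em i).mulVec (tket n₁ n₂ q.1.A q.1.B q.2.A q.2.B) p := by
    intro p; rw [tket_eq_single, Matrix.mulVec_single_one]; rfl
  have hA₁ : ((q.1.A : ℕ) : ℚ) ≤ n₁ := by exact_mod_cast q.1.A_le
  have hA₂ : ((q.2.A : ℕ) : ℚ) ≤ n₂ := by exact_mod_cast q.2.A_le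
  have hB₁ : ((q.1.B : ℕ) : ℚ) ≤ q.1.A := by exact_mod_cast q.1.B_le_A
  have hB₂ : ((q.2.B : ℕ) : ℚ) ≤ q.2.A := by exact_mod_cast q.2.B_le_A
  have h0 : ∀ m : ℕ, (0 : ℚ) ≤ m := fun m => Nat.cast_nonneg m
  rw [h, ← Pi.star_apply]
  refine congrFun ?_ p
  fin_cases i
  · have e := tensorRep_Em_zero_tket (ħ := r) (n₁ := n₁) (n₂ := n₂) q.1.A q.1.B q.2.A q.2.B
    refine (congrArg star e).trans (Eq.trans ?_ e.symm)
    simp only [star_add, star_smul, star_mul', star_qPow, star_tket, Int.cast_natCast]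
    rw [star_qSqrt r (by linarith), star_qSqrt r (by linarith), star_qSqrt r (by linarith),
      star_qSqrt r (by linarith)]
  · have e := tensorRep_Em_one_tket (ħ := r) (n₁ := n₁) (n₂ := n₂) q.1.A q.1.B q.2.A q.2.B
    refine (congrArg star e).trans (Eq.trans ?_ e.symm)
    simp only [star_add, star_smul, star_mul', star_qPow, star_tket, Int.cast_natCast]
    rw [star_qSqrt r (by linarith), star_qSqrt r (by linarith [h0 q.1.B]),
      star_qSqrt r (by linarith), star_qSqrt r (by linarith [h0 q.2.B])]

lemma star_Em3_mulVec (r : ℝ) (ε : ℤ) (v : SymIdx n₁ × SymIdx n₂ → ℂ) :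
    star ((Em3 (r : ℂ) ε (tensorRep (r : ℂ) n₁ n₂)).mulVec v)
      = (Em3 (r : ℂ) ε (tensorRep (r : ℂ) n₁ n₂)).mulVec (star v) := by
  simp only [IsGraded.Em3_mulVec, star_sub, star_smul, star_Em_mulVec, star_qPow]

lemma star_pow_mulVec {ι : Type} [Fintype ι] [DecidableEq ι] {M : Matrix ι ι ℂ}
    (h : ∀ v, star (M.mulVec v) = M.mulVec (star v)) (l : ℕ) (v : ι → ℂ) :
    star ((M ^ l).mulVec v) = (M ^ l).mulVec (star v) := by
  induction l with
  | zero => simp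
  | succ l ih => rw [pow_succ_mulVec, h, ih, pow_succ_mulVec]

lemma star_topState (hr : r ≠ 0) {s : ℕ} (hs : s ≤ min n₁ n₂) :
    star (topState (r : ℂ) n₁ n₂ s) = topState (r : ℂ) n₁ n₂ s := by
  funext p
  rw [Pi.star_apply, topState]
  split_ifs with h
  · obtain ⟨a, ha⟩ := Nat.exists_eq_add_of_le (show s ≤ n₁ by omega)
    obtain ⟨b, hb⟩ := Nat.exists_eq_add_of_le (show s ≤ n₂ by omega)
    have c := topCG_eq (ħ := r) (a := a) (b := b) (k₁ := p.1.A) (k₂ := p.2.A)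
      (admissible_of_real hr _)
    rw [h.2.2, show a + s = n₁ by omega, show b + s = n₂ by omega] at c
    rw [c]
    simp only [star_mul', star_div₀, star_pow, star_neg, star_one, star_qPow, star_sfac]
  · exact star_zero _

lemma star_lowered (hr : r ≠ 0) {s : ℕ} (hs : s ≤ min n₁ n₂) (l₁ l₂ : ℕ) :
    star (lowered (r : ℂ) n₁ n₂ s l₁ l₂) = lowered (r : ℂ) n₁ n₂ s l₁ l₂ := by
  rw [lowered, ← Matrix.mulVec_mulVec, star_pow_mulVec (star_Em_mulVec r 1),
    star_pow_mulVec (star_Em_mulVec r 0), star_topState hr hs]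

lemma star_colorState (hr : r ≠ 0) {s : ℕ} (hs : s ≤ min n₁ n₂) (ε : ℤ) (A B c : ℕ) :
    star (colorState (r : ℂ) ε n₁ n₂ s A B c) = colorState (r : ℂ) ε n₁ n₂ s A B c := by
  by_cases h : B ≤ A
  · simp only [colorState, if_pos h, ← Matrix.mulVec_mulVec,
      star_pow_mulVec (star_Em3_mulVec r ε), star_pow_mulVec (star_Em_mulVec r 0),
      star_lowered hr hs]
  · simp only [colorState, if_neg h, ← Matrix.mulVec_mulVec,
      star_pow_mulVec (star_Em3_mulVec r ε), star_pow_mulVec (star_Em_mulVec r 1),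
      star_lowered hr hs]

end Real

/-! ### The pairs of states of weight `Λ - l α₃` -/

section Pairs

variable {ħ : ℂ} {ε : ℤ} {n₁ n₂ : ℕ}

/-- `pairStates` before normalisation. -/
def pairWord (ħ : ℂ) (ε : ℤ) (n₁ n₂ s l : ℕ) : ℕ → SymIdx n₁ × SymIdx n₂ → ℂ
  | 0 => (Em3 ħ ε (tensorRep ħ n₁ n₂) ^ l).mulVec (topState ħ n₁ n₂ s)
  | _ => lowered ħ n₁ n₂ s l l

section Graded

variable {ι : Type} [Fintype ι] [DecidableEq ι] {R : Ops ι} {N : ℕ} {A B : ι → ℕ}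

lemma IsGraded.exists_Em_zero_Em3_pow (G : IsGraded ħ R N A B) (hq : Admissible ħ 1)
    (hε : ε = 1 ∨ ε = -1) (l : ℕ) (v : ι → ℂ) :
    ∃ c : ℂ, (R.Em 0).mulVec ((Em3 ħ ε R ^ l).mulVec v)
      = c • (Em3 ħ ε R ^ l).mulVec ((R.Em 0).mulVec v) := by
  induction l with
  | zero => exact ⟨1, by simp⟩
  | succ l ih =>
    obtain ⟨c, hc⟩ := ih
    refine ⟨qPow ħ ((ε : ℚ) / 2) * c, ?_⟩
    rw [pow_succ_mulVec, G.Em_zero_Em3 hq hε, hc, Matrix.mulVec_smul, smul_smul, pow_succ_mulVec]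

lemma IsGraded.exists_Em_one_Em3_pow (G : IsGraded ħ R N A B) (hq : Admissible ħ 1)
    (hε : ε = 1 ∨ ε = -1) (l : ℕ) (v : ι → ℂ) :
    ∃ c : ℂ, (R.Em 1).mulVec ((Em3 ħ ε R ^ l).mulVec v)
      = c • (Em3 ħ ε R ^ l).mulVec ((R.Em 1).mulVec v) := by
  induction l with
  | zero => exact ⟨1, by simp⟩
  | succ l ih =>
    obtain ⟨c, hc⟩ := ih
    refine ⟨qPow ħ (-(ε : ℚ) / 2) * c, ?_⟩
    rw [pow_succ_mulVec, G.Em_one_Em3 hq hε, hc, Matrix.mulVec_smul, smul_smul, pow_succ_mulVec]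

/-- Raising a power of `Em3` on a highest weight vector gives a state with one more `Em 0`. -/
lemma IsGraded.exists_Ep_one_Em3_pow (G : IsGraded ħ R N A B) (hq : Admissible ħ 1)
    (hε : ε = 1 ∨ ε = -1) {a b : ℤ} {v : ι → ℂ} (hv : v ∈ wt A B a b)
    (h0 : (R.Ep 1).mulVec v = 0) (l : ℕ) :
    ∃ c : ℂ, (R.Ep 1).mulVec ((Em3 ħ ε R ^ (l + 1)).mulVec v)
      = c • (Em3 ħ ε R ^ l).mulVec ((R.Em 0).mulVec v) := by
  induction l with
  | zero =>
    refine ⟨qPow ħ (-ε * ((a : ℚ) - 2 * b) / 2), ?_⟩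
    rw [zero_add, pow_one, G.Ep_one_Em3 hq hε hv, h0, Matrix.mulVec_zero, zero_add, pow_zero,
      Matrix.one_mulVec]
  | succ l ih =>
    obtain ⟨c, hc⟩ := ih
    obtain ⟨d, hd⟩ := G.exists_Em_zero_Em3_pow hq hε (l + 1) v
    refine ⟨c + qPow ħ (-ε * (((a + (l + 1 : ℕ) : ℤ) : ℚ) - 2 * ((b + (l + 1 : ℕ) : ℤ) : ℚ)) / 2)
      * d, ?_⟩
    rw [pow_succ_mulVec, G.Ep_one_Em3 hq hε (G.Em3_pow_mem (l + 1) hv), hc, hd,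
      Matrix.mulVec_smul, ← pow_succ_mulVec, smul_smul, ← add_smul]

end Graded

lemma lowered_ne_zero (hM : Admissible ħ (n₁ + n₂ + 1)) {s l₁ l₂ : ℕ} (hs : s ≤ min n₁ n₂)
    (h₁ : l₁ ≤ n₁ + n₂ - 2 * s) (h₂ : l₂ ≤ s + l₁) : lowered ħ n₁ n₂ s l₁ l₂ ≠ 0 := by
  intro h
  have := pairing_lowered hM hs h₁ h₂
  rw [h, pairing_zero_left, eq_comm] at this
  have n : ∀ m : ℕ, m ≤ n₁ + n₂ + 1 → qfac ħ m ≠ 0 := fun m hm => qfac_ne_zero hM hm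
  exact mul_ne_zero
    (div_ne_zero (mul_ne_zero (n _ (by omega)) (n _ (by omega))) (n _ (by omega)))
    (div_ne_zero (mul_ne_zero (n _ (by omega)) (n _ (by omega))) (n _ (by omega))) this

/-- If the two states were proportional, applying `Em 1 * Ep 1` would give a linear relation
between the first two states `colorState` of weight `Λ - l α₃`. -/
theorem linearIndependent_pairWord (hM : Admissible ħ (n₁ + n₂ + 1)) (hε : ε = 1 ∨ ε = -1)
    {s l : ℕ} (hs : s ≤ min n₁ n₂) (hs1 : 1 ≤ s) (hl1 : 1 ≤ l) (hl : l ≤ n₁ + n₂ - 2 * s) :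
    LinearIndependent ℂ (fun c : Fin 2 => pairWord ħ ε n₁ n₂ s l c) := by
  have hq : Admissible ħ 1 := hM.mono (by omega)
  have G := isGraded_tensorRep hq n₁ n₂
  have ht := topState_mem_wt ħ n₁ n₂ s
  obtain ⟨m, rfl⟩ := Nat.exists_eq_add_of_le' hl1
  have hli : LinearIndependent ℂ (fun c : Fin 2 => colorState ħ ε n₁ n₂ s (m + 1) (m + 1) c) :=
    (linearIndependent_colorState hM hε hs (m + 1) (m + 1)).comp
      (Fin.castLE (show 2 ≤ weightMult (n₁ + n₂ - 2 * s) s (m + 1) (m + 1) by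
        simp only [weightMult]; omega)) (Fin.castLE_injective _)
  rw [Fintype.linearIndependent_iff] at hli ⊢
  have c0 : colorState ħ ε n₁ n₂ s (m + 1) (m + 1) 0
      = (Em3 ħ ε (tensorRep ħ n₁ n₂) ^ (m + 1)).mulVec (topState ħ n₁ n₂ s) := by
    simp [colorState, lowered]
  have c1 : colorState ħ ε n₁ n₂ s (m + 1) (m + 1) 1
      = (Em3 ħ ε (tensorRep ħ n₁ n₂) ^ m).mulVec (lowered ħ n₁ n₂ s 1 1) := by
    simp [colorState]
  -- the action of `Em 1 * Ep 1` on the two states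
  obtain ⟨d, hd⟩ : ∃ d : ℂ, ((tensorRep ħ n₁ n₂).Em 1).mulVec (((tensorRep ħ n₁ n₂).Ep 1).mulVec
      (colorState ħ ε n₁ n₂ s (m + 1) (m + 1) 0))
      = d • colorState ħ ε n₁ n₂ s (m + 1) (m + 1) 1 := by
    obtain ⟨c, hc⟩ := G.exists_Ep_one_Em3_pow hq hε ht (Ep_topState hM hs 1) m
    obtain ⟨c', hc'⟩ := G.exists_Em_one_Em3_pow hq hε m
      (((tensorRep ħ n₁ n₂).Em 0).mulVec (topState ħ n₁ n₂ s))
    refine ⟨c * c', ?_⟩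
    rw [c0, c1, hc, Matrix.mulVec_smul, hc', smul_smul, lowered, pow_one, pow_one,
      ← Matrix.mulVec_mulVec]
  have hL : ((tensorRep ħ n₁ n₂).Em 1).mulVec (((tensorRep ħ n₁ n₂).Ep 1).mulVec
      (lowered ħ n₁ n₂ s (m + 1) (m + 1)))
      = (qNum ħ ((m + 1 : ℕ) : ℚ) * qNum ħ ((s + 1 : ℕ) : ℚ)) • lowered ħ n₁ n₂ s (m + 1) (m + 1) := by
    rw [lowered, ← Matrix.mulVec_mulVec, G.Ep_Em_pow_one hq m (G.Em_pow_zero_mem (m + 1) ht),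
      G.Ep_Em_pow_of_ne one_ne_zero, Ep_topState hM hs, Matrix.mulVec_zero, Matrix.mulVec_zero,
      zero_add, Matrix.mulVec_smul, ← pow_succ_mulVec]
    congr 3
    · push_cast; ring
    · push_cast; ring
  intro g hg
  rw [Fin.sum_univ_two] at hg
  change g 0 • (Em3 ħ ε (tensorRep ħ n₁ n₂) ^ (m + 1)).mulVec (topState ħ n₁ n₂ s)
    + g 1 • lowered ħ n₁ n₂ s (m + 1) (m + 1) = 0 at hg
  rw [← c0] at hg
  have h1 := congrArg (fun v => ((tensorRep ħ n₁ n₂).Em 1).mulVec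
    (((tensorRep ħ n₁ n₂).Ep 1).mulVec v)) hg
  simp only [Matrix.mulVec_add, Matrix.mulVec_smul, hd, hL, Matrix.mulVec_zero] at h1
  set k := qNum ħ ((m + 1 : ℕ) : ℚ) * qNum ħ ((s + 1 : ℕ) : ℚ)
  have hk : k ≠ 0 := mul_ne_zero (qNum_ne_zero hM (by omega) (by omega))
    (qNum_ne_zero hM (by omega) (by omega))
  have h2 := hli ![-(k * g 0), g 0 * d] (by
    rw [Fin.sum_univ_two]
    change (-(k * g 0)) • colorState ħ ε n₁ n₂ s (m + 1) (m + 1) 0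
      + (g 0 * d) • colorState ħ ε n₁ n₂ s (m + 1) (m + 1) 1 = 0
    linear_combination (norm := module) h1 - k • hg) 0
  have h3 : g 0 = 0 := by
    have : -(k * g 0) = 0 := h2
    exact (mul_eq_zero.1 (neg_eq_zero.1 this)).resolve_left hk
  have h4 : g 1 = 0 := by
    rw [h3, zero_smul, zero_add] at hg
    exact (smul_eq_zero.1 hg).resolve_right (lowered_ne_zero hM hs hl (by omega))
  intro c
  fin_cases c
  · exact h3
  · exact h4

lemma gram_smul {ι : Type} [Fintype ι] (a : ℕ → ℂ) (v : ℕ → ι → ℂ) (k : ℕ) :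
    gram (fun c => a c • v c) k
      = Matrix.diagonal (fun c : Fin k => a c) * gram v k * Matrix.diagonal (fun c : Fin k => a c) := by
  ext c d
  rw [Matrix.mul_diagonal, Matrix.diagonal_mul]
  simp only [gram, Matrix.of_apply, pairing_smul_left, pairing_smul_right]
  ring

/-- Normalising the states multiplies the Gram determinant by a nonzero number. -/
lemma det_gram_pairStates_ne_zero (hM : Admissible ħ (n₁ + n₂ + 1)) {s l : ℕ} (hs : s ≤ min n₁ n₂)
    (hl : l ≤ n₁ + n₂ - 2 * s) {k : ℕ} (h : (gram (pairWord ħ ε n₁ n₂ s l) k).det ≠ 0) :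
    (gram (pairStates ħ ε n₁ n₂ s l) k).det ≠ 0 := by
  set κ : ℂ := (-1 : ℂ) ^ s / (ladderH ħ 0 l (n₁ + n₂ - 2 * s) s 0 0
    * ladderH ħ 1 l (n₁ + n₂ - 2 * s) s l 0) with hκ
  have hκ0 : κ ≠ 0 := by
    have n : ∀ m : ℕ, m ≤ n₁ + n₂ + 1 → sfac ħ m ≠ 0 := fun m hm => sfac_ne_zero hM hm
    rw [hκ, ladderH_zero_eq ħ s hl, ladderH_one_eq ħ hl (by omega)]
    exact div_ne_zero (pow_ne_zero _ (by norm_num)) (mul_ne_zero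
      (div_ne_zero (mul_ne_zero (n _ (by omega)) (n _ (by omega))) (n _ (by omega)))
      (div_ne_zero (mul_ne_zero (n _ (by omega)) (n _ (by omega))) (n _ (by omega))))
  let a : ℕ → ℂ := fun c => if c = 0 then 1 else κ
  have e : pairStates ħ ε n₁ n₂ s l = fun c => a c • pairWord ħ ε n₁ n₂ s l c := by
    funext c
    cases c with
    | zero => simp [pairStates, pairWord, a]
    | succ c => simp only [pairStates, pairWord, a, if_neg (Nat.succ_ne_zero c), blackState, hκ]
  have ha : ∀ c, a c ≠ 0 := fun c => by simp only [a]; split_ifs <;> simp [hκ0]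
  rw [e, gram_smul, Matrix.det_mul, Matrix.det_mul, Matrix.det_diagonal]
  exact mul_ne_zero (mul_ne_zero (Finset.prod_ne_zero_iff.2 fun c _ => ha c) h)
    (Finset.prod_ne_zero_iff.2 fun c _ => ha c)

end Pairs

/-! ### The exceptional values of `q ^ (1/2)` -/

section Exceptional

variable {n₁ n₂ : ℕ}

lemma isLaurent_det_gram {s : ℕ} (hs : s ≤ min n₁ n₂) {v : ℂ → ℕ → SymIdx n₁ × SymIdx n₂ → ℂ}
    (h : ∀ c, ∃ a b, IsLoweredFamily n₁ n₂ s a b fun ħ => v ħ c) (k : ℕ) :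
    IsLaurent (n₁ + n₂ + 1) fun ħ => (gram (v ħ) k).det := by
  refine IsLaurent.det fun c d => ?_
  obtain ⟨a, b, hc⟩ := h c
  obtain ⟨a', b', hd⟩ := h d
  exact hc.isLaurent_pairing hs hd

/-- The exceptional set consists of the roots of a single Laurent polynomial, the product of all the
Gram determinants. -/
lemma exists_finset_colorState (n₁ n₂ : ℕ) :
    ∃ S : Finset ℂ, (∀ x : ℝ, 0 < x → x ≠ 1 → (x : ℂ) ∉ S) ∧
      ∀ ħ, Admissible ħ (n₁ + n₂ + 1) → Complex.exp (ħ / 2) ∉ S →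
        ∀ s ≤ min n₁ n₂, ∀ ε : ℤ, ε = 1 ∨ ε = -1 → ∀ A B : ℕ,
          ∀ k ≤ weightMult (n₁ + n₂ - 2 * s) s A B,
            (gram (colorState ħ ε n₁ n₂ s A B) k).det ≠ 0 := by
  let T := Finset.range (n₁ + n₂ + 1)
  have hL : IsLaurent (n₁ + n₂ + 1) fun ħ => ∏ s ∈ Finset.range (min n₁ n₂ + 1),
      ∏ ε ∈ ({1, -1} : Finset ℤ), ∏ A ∈ T, ∏ B ∈ T,
        ∏ k ∈ Finset.range (weightMult (n₁ + n₂ - 2 * s) s A B + 1),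
          (gram (colorState ħ ε n₁ n₂ s A B) k).det :=
    .prod _ fun s hs => .prod _ fun ε _ => .prod _ fun A _ => .prod _ fun B _ => .prod _ fun k _ =>
      isLaurent_det_gram (by have := Finset.mem_range.1 hs; omega)
        (fun c => IsLoweredFamily.exists_colorState ε n₁ n₂ s A B c) k
  obtain ⟨S, hS, h⟩ := hL.exists_finset fun r hr => by
    refine Finset.prod_ne_zero_iff.2 fun s hs => Finset.prod_ne_zero_iff.2 fun ε hε =>
      Finset.prod_ne_zero_iff.2 fun A _ => Finset.prod_ne_zero_iff.2 fun B _ =>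
      Finset.prod_ne_zero_iff.2 fun k hk => ?_
    have hs' : s ≤ min n₁ n₂ := by have := Finset.mem_range.1 hs; omega
    have hk' : k ≤ weightMult (n₁ + n₂ - 2 * s) s A B := by
      have := Finset.mem_range.1 hk; omega
    refine det_gram_ne_zero_of_star_eq ?_ fun c _ => star_colorState hr hs' ε A B c
    exact (linearIndependent_colorState (admissible_of_real hr _) (by simpa using hε) hs' A B).comp
      (Fin.castLE hk') (Fin.castLE_injective _)
  refine ⟨S, hS, fun ħ hM hmem s hs ε hε A B k hk => ?_⟩
  by_cases hAB : A < n₁ + n₂ + 1 ∧ B < n₁ + n₂ + 1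
  · have h1 := h ħ hM hmem
    have h2 := Finset.prod_ne_zero_iff.1 h1 s (Finset.mem_range.2 (by omega))
    have h3 := Finset.prod_ne_zero_iff.1 h2 ε (by simpa using hε)
    have h4 := Finset.prod_ne_zero_iff.1 h3 A (Finset.mem_range.2 hAB.1)
    have h5 := Finset.prod_ne_zero_iff.1 h4 B (Finset.mem_range.2 hAB.2)
    exact Finset.prod_ne_zero_iff.1 h5 k (Finset.mem_range.2 (by omega))
  -- there are no weights with `A` or `B` above `n₁ + n₂`: `weightMult` is `0` there
  · have hk0 : k = 0 := by simp only [weightMult] at hk; omega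
    subst hk0
    simp

/-- The analogue of `exists_finset_colorState` for `pairStates`. The product of the determinants is
formed with the unnormalised states, whose pairings are Laurent polynomials. -/
lemma exists_finset_pairStates (n₁ n₂ : ℕ) :
    ∃ S : Finset ℂ, (∀ x : ℝ, 0 < x → x ≠ 1 → (x : ℂ) ∉ S) ∧
      ∀ ħ, Admissible ħ (n₁ + n₂ + 1) → Complex.exp (ħ / 2) ∉ S →
        ∀ s ≤ min n₁ n₂, ∀ ε : ℤ, ε = 1 ∨ ε = -1 → ∀ l : ℕ, 1 ≤ s → 1 ≤ l →
          l ≤ n₁ + n₂ - 2 * s → ∀ k ≤ 2, (gram (pairStates ħ ε n₁ n₂ s l) k).det ≠ 0 := by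
  have hL : IsLaurent (n₁ + n₂ + 1) fun ħ => ∏ s ∈ Finset.Icc 1 (min n₁ n₂),
      ∏ ε ∈ ({1, -1} : Finset ℤ), ∏ l ∈ Finset.Icc 1 (n₁ + n₂ - 2 * s), ∏ k ∈ Finset.range 3,
        (gram (pairWord ħ ε n₁ n₂ s l) k).det :=
    .prod _ fun s hs => .prod _ fun ε _ => .prod _ fun l _ => .prod _ fun k _ =>
      isLaurent_det_gram (Finset.mem_Icc.1 hs).2 (fun c => by
        cases c with
        | zero => exact ⟨_, _, IsLoweredFamily.top.Em3_pow ε l⟩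
        | succ c => exact ⟨_, _, IsLoweredFamily.lowered n₁ n₂ s l l⟩) k
  obtain ⟨S, hS, h⟩ := hL.exists_finset fun r hr => by
    refine Finset.prod_ne_zero_iff.2 fun s hs => Finset.prod_ne_zero_iff.2 fun ε hε =>
      Finset.prod_ne_zero_iff.2 fun l hl => Finset.prod_ne_zero_iff.2 fun k hk => ?_
    have hs' := Finset.mem_Icc.1 hs
    have hl' := Finset.mem_Icc.1 hl
    have hk' : k ≤ 2 := by have := Finset.mem_range.1 hk; omega
    refine det_gram_ne_zero_of_star_eq ?_ fun c _ => ?_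
    · exact (linearIndependent_pairWord (admissible_of_real hr _) (by simpa using hε) hs'.2 hs'.1
        hl'.1 hl'.2).comp (Fin.castLE hk') (Fin.castLE_injective _)
    · cases c with
      | zero =>
        simp only [pairWord, star_pow_mulVec (star_Em3_mulVec r ε), star_topState hr hs'.2]
      | succ c => exact star_lowered hr hs'.2 l l
  refine ⟨S, hS, fun ħ hM hmem s hs ε hε l hs1 hl1 hl k hk => ?_⟩
  have h1 := h ħ hM hmem
  have h2 := Finset.prod_ne_zero_iff.1 h1 s (Finset.mem_Icc.2 ⟨hs1, hs⟩)
  have h3 := Finset.prod_ne_zero_iff.1 h2 ε (by simpa using hε)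
  have h4 := Finset.prod_ne_zero_iff.1 h3 l (Finset.mem_Icc.2 ⟨hl1, hl⟩)
  exact det_gram_pairStates_ne_zero hM hs hl
    (Finset.prod_ne_zero_iff.1 h4 k (Finset.mem_range.2 (by omega)))

end Exceptional

end

end QuantumSl3

end

open QuantumSl3 in
theorem mainTheorem1 (n₁ n₂ : ℕ) :
    -- for every `q = exp ħ` with `q ^ m ≠ 1` for `1 ≤ m ≤ n₁ + n₂ + 1`
    (∀ ħ : ℂ, (∀ m : ℕ, 1 ≤ m → m ≤ n₁ + n₂ + 1 → Complex.exp (ħ * m) ≠ 1) →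
      -- the symmetric representations
      (∀ n : ℕ, n = n₁ ∨ n = n₂ →
        IsRep ħ (symRep ħ n) ∧ IsIrreducibleSub (symRep ħ n) ⊤ ∧
        ∃ v, IsHighestWeight (symRep ħ n) n 0 v) ∧
      -- their tensor product is a direct sum of irreducibles of highest weights `(n₁+n₂-2s, s)`
      IsRep ħ (tensorRep ħ n₁ n₂) ∧
      DirectSum.IsInternal (fun s : Fin (min n₁ n₂ + 1) => summand ħ n₁ n₂ s) ∧
      ∀ s : ℕ, s ≤ min n₁ n₂ →
        IsIrreducibleSub (tensorRep ħ n₁ n₂) (summand ħ n₁ n₂ s) ∧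
        -- normalised highest weight vectors: the coefficients are those of `U_q(sl₂)`
        (∀ v : SymIdx n₁ × SymIdx n₂ → ℂ,
          (IsHighestWeight (tensorRep ħ n₁ n₂) (n₁ + n₂ - 2 * s) s v ∧ pairing v v = 1) ↔
            (v = topState ħ n₁ n₂ s ∨ v = -topState ħ n₁ n₂ s)) ∧
        -- the states reached by `(E⁻_{α₂})^{l₂} (E⁻_{α₁})^{l₁}`
        (∀ l₁ l₂ : ℕ, l₁ ≤ n₁ + n₂ - 2 * s → l₂ ≤ s + l₁ →
          pairing (blackState ħ n₁ n₂ s l₁ l₂) (blackState ħ n₁ n₂ s l₁ l₂) = 1 ∧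
          ∀ (p₁ : SymIdx n₁) (p₂ : SymIdx n₂),
            blackState ħ n₁ n₂ s l₁ l₂ (p₁, p₂) =
              blackCG ħ n₁ n₂ s l₁ l₂ p₁.A p₁.B p₂.A p₂.B) ∧
        -- the black, red, green, … states form a basis of every weight space
        (∀ ε : ℤ, ε = 1 ∨ ε = -1 → ∀ A B : ℕ,
          LinearIndependent ℂ
            (fun c : Fin (multiplicity ħ n₁ n₂ s A B) => colorState ħ ε n₁ n₂ s A B c) ∧
          Submodule.span ℂ (Set.range
            (fun c : Fin (multiplicity ħ n₁ n₂ s A B) => colorState ħ ε n₁ n₂ s A B c)) =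
            weightSpace (tensorRep ħ n₁ n₂) (summand ħ n₁ n₂ s) (n₁ + n₂ - 2 * s) s A B)) ∧
    -- Gram–Schmidt, for all but finitely many values of `q ^ (1/2)`, in particular for all
    -- positive real ones other than `1`
    (∃ S : Finset ℂ, (∀ x : ℝ, 0 < x → x ≠ 1 → (x : ℂ) ∉ S) ∧
      ∀ ħ : ℂ, (∀ m : ℕ, 1 ≤ m → m ≤ n₁ + n₂ + 1 → Complex.exp (ħ * m) ≠ 1) →
        Complex.exp (ħ / 2) ∉ S →
        ∀ s : ℕ, s ≤ min n₁ n₂ → ∀ ε : ℤ, ε = 1 ∨ ε = -1 →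
          (∀ A B : ℕ,
            (∀ c d : Fin (multiplicity ħ n₁ n₂ s A B),
              pairing (gramSchmidtNormed (colorState ħ ε n₁ n₂ s A B) c)
                (gramSchmidtNormed (colorState ħ ε n₁ n₂ s A B) d) = if c = d then 1 else 0) ∧
            Submodule.span ℂ (Set.range (fun c : Fin (multiplicity ħ n₁ n₂ s A B) =>
              gramSchmidtNormed (colorState ħ ε n₁ n₂ s A B) c)) =
              weightSpace (tensorRep ħ n₁ n₂) (summand ħ n₁ n₂ s) (n₁ + n₂ - 2 * s) s A B) ∧
          (∀ l : ℕ, 1 ≤ s → 1 ≤ l → l ≤ n₁ + n₂ - 2 * s →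
            LinearIndependent ℂ (fun c : Fin 2 => pairStates ħ ε n₁ n₂ s l c) ∧
            ∀ c d : Fin 2,
              pairing (gramSchmidtNormed (pairStates ħ ε n₁ n₂ s l) c)
                (gramSchmidtNormed (pairStates ħ ε n₁ n₂ s l) d) = if c = d then 1 else 0)) := by
  refine ⟨fun ħ hM => ⟨fun n hn => ?_, isRep_tensorRep (Admissible.mono hM (by omega)) n₁ n₂,
    isInternal_summand hM, fun s hs => ⟨isIrreducibleSub_summand hM hs,
      isHighestWeight_and_pairing_iff hM hs, fun l₁ l₂ h₁ h₂ =>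
        ⟨pairing_blackState hM hs h₁ h₂, blackState_apply hM hs h₁ h₂⟩, fun ε hε A B => ?_⟩⟩, ?_⟩
  · have hn' : Admissible ħ (n + 1) := Admissible.mono hM (by rcases hn with rfl | rfl <;> omega)
    exact ⟨isRep_symRep (hn'.mono (by omega)) n, isIrreducibleSub_symRep hn', ket n 0 0,
      isHighestWeight_symRep ħ n⟩
  · rw [multiplicity_eq hM hs]
    exact ⟨linearIndependent_colorState hM hε hs A B, span_colorState hM hε hs A B⟩
  · obtain ⟨S₁, hS₁, h₁⟩ := exists_finset_colorState n₁ n₂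
    obtain ⟨S₂, hS₂, h₂⟩ := exists_finset_pairStates n₁ n₂
    classical
    refine ⟨S₁ ∪ S₂, fun x hx hx1 hmem => ?_, fun ħ hM hmem s hs ε hε => ⟨fun A B => ?_,
      fun l hs1 hl1 hl => ?_⟩⟩
    · rcases Finset.mem_union.1 hmem with h | h
      · exact hS₁ x hx hx1 h
      · exact hS₂ x hx hx1 h
    · have hdet := h₁ ħ hM (fun h => hmem (Finset.mem_union_left _ h)) s hs ε hε A B
      rw [multiplicity_eq hM hs]
      exact ⟨pairing_gramSchmidtNormed hdet,
        (span_gramSchmidtNormed hdet).trans (span_colorState hM hε hs A B)⟩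
    · have hdet := h₂ ħ hM (fun h => hmem (Finset.mem_union_right _ h)) s hs ε hε l hs1 hl1 hl
      exact ⟨linearIndependent_of_det_gram_ne_zero (hdet 2 le_rfl),
        pairing_gramSchmidtNormed hdet⟩
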